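/- Let $n\ge 3$ and $k\ge 2$. **The puzzle.** The cube $[0,k]^n$ is cut into $k^n$ unit cubies with positions $E_{j_1}\times\dots\times E_{j_n}$, $0\le j_i\le k-1$, $E_j=[j,j+1]$; put $\overline{E_j}=E_{k-1-j}$. A *layer* consists of all positions with prescribed factors on some set of axes, and a *layer rotation* $\psi_{i,j}$ ($i\neq j$ free axes of the layer) replaces the $i$-th factor $A_i$ by $\overline{A_j}$ and the $j$-th factor $A_j$ by $A_i$ for all cubies of the layer, moving their faces accordingly. Two cubies are *linked* if a sequence of layer rotations takes one to the position of the other; the equivalence classes are called *classes*. The number of factors $E_0,E_{k-1}$ of a cubie is denoted by $m$; its *outer axes* are those of these factors. For $2\le t\le n-1$, the $t$-dimensional faces of cubies that lie in a $t$-dimensional face of the big cube are painted, in the solved puzzle, in a colour that belongs to that face of the big cube (different faces have different colours). A *state* is any colouring that arises by redistributing the cubies within their classes, each being turned by a rotation of space (a signed permutation matrix of determinant $1$) so that its outer sides point outwards. Two states are *connected* if a sequence of layer rotations takes one to the other. A *cluster* is the set of all cubies of one class with the same colours, if it has more than one element. **Orientation.** The *orientation faces* of a cubie are its $m$ faces of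 dimension $n+1-m$ (one for each outer axis). For $m\ge1$ let $\overline G_{rot}\le S_m$ be the group of permutations of them produced by sequences of rotations that preserve the position of the cubie, and $Q=[\overline G_{rot},\overline G_{rot}]$. A class or cluster is *alternating* if $\overline G_{rot}=A_m$ and *symmetric* if $\overline G_{rot}=S_m$. In each class fix a base position $P$, number the orientation faces of each cubie so that cubies of one cluster are numbered alike according to their colours, and for each position choose a right orientation, obtained from that of $P$ by a sequence of rotations. The *orientation permutation* $\varphi\in S_m$ of a cubie sends $j$ to the number of the face standing where face $j$ should be. Fix for each class $\tau\in S_m$ such that for every $\varphi\in S_m$ one of $\varphi$, $\tau\varphi$ lies in $\overline G_{rot}$; put $\hat\varphi=\varphi$ if $\varphi\in\overline G_{rot}$ and $\hat\varphi=\tau\varphi$ otherwise. **Invariants.** * (odd $k$) The *frame* is the class of the $2n$ cubies with $m=1$ and all other factors equal to $E_{(k-1)/2}$. $B_1$ is the partition of the frame cubies into pairs standing at opposite positions. For each such partition fix a reference state with this partition; $B_2=\operatorname{sgn}(\sigma_c)\operatorname{sgn}(\sigma_p)$, where the state differs from the reference state with the same $B_1$ by the permutation $\sigma_c$ of the frame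 cubies and $\sigma_p$ of the pairs. * (odd $k$) $C=\prod_{m=1}^n\operatorname{sgn}(\sigma_m)$, where $\sigma_m$ is the permutation by which the positions of the cubies of the central class $(m,\frac{k-1}2,\dots,\frac{k-1}2)$ (with $m$ factors $E_0,E_{k-1}$ and all others equal to $E_{(k-1)/2}$) differ from those in a fixed reference state. * $O=\prod_i\hat\varphi_i\,Q\in\overline G_{rot}/Q$, the product over all cubies of a class, for each class with $Q\ne\overline G_{rot}$. * $Cl=\sum_i or_i$, the sum over all cubies of an alternating cluster with $m>1$, for each such cluster; here $or_i=1$ if a sequence of rotations takes the cubie to $P$ with the right orientation, and $or_i=0$ otherwise. **Theorem.** The choices above can be made, and for any such choices the system of invariants $B_1,B_2,C,O,Cl$ is complete: two states are connected if and only if all these invariants agree. The numbers of distinct values of the triple $(B_1,B_2,C)$, of the family of the $O$ of all alternating classes, of the family of the $O$ of all symmetric classes, and of the family of all $Cl$ are $BC$, $OA$, $OS$ and $Cl$, respectively, and the number of pairwise unconnected states is $$S(n,k)=BC(n,k)\cdot OA(n,k)\cdot OS(n,k)\cdot Cl(n,k),$$ where, with the convention that $\binom Ns=0$ if $N\le 0$,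 $s<0$ or $s>N$, $$BC(n,k)=\begin{cases}1,&k\text{ even},\\ \dfrac{(2n)!}{2^{n-2}\,n!},&k\text{ odd},\end{cases}$$ $$OA(n,k)=3^N,\quad N=\binom{[k/2]-1}{n-3}+\binom{[k/2]-1}{n-4}+c,\quad c=\begin{cases}1,&n\in\{3,4\}\text{ and }k\in\{2,3\},\\0,&\text{otherwise},\end{cases}$$ $$OS(n,k)=2^M,\quad M=\sum_{m=1}^{n-2}\binom{[\frac{k-1}2]+m-1}{[\frac{k-1}2]-1}-\sum_{m=1}^{n-2}\binom{[k/2]-1}{m},$$ $$Cl(n,k)=\prod_{m=1}^{n-2}(m!\cdot2^m+1)^{L(m)},\quad L(m)=\binom{[k/2]-1}{m}\binom nm 2^{n-m}.$$ -/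

import Mathlib

namespace Rubik

open Finset

/-! ### Positions, layers, rotations -/

/-- The position `E_{p 0} × ⋯ × E_{p (n-1)}` of a unit cubie, where `E_j = [j, j+1]`. A cubie is
named by the position it occupies in the solved puzzle. -/
abbrev Pos (n k : ℕ) := Fin n → Fin k

/-- The axes along which a cubie at position `p` touches the boundary of the big cube, that is,
those `l` for which the `l`-th factor is `E_0` or `E_{k-1}`. -/
def outer {n k : ℕ} (p : Pos n k) : Finset (Fin n) :=
  univ.filter fun l => (p l : ℕ) = 0 ∨ (p l : ℕ) + 1 = k

/-- The rule `A'_i = opposite of A_j`, `A'_j = A_i`, `A'_l = A_l` otherwise; the opposite of `E_a`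
is `E_{k-1-a}`. -/
def rotate {n k : ℕ} (i j : Fin n) (p : Pos n k) : Pos n k := fun l =>
  if l = i then (p j).rev else if l = j then p i else p l

/-- A rotation `ψ_{i,j}` of a layer. The layer consists of all positions that agree with `level`
on the coordinates outside `free`; its dimension is the cardinality of `free`. -/
structure LayerTurn (n k : ℕ) where
  free : Finset (Fin n)
  level : Pos n k
  i : Fin n
  j : Fin n
  i_mem : i ∈ free
  j_mem : j ∈ free
  i_ne_j : i ≠ j

open Classical in
/-- Where a layer rotation takes a cubie. -/
noncomputable def LayerTurn.pos {n k : ℕ} (t : LayerTurn n k) (p : Pos n k) : Pos n k :=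
  if ∀ l, l ∉ t.free → p l = t.level l then rotate t.i t.j p else p

open Classical in
/-- How a layer rotation moves the axes of a cubie at position `p`. -/
noncomputable def LayerTurn.axes {n k : ℕ} (t : LayerTurn n k) (p : Pos n k) :
    Equiv.Perm (Fin n) :=
  if ∀ l, l ∉ t.free → p l = t.level l then Equiv.swap t.i t.j else 1

/-- A combination: a finite sequence of layer rotations, performed from left to right. -/
abbrev Combination (n k : ℕ) := List (LayerTurn n k)

/-- Where a combination takes a cubie that is at `p`. -/
noncomputable def posAfter {n k : ℕ} : Combination n k → Pos n k → Pos n k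
  | [], p => p
  | t :: w, p => posAfter w (t.pos p)

/-- How a combination moves the axes of a cubie that is at `p`. -/
noncomputable def axesAfter {n k : ℕ} : Combination n k → Pos n k → Equiv.Perm (Fin n)
  | [], _ => 1
  | t :: w, p => axesAfter w (t.pos p) * t.axes p

/-- Two positions (or the cubies occupying them) are linked. -/
def Linked {n k : ℕ} (p q : Pos n k) : Prop := ∃ w : Combination n k, posAfter w p = q

theorem posAfter_append {n k : ℕ} (v w : Combination n k) (p : Pos n k) :
    posAfter (v ++ w) p = posAfter w (posAfter v p) := by
  induction v generalizing p with
  | nil => rfl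
  | cons t v ih => exact ih _

theorem rotate_rotate {n k : ℕ} {i j : Fin n} (h : i ≠ j) (p : Pos n k) :
    rotate j i (rotate i j p) = p := by
  funext l
  unfold rotate
  by_cases h1 : l = j
  · subst h1; simp
  · by_cases h2 : l = i
    · subst h2; simp [h, h.symm]
    · simp [h1, h2]

theorem Linked.refl {n k : ℕ} (p : Pos n k) : Linked p p := ⟨[], rfl⟩

theorem Linked.trans {n k : ℕ} {p q r : Pos n k} (h : Linked p q) (h' : Linked q r) :
    Linked p r := by
  obtain ⟨v, rfl⟩ := h
  obtain ⟨w, rfl⟩ := h'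
  exact ⟨v ++ w, posAfter_append v w p⟩

theorem linked_pos_symm {n k : ℕ} (t : LayerTurn n k) (p : Pos n k) : Linked (t.pos p) p := by
  by_cases h : ∀ l, l ∉ t.free → p l = t.level l
  · refine ⟨[⟨t.free, t.level, t.j, t.i, t.j_mem, t.i_mem, t.i_ne_j.symm⟩], ?_⟩
    have h2 : ∀ l, l ∉ t.free → rotate t.i t.j p l = t.level l := by
      intro l hl
      have h3 : l ≠ t.i := fun e => hl (e ▸ t.i_mem)
      have h4 : l ≠ t.j := fun e => hl (e ▸ t.j_mem)
      simp [rotate, h3, h4, h l hl]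
    simp only [posAfter, LayerTurn.pos, if_pos h]
    rw [if_pos h2, rotate_rotate t.i_ne_j]
  · exact ⟨[], by simp [posAfter, LayerTurn.pos, h]⟩

theorem Linked.symm {n k : ℕ} {p q : Pos n k} (h : Linked p q) : Linked q p := by
  obtain ⟨w, rfl⟩ := h
  induction w generalizing p with
  | nil => exact Linked.refl p
  | cons t w ih => exact (ih (p := t.pos p)).trans (linked_pos_symm t p)

/-- Linkedness as an equivalence relation. -/
def linkedSetoid (n k : ℕ) : Setoid (Pos n k) :=
  ⟨Linked, Linked.refl, Linked.symm, Linked.trans⟩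

/-- The classes of cubies: the equivalence classes of linkedness. -/
abbrev Cls (n k : ℕ) := Quotient (linkedSetoid n k)

/-- The class of a cubie. -/
abbrev cls {n k : ℕ} (p : Pos n k) : Cls n k := Quotient.mk (linkedSetoid n k) p

/-! ### Painted faces and colours -/

theorem outer_rev {k : ℕ} (a : Fin k) :
    ((a.rev : ℕ) = 0 ∨ (a.rev : ℕ) + 1 = k) ↔ ((a : ℕ) = 0 ∨ (a : ℕ) + 1 = k) := by
  rw [Fin.val_rev]; omega

theorem mem_outer_pos {n k : ℕ} (t : LayerTurn n k) (p : Pos n k) (l : Fin n) :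
    t.axes p l ∈ outer (t.pos p) ↔ l ∈ outer p := by
  unfold LayerTurn.axes LayerTurn.pos
  split_ifs with h
  · have key : ∀ (q : Pos n k) (x : Fin n),
        x ∈ outer q ↔ ((q x : ℕ) = 0 ∨ (q x : ℕ) + 1 = k) := by simp [outer]
    rw [key, key]
    by_cases h1 : l = t.i
    · subst h1; simp [rotate, t.i_ne_j.symm]
    · by_cases h2 : l = t.j
      · subst h2
        rw [Equiv.swap_apply_right, rotate, if_pos rfl]
        exact outer_rev _
      · simp [rotate, Equiv.swap_apply_of_ne_of_ne h1 h2, h1, h2]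
  · rfl

/-- A painted face of a cubie: the position of the cubie, and the set of axes whose factor `E_0` or
`E_{k-1}` is replaced by `{0}` or `{k}`. With `s` such axes its dimension is `t = n - s`, and
`2 ≤ t ≤ n - 1`. -/
structure Face (n k : ℕ) where
  pos : Pos n k
  axes : Finset (Fin n)
  subset_outer : axes ⊆ outer pos
  nonempty : axes.Nonempty
  card_add_two_le : #axes + 2 ≤ n

/-- The position of a painted face after a layer rotation. -/
noncomputable def LayerTurn.face {n k : ℕ} (t : LayerTurn n k) (f : Face n k) : Face n k where
  pos := t.pos f.pos
  axes := f.axes.map (t.axes f.pos).toEmbedding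
  subset_outer := by
    intro x hx
    obtain ⟨l, hl, rfl⟩ := Finset.mem_map.1 hx
    exact (mem_outer_pos t f.pos l).2 (f.subset_outer hl)
  nonempty := f.nonempty.map
  card_add_two_le := by simpa using f.card_add_two_le

/-- The position of a painted face after a combination. -/
noncomputable def faceAfter {n k : ℕ} : Combination n k → Face n k → Face n k
  | [], f => f
  | t :: w, f => faceAfter w (t.face f)

/-- The colours are the faces of the big cube. Such a face is described by its coordinates: `none`
where it is `[0, k]`, `some 0` where it is `{0}`, and `some (k-1)` where it is `{k}`. -/
abbrev Colour (n k : ℕ) := Fin n → Option (Fin k)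

/-- The colour of a face in the solved puzzle: the face of the big cube that contains it and has the
same dimension. -/
def Face.colour {n k : ℕ} (f : Face n k) : Colour n k := fun l =>
  if l ∈ f.axes then some (f.pos l) else none

/-- The set of colours of a cubie. -/
def colours {n k : ℕ} (p : Pos n k) : Set (Colour n k) :=
  {c | ∃ f : Face n k, f.pos = p ∧ f.colour = c}

/-! ### Assemblies and states -/

/-- A way to put the puzzle together from its cubies. Each cubie `p` is put at a position `place p`
of its own class. It is turned there by a rotation of space (the signed permutation matrix with
underlying permutation `σ` and signs `ε`, of determinant `1`) that points its outer sides outwards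
again; `face p` tells to which axis each of its outer axes is turned. -/
structure Assembly (n k : ℕ) where
  place : Equiv.Perm (Pos n k)
  linked_place : ∀ p, Linked p (place p)
  face : ∀ p, outer p ≃ outer (place p)
  rigid : ∀ p, ∃ (σ : Equiv.Perm (Fin n)) (ε : Fin n → ℤˣ),
    Equiv.Perm.sign σ * ∏ l, ε l = 1 ∧
    ∀ l : outer p, (face p l : Fin n) = σ l ∧
      place p (σ l) = if ε l = 1 then p l else (p l).rev

/-- A distribution of colours over the positions of painted faces. -/
abbrev Colouring (n k : ℕ) := Face n k → Colour n k

open Classical in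
/-- The colours seen on an assembly. If the cubie at the position of the face `f` is `p`, then `f` is
occupied by the face of `p` on the axes `l` with `face p l ∈ f.axes`. -/
noncomputable def Assembly.paint {n k : ℕ} (a : Assembly n k) : Colouring n k := fun f l =>
  if ∃ h : l ∈ outer (a.place.symm f.pos),
      ((a.face (a.place.symm f.pos) ⟨l, h⟩ : Fin n)) ∈ f.axes
    then some (a.place.symm f.pos l) else none

/-- The states of the puzzle. -/
abbrev State (n k : ℕ) := {c : Colouring n k // ∃ a : Assembly n k, a.paint = c}

/-- The colouring `d` is obtained from `c` by a combination. -/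
def Connected {n k : ℕ} (c d : Colouring n k) : Prop :=
  ∃ w : Combination n k, ∀ f, d (faceAfter w f) = c f

/-! ### Rotation groups, clusters -/

/-- The dependent rotation group of a cubie at position `P`: the permutations of its orientation faces
that are produced by combinations preserving its position. The orientation faces are the
`(n+1-m)`-dimensional ones, `m` being the number of outer axes; each leaves exactly one outer axis
unreplaced and is named by that axis. -/
def depGroup {n k : ℕ} (P : Pos n k) : Subgroup (Equiv.Perm (outer P)) :=
  Subgroup.closure {π | ∃ w : Combination n k, posAfter w P = P ∧
    ∀ l : outer P, (π l : Fin n) = axesAfter w P l}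

open Classical in
/-- All cubies of the class of `p` with the same colours as `p`. -/
noncomputable def cluster {n k : ℕ} (p : Pos n k) : Finset (Pos n k) :=
  univ.filter fun q => Linked p q ∧ colours q = colours p

/-- The nontrivial alternating clusters: they have more than one cubie, each cubie has more than one
orientation face, and the dependent rotation group is alternating. -/
def IsAltCluster {n k : ℕ} (s : Finset (Pos n k)) : Prop :=
  ∃ p, s = cluster p ∧ 1 < #s ∧ 1 < #(outer p) ∧ depGroup p = alternatingGroup (outer p)

/-! ### Central classes and the frame -/

/-- The cubies of the central class `(m, (k-1)/2, …, (k-1)/2)`. The middle index `(k-1)/2` is the one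
with `rev j = j`. For `m = 1` this is the frame. -/
def IsCentral {n k : ℕ} (m : ℕ) (p : Pos n k) : Prop :=
  #(outer p) = m ∧ ∀ l, l ∉ outer p → (p l).rev = p l

theorem outer_pos {n k : ℕ} (t : LayerTurn n k) (p : Pos n k) :
    outer (t.pos p) = (outer p).map (t.axes p).toEmbedding := by
  ext x
  obtain ⟨l, rfl⟩ := (t.axes p).surjective x
  rw [mem_outer_pos]
  simp

theorem IsCentral.pos {n k m : ℕ} {p : Pos n k} (h : IsCentral m p) (t : LayerTurn n k) :
    IsCentral m (t.pos p) := by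
  refine ⟨by rw [outer_pos, card_map]; exact h.1, ?_⟩
  intro x hx
  obtain ⟨l, rfl⟩ := (t.axes p).surjective x
  rw [mem_outer_pos] at hx
  have hl := h.2 l hx
  unfold LayerTurn.axes LayerTurn.pos
  split_ifs with h0
  · unfold rotate
    by_cases h1 : l = t.i
    · subst h1; simp [t.i_ne_j.symm, hl]
    · by_cases h2 : l = t.j
      · subst h2; simp [hl]
      · simp [Equiv.swap_apply_of_ne_of_ne h1 h2, h1, h2, hl]
  · exact hl

theorem IsCentral.of_linked {n k m : ℕ} {p q : Pos n k} (h : IsCentral m p) (hpq : Linked p q) :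
    IsCentral m q := by
  obtain ⟨w, rfl⟩ := hpq
  induction w generalizing p with
  | nil => exact h
  | cons t w ih => exact ih (h.pos t)

/-- The permutation of the central class `m` by which the assembly `a` differs from `r`. -/
def centralPerm {n k : ℕ} (m : ℕ) (r a : Assembly n k) :
    Equiv.Perm {p : Pos n k // IsCentral m p} :=
  Equiv.Perm.subtypePerm (r.place.symm.trans a.place) fun x => by
    have h : Linked x (a.place (r.place.symm x)) := by
      have h1 := r.linked_place (r.place.symm x)
      rw [Equiv.apply_symm_apply] at h1
      exact h1.symm.trans (a.linked_place _)
    exact ⟨fun hx => hx.of_linked h.symm, fun hx => hx.of_linked h⟩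

/-- The permutation of the pairs of opposite frame cubies by which `a` differs from `r`, when both
have the same pairs; a pair occupies the two ends of an axis, so this is a permutation of axes. -/
noncomputable def pairPerm {n k : ℕ} (r a : Assembly n k) : Equiv.Perm (Fin n) :=
  Classical.epsilon fun τ : Equiv.Perm (Fin n) => ∀ p : Pos n k, IsCentral 1 p →
    outer (a.place p) = (outer (r.place p)).map τ.toEmbedding

/-- The first frame invariant: the partition of the frame cubies into pairs standing at opposite
positions. -/
def B₁ {n k : ℕ} (a : Assembly n k) : Set (Set (Pos n k)) :=
  {s | ∃ q : Pos n k, IsCentral 1 q ∧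
    s = {a.place.symm q, a.place.symm fun l => (q l).rev}}

/-! ### Reference data and the remaining invariants -/

/-- The arbitrary choices on which the invariants depend. -/
structure Reference (n k : ℕ) where
  /-- The reference state for the central invariant. -/
  central : Assembly n k
  /-- A reference state of the frame for each partition into pairs. -/
  frame : Set (Set (Pos n k)) → Assembly n k
  B₁_frame : ∀ a : Assembly n k, B₁ (frame (B₁ a)) = B₁ a
  /-- A distinguished position in each class. -/
  base : Cls n k → Pos n k
  cls_base : ∀ K, cls (base K) = K
  /-- The right orientation of each position: where the orientation face with a given number should
  be. The numbers are the orientation faces of the base position. Each right orientation is carried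
  over from the base position by a combination. -/
  right : ∀ (K : Cls n k) (q : Pos n k), cls q = K → (outer (base K) ≃ outer q)
  right_spec : ∀ K q h, ∃ w : Combination n k, posAfter w (base K) = q ∧
    ∀ l : outer (base K), (right K q h l : Fin n) = axesAfter w (base K) l
  /-- The numbering of the orientation faces of each cubie, according to their colours. -/
  number : ∀ (K : Cls n k) (p : Pos n k), cls p = K → (outer (base K) ≃ outer p)
  number_spec : ∀ K p q hp hq, colours p = colours q →
    ∀ l, (number K p hp l : Fin n) = (number K q hq l : Fin n)
  /-- A second numbering, got by applying `other K`, for those cubies whose orientation permutation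
  would not lie in the dependent rotation group otherwise. -/
  other : ∀ K : Cls n k, Equiv.Perm (outer (base K))
  other_spec : ∀ K φ, φ ∈ depGroup (base K) ∨ other K * φ ∈ depGroup (base K)

theorem cls_place {n k : ℕ} (a : Assembly n k) {K : Cls n k} {p : Pos n k} (h : cls p = K) :
    cls (a.place p) = K := by
  rw [← h]
  exact Quotient.sound (s := linkedSetoid n k) (a.linked_place p).symm

namespace Reference

variable {n k : ℕ} (R : Reference n k)

open Classical in
/-- The second frame invariant, present for odd `k`. -/
noncomputable def B₂ (a : Assembly n k) : ℤˣ :=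
  if Odd k then Equiv.Perm.sign (centralPerm 1 (R.frame (B₁ a)) a) *
    Equiv.Perm.sign (pairPerm (R.frame (B₁ a)) a) else 1

open Classical in
/-- The central invariant, present for odd `k`. -/
noncomputable def C (a : Assembly n k) : ℤˣ :=
  if Odd k then ∏ m ∈ Icc 1 n, Equiv.Perm.sign (centralPerm m R.central a) else 1

/-- The orientation permutation of the cubie `p`: it sends `j` to the number of the face that stands
where the face number `j` should be. -/
def orientation (a : Assembly n k) (K : Cls n k) (p : Pos n k) (h : cls p = K) :
    Equiv.Perm (outer (R.base K)) :=
  ((R.right K (a.place p) (cls_place a h)).trans (a.face p).symm).trans (R.number K p h).symm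

open Classical in
/-- The orientation permutation, with respect to a numbering for which it lies in the dependent
rotation group. -/
noncomputable def depOrientation (a : Assembly n k) (K : Cls n k) (p : Pos n k) (h : cls p = K) :
    depGroup (R.base K) :=
  if hφ : R.orientation a K p h ∈ depGroup (R.base K) then ⟨R.orientation a K p h, hφ⟩
  else ⟨R.other K * R.orientation a K p h, (R.other_spec K _).resolve_left hφ⟩

open Classical in
/-- The orientation invariant of a class: the product of the orientation permutations of all its
cubies, in the dependent rotation group modulo its commutator subgroup. -/
noncomputable def O (K : Cls n k) (a : Assembly n k) : Abelianization (depGroup (R.base K)) :=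
  ∏ p : {p : Pos n k // cls p = K}, Abelianization.of (R.depOrientation a K p p.2)

/-- The orientation invariant is present for the classes whose dependent rotation group differs from
its commutator subgroup. -/
def HasO (K : Cls n k) : Prop := commutator (depGroup (R.base K)) ≠ ⊤

open Classical in
/-- The simplified orientation of a cubie: `1` if some combination takes it to the base position with
the right orientation there, and `0` otherwise. -/
noncomputable def simpleOrientation (a : Assembly n k) (p : Pos n k) : ℕ :=
  if ∃ w : Combination n k, posAfter w (a.place p) = R.base (cls p) ∧
      ∀ l : outer (R.base (cls p)),
        axesAfter w (a.place p) (a.face p (R.number (cls p) p rfl l)) =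
          (R.right (cls p) (R.base (cls p)) (R.cls_base _) l : Fin n)
    then 1 else 0

/-- The cluster invariant of a cluster `s`. -/
noncomputable def Cl (s : Finset (Pos n k)) (a : Assembly n k) : ℕ :=
  ∑ p ∈ s, R.simpleOrientation a p

/-- All the invariants of the system agree. -/
def SameInvariants (a b : Assembly n k) : Prop :=
  B₁ a = B₁ b ∧ R.B₂ a = R.B₂ b ∧ R.C a = R.C b ∧
  (∀ K, R.HasO K → R.O K a = R.O K b) ∧
  (∀ s, IsAltCluster s → R.Cl s a = R.Cl s b)

end Reference

/-! ### The formulas -/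

/-- The binomial coefficient, with the convention that it vanishes for `N ≤ 0`, `s < 0`, `s > N`. -/
def binom (N s : ℤ) : ℕ := if 0 < N ∧ 0 ≤ s then N.toNat.choose s.toNat else 0

def countBC (n k : ℕ) : ℕ :=
  if Even k then 1 else (2 * n).factorial / (2 ^ (n - 2) * n.factorial)

def countOA (n k : ℕ) : ℕ :=
  3 ^ (binom ((k / 2 : ℕ) - 1) (n - 3) + binom ((k / 2 : ℕ) - 1) (n - 4) +
    if (n = 3 ∨ n = 4) ∧ k ≤ 3 then 1 else 0)

def countOS (n k : ℕ) : ℕ :=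
  2 ^ (∑ m ∈ Icc 1 (n - 2), binom (((k - 1) / 2 : ℕ) + m - 1) (((k - 1) / 2 : ℕ) - 1) -
    ∑ m ∈ Icc 1 (n - 2), binom ((k / 2 : ℕ) - 1) m)

def countCl (n k : ℕ) : ℕ :=
  ∏ m ∈ Icc 1 (n - 2), (m.factorial * 2 ^ m + 1) ^
    (binom ((k / 2 : ℕ) - 1) m * binom n m * 2 ^ (n - m))

end Rubik

/-! A combination moves a single cubie as a rotation of space does, and turns of the whole cube
already realize every signed permutation of determinant 1 (`realizable`). Linkedness and the
dependent rotation group are therefore questions about signed permutations. The sign on an outer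
axis is forced by the two sides involved, and these signs multiply to 1 when the position is
preserved. The determinant then restricts the outer axes to even permutations, unless the inner
factors can compensate: by a self-opposite factor, whose sign is free, or by two factors equal up to
opposites, which can be exchanged. So the group is `A_m` for chiral cubies and `S_m` for all others
(`depGroup_of_chiral`, `depGroup_of_not_chiral`).

There are many moves. Every layer rotation is a product of rotations of planes. The commutator of a
rotation of a plane with a conjugated rotation of a parallel plane, chosen so that the supports meet
in one position only, cycles three cubies and fixes all others (`exists_cycle`). The effect of any
rotation of a plane on one cubie is the beginning of such a 3-cycle, so the 3-cycles connect all
oriented positions of a class. In the wreath product over at least five cubies, a connected family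
of pure 3-cycles generates every element with an even permutation of the cubies and a total twist
that is trivial in the abelianization (`shear_mem_of_connected`). Hence each class, except the
frame, is obstructed only by one sign and by one element of the abelianized rotation group.

Invariance comes from orbit lengths. A layer rotation has orbits of lengths 1 and 4 and its fourth
power is trivial, so it does not change `O`. Whether the orientation permutation of a cubie lies in
the dependent group never changes, but cubies of one cluster are indistinguishable, so only the
number of such cubies in a cluster is visible; this is `Cl`. A rotation of a plane is odd on exactly
two consecutive central classes or on none, which gives `C`. On the frame it is trivial, or a
4-cycle that transposes two axes, which gives `B₁` and `B₂`.

For completeness, a rotation of the whole cube matches the frame, and exchanging cubies of equal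
colours matches the parities in every cluster. The signs of the classes are corrected next. A class
with two cubies of equal colours and equal parity can change its sign for free. The remaining
classes are central or have exactly one inner factor; they are ranked so that some rotation changes
the sign at one rank and fixes all cubies of lower rank, and for odd `k` the corners are settled by
`C`. What is left is treated class by class.

For the count, places and orientations can be prescribed independently, because a cubie with an
inner factor can be put in with any orientation. So the number of states is the product of the
numbers of values. The partitions `B₁` form a conjugacy class of involutions; classes with at least
two outer axes correspond to multisets of kinds of inner factors, and the chiral ones to sets. -/

namespace Rubik

open Finset

/-! ### Subgroups of wreath products generated by pure 3-cycles -/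

section Wreath

variable {K F D : Type*} [Group D] [MulAction D F]

/-- The permutation `(x, l) ↦ (π x, d x • l)` of `K × F`. -/
def shear (π : Equiv.Perm K) (d : K → D) : Equiv.Perm (K × F) where
  toFun x := (π x.1, d x.1 • x.2)
  invFun x := (π⁻¹ x.1, (d (π⁻¹ x.1))⁻¹ • x.2)
  left_inv x := by simp
  right_inv x := by simp

theorem shear_apply (π : Equiv.Perm K) (d : K → D) (x : K) (l : F) :
    shear π d (x, l) = (π x, d x • l) := rfl

theorem shear_mul (π ρ : Equiv.Perm K) (d e : K → D) :
    (shear π d * shear ρ e : Equiv.Perm (K × F)) = shear (π * ρ) fun x => d (ρ x) * e x := by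
  ext x : 1
  simp [shear, mul_smul]

theorem shear_one : (shear 1 (1 : K → D) : Equiv.Perm (K × F)) = 1 :=
  Equiv.ext fun x => by simp [shear]

/-- The elements of the base group of the wreath product that act by elements of `N`. -/
def baseSubgroup (N : Subgroup (Equiv.Perm (K × F))) : Subgroup (K → D) where
  carrier := {d | shear 1 d ∈ N}
  one_mem' := by simp [shear_one, N.one_mem]
  mul_mem' := fun {a b} ha hb => by
    have := N.mul_mem ha hb
    rwa [shear_mul] at this
  inv_mem' := fun {a} ha => by
    have h : (shear 1 a : Equiv.Perm (K × F))⁻¹ = shear 1 a⁻¹ := by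
      rw [inv_eq_iff_mul_eq_one, shear_mul, ← shear_one (D := D)]
      congr 1
      funext x; simp
    have := N.inv_mem ha
    rwa [h] at this

theorem mem_baseSubgroup {N : Subgroup (Equiv.Perm (K × F))} {d : K → D} :
    d ∈ baseSubgroup N ↔ shear 1 d ∈ N := Iff.rfl

/-- `g` permutes three fibres cyclically by `a ↦ b ↦ c ↦ a` and fixes all other fibres. -/
def IsPureCycle (g : Equiv.Perm (K × F)) (a b c : K × D) : Prop :=
  (∀ l, g (a.1, a.2 • l) = (b.1, b.2 • l)) ∧ (∀ l, g (b.1, b.2 • l) = (c.1, c.2 • l)) ∧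
  (∀ l, g (c.1, c.2 • l) = (a.1, a.2 • l)) ∧
  ∀ u l, u ≠ a.1 → u ≠ b.1 → u ≠ c.1 → g (u, l) = (u, l)

/-- The pure cycle of three points in different fibres lies in `N`. -/
def HasCycle (N : Subgroup (Equiv.Perm (K × F))) (a b c : K × D) : Prop :=
  a.1 ≠ b.1 ∧ b.1 ≠ c.1 ∧ c.1 ≠ a.1 ∧ ∃ g ∈ N, IsPureCycle g a b c

variable {N : Subgroup (Equiv.Perm (K × F))} {a b c p q r : K × D}

theorem HasCycle.rot (h : HasCycle N a b c) : HasCycle N b c a := by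
  obtain ⟨h1, h2, h3, g, hg, g1, g2, g3, g4⟩ := h
  exact ⟨h2, h3, h1, g, hg, g2, g3, g1, fun u l ha hb hc => g4 u l hc ha hb⟩

theorem HasCycle.flip (h : HasCycle N a b c) : HasCycle N b a c := by
  obtain ⟨h1, h2, h3, g, hg, g1, g2, g3, g4⟩ := h
  refine ⟨h1.symm, h3.symm, h2.symm, g⁻¹, N.inv_mem hg, ?_, ?_, ?_, ?_⟩
  · intro l; rw [Equiv.Perm.inv_eq_iff_eq, g1]
  · intro l; rw [Equiv.Perm.inv_eq_iff_eq, g3]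
  · intro l; rw [Equiv.Perm.inv_eq_iff_eq, g2]
  · intro u l ha hb hc; rw [Equiv.Perm.inv_eq_iff_eq, g4 u l hb ha hc]

/-- Right translation of a point. -/
def rightMul (a : K × D) (δ : D) : K × D := (a.1, a.2 * δ)

/-- A pure cycle is a triple of bijections between fibres, so it depends on its three points only up
to a common right translation. This is used to make a cycle over given fibres pass through a given
point. -/
theorem HasCycle.rightMul (h : HasCycle N a b c) (δ : D) :
    HasCycle N (rightMul a δ) (rightMul b δ) (rightMul c δ) := by
  obtain ⟨h1, h2, h3, g, hg, g1, g2, g3, g4⟩ := h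
  exact ⟨h1, h2, h3, g, hg, fun l => by simp [Rubik.rightMul, mul_smul, g1],
    fun l => by simp [Rubik.rightMul, mul_smul, g2],
    fun l => by simp [Rubik.rightMul, mul_smul, g3], g4⟩

open Classical in
/-- The action of the pure cycle `p ↦ q ↦ r ↦ p` on points. -/
noncomputable def cycleMove (p q r a : K × D) : K × D :=
  if a.1 = p.1 then (q.1, q.2 * p.2⁻¹ * a.2) else
  if a.1 = q.1 then (r.1, r.2 * q.2⁻¹ * a.2) else
  if a.1 = r.1 then (p.1, p.2 * r.2⁻¹ * a.2) else a

theorem IsPureCycle.apply {g : Equiv.Perm (K × F)} (h : IsPureCycle g p q r) (a : K × D) (l : F) :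
    g (a.1, a.2 • l) = ((cycleMove p q r a).1, (cycleMove p q r a).2 • l) := by
  obtain ⟨g1, g2, g3, g4⟩ := h
  unfold cycleMove
  split_ifs with h1 h2 h3
  · have := g1 (p.2⁻¹ • a.2 • l)
    rw [smul_inv_smul] at this
    rw [h1, this, mul_smul, mul_smul]
  · have := g2 (q.2⁻¹ • a.2 • l)
    rw [smul_inv_smul] at this
    rw [h2, this, mul_smul, mul_smul]
  · have := g3 (r.2⁻¹ • a.2 • l)
    rw [smul_inv_smul] at this
    rw [h3, this, mul_smul, mul_smul]
  · exact g4 _ _ h1 h2 h3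

/-- Conjugation carries a pure cycle to the cycle of the moved points. The motion is a left
multiplication on the second coordinate, so it is compatible with evaluation at every `l`. -/
theorem HasCycle.conj (h : HasCycle N a b c) (h' : HasCycle N p q r) :
    HasCycle N (cycleMove p q r a) (cycleMove p q r b) (cycleMove p q r c) := by
  obtain ⟨h1, h2, h3, g, hg, g1, g2, g3, g4⟩ := h
  obtain ⟨p1, p2, p3, k, hk, hk'⟩ := h'
  have key := hk'.apply
  have inj : ∀ a b : K × D, a.1 ≠ b.1 → (cycleMove p q r a).1 ≠ (cycleMove p q r b).1 := by
    intro a b hab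
    unfold cycleMove
    split_ifs <;> grind
  refine ⟨inj _ _ h1, inj _ _ h2, inj _ _ h3, k * g * k⁻¹,
    N.mul_mem (N.mul_mem hk hg) (N.inv_mem hk), ?_, ?_, ?_, ?_⟩
  · intro l; simp [← key, g1]
  · intro l; simp [← key, g2]
  · intro l; simp [← key, g3]
  · intro u l ha hb hc
    have hfib : ∀ a : K × D, u ≠ (cycleMove p q r a).1 → (k⁻¹ (u, l)).1 ≠ a.1 := by
      intro a ha e
      apply ha
      have h5 := key ((k⁻¹ (u, l)).1, a.2) (a.2⁻¹ • (k⁻¹ (u, l)).2)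
      rw [smul_inv_smul] at h5
      have h6 := congrArg Prod.fst h5
      rw [show k (((k⁻¹ (u, l)).1, a.2).1, (k⁻¹ (u, l)).2) = (u, l) from
        Equiv.apply_symm_apply k _] at h6
      simp only at h6
      rw [h6, e]

    have := g4 (k⁻¹ (u, l)).1 (k⁻¹ (u, l)).2 (hfib a ha) (hfib b hb) (hfib c hc)
    simp only [Prod.mk.eta] at this
    rw [Equiv.Perm.mul_apply, Equiv.Perm.mul_apply, this]
    exact Equiv.apply_symm_apply k _

/-- Conjugation by the second cycle takes `r` to `s` and does not touch the fibres of `p` and `q`;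
one point of a cycle is thus replaced by another. -/
theorem HasCycle.move {s t : K × D} (h : HasCycle N p q r) (h' : HasCycle N r s t)
    (h1 : p.1 ≠ s.1) (h2 : p.1 ≠ t.1) (h3 : q.1 ≠ s.1) (h4 : q.1 ≠ t.1) : HasCycle N p q s := by
  have := h.conj h'
  obtain ⟨e1, e2, e3, -⟩ := h
  have a1 : cycleMove r s t p = p := by simp [cycleMove, e3.symm, h1, h2]
  have a2 : cycleMove r s t q = q := by simp [cycleMove, e2, h3, h4]
  have a3 : cycleMove r s t r = s := by simp [cycleMove]
  rwa [a1, a2, a3] at this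

/-- Some pure cycle over the fibres `x`, `y`, `z` lies in `N`. -/
def HasFibreCycle (D : Type*) [Group D] [MulAction D F] (N : Subgroup (Equiv.Perm (K × F)))
    (x y z : K) : Prop :=
  ∃ a b c : D, HasCycle N (x, a) (y, b) (z, c)

theorem HasFibreCycle.rot {x y z : K} : HasFibreCycle D N x y z → HasFibreCycle D N y z x :=
  fun ⟨a, b, c, h⟩ => ⟨b, c, a, h.rot⟩

theorem HasFibreCycle.flip {x y z : K} : HasFibreCycle D N x y z → HasFibreCycle D N y x z :=
  fun ⟨a, b, c, h⟩ => ⟨b, a, c, h.flip⟩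

theorem HasFibreCycle.ne {x y z : K} : HasFibreCycle D N x y z → x ≠ y ∧ y ≠ z ∧ z ≠ x :=
  fun ⟨_, _, _, h⟩ => ⟨h.1, h.2.1, h.2.2.1⟩

open Classical in
theorem HasFibreCycle.conj {x y z u v w : K} :
    HasFibreCycle D N x y z → HasFibreCycle D N u v w →
    HasFibreCycle D N (if x = u then v else if x = v then w else if x = w then u else x)
      (if y = u then v else if y = v then w else if y = w then u else y)
      (if z = u then v else if z = v then w else if z = w then u else z) := by
  rintro ⟨a, b, c, h⟩ ⟨d, e, f, h'⟩
  have key : ∀ x (a : D), (cycleMove (u, d) (v, e) (w, f) (x, a)).1 =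
      if x = u then v else if x = v then w else if x = w then u else x := by
    intro x a; unfold cycleMove; split_ifs <;> simp_all
  rw [← key x a, ← key y b, ← key z c]
  exact ⟨_, _, _, h.conj h'⟩

/-- Conjugation by the second cycle fixes `x` and takes `y` to `z`, unless `a = z` or `b = x`, when
one of the given cycles already runs through `x` and `z`. -/
theorem HasFibreCycle.trans {x y z a b : K} (h : HasFibreCycle D N x y a)
    (h' : HasFibreCycle D N y z b) (hxz : x ≠ z) : ∃ e, HasFibreCycle D N x z e := by
  have hn := h.ne
  have hn' := h'.ne
  by_cases h1 : a = z
  · subst h1; exact ⟨y, h.rot.rot.flip⟩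
  by_cases h2 : b = x
  · subst h2; exact ⟨y, h'.rot.flip⟩
  have := h.conj h'
  rw [if_neg hn.1, if_neg hxz, if_neg (Ne.symm h2), if_pos rfl] at this
  exact ⟨_, this⟩

/-- The second cycle takes `a` to `u`. If its third fibre `v` is `x` or `y`, conjugation by the
inverse cycle gives the same three fibres in another order. -/
theorem HasFibreCycle.third {x y a u v : K} (h : HasFibreCycle D N x y a)
    (h' : HasFibreCycle D N a u v) (hx : u ≠ x) (hy : u ≠ y) : HasFibreCycle D N x y u := by
  have hn := h.ne
  have hn' := h'.ne
  by_cases h1 : v = x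
  · subst h1
    have := h.conj h'.flip
    simp only [hn.1.symm, hx.symm, hn.2.1, hn.2.2.symm, hy.symm, if_true, if_false, hn'.1] at this
    exact this.rot.flip
  by_cases h2 : v = y
  · subst h2
    have := h.conj h'.flip
    simp only [hn.1, hx.symm, hn.2.1, hn.2.2.symm, hy.symm, if_true, if_false, hn'.1] at this
    exact this.rot.rot.flip
  have := h.conj h'
  simpa only [hn.2.2.symm, hn.2.1, hx.symm, hy.symm, Ne.symm h1, Ne.symm h2, if_true,
    if_false] using this

/-- One step along the pure cycles in `N`. -/
def CycleStep (N : Subgroup (Equiv.Perm (K × F))) (a b : K × D) : Prop :=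
  ∃ c, HasCycle N a b c

theorem exists_notMem_of_five_le [Fintype K] (hK : 5 ≤ Fintype.card K) (x y z w : K) :
    ∃ u : K, u ≠ x ∧ u ≠ y ∧ u ≠ z ∧ u ≠ w := by
  classical
  have h : #({x, y, z, w} : Finset K) ≤ 4 := Finset.card_le_four
  obtain ⟨u, hu⟩ := Finset.exists_mem_notMem_of_card_lt_card
    (s := {x, y, z, w}) (t := univ) (by rw [Finset.card_univ]; omega)
  exact ⟨u, by simpa using hu.2⟩

theorem exists_third [Fintype K] (hK : 5 ≤ Fintype.card K) (x y : K) : ∃ u : K, u ≠ x ∧ u ≠ y :=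
  (exists_notMem_of_five_le hK x y y y).imp fun _ h => ⟨h.1, h.2.1⟩

/-! ### Connected families of pure cycles contain all pure cycles. -/

section Connected

/-- Follow a path from the fibre of `x` to that of `y`, keeping a cycle through `x` and the current
fibre; whenever the path is back over `x`, the next step supplies a new one. -/
theorem exists_fibreCycle (hconn : ∀ a b : K × D, Relation.ReflTransGen (CycleStep N) a b)
    {x y : K} (hxy : x ≠ y) : ∃ z, HasFibreCycle D N x y z := by
  have key : ∀ b : K × D, Relation.ReflTransGen (CycleStep N) (x, (1 : D)) b →
      x ≠ b.1 → ∃ z, HasFibreCycle D N x b.1 z := by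
    intro b hb
    induction hb with
    | refl => exact fun h => absurd rfl h
    | @tail b c _ hbc ih =>
      intro hc
      obtain ⟨e, he⟩ := hbc
      by_cases hxb : x = b.1
      · exact ⟨e.1, b.2, c.2, e.2, by rw [hxb]; exact he⟩
      · obtain ⟨z, hz⟩ := ih hxb
        exact hz.trans (b := e.1) ⟨b.2, c.2, e.2, he⟩ hc
  exact key (y, 1) (hconn _ _) hxy

theorem hasFibreCycle (hconn : ∀ a b : K × D, Relation.ReflTransGen (CycleStep N) a b)
    {x y u : K} (hxy : x ≠ y) (hyu : y ≠ u) (hux : u ≠ x) : HasFibreCycle D N x y u := by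
  obtain ⟨a, ha⟩ := exists_fibreCycle hconn hxy
  by_cases hau : a = u
  · exact hau ▸ ha
  obtain ⟨v, hv⟩ := exists_fibreCycle hconn hau
  exact ha.third hv hux hyu.symm

variable [Fintype K]

/-- The third point of a cycle can be put over any remaining fibre `u`. A fifth fibre `v` is used: a
cycle over the old third fibre, `u` and `v`, translated so that it passes through the old third
point, moves that point over `u` and avoids `a` and `b`. -/
theorem CycleStep.third (hK : 5 ≤ Fintype.card K)
    (hconn : ∀ a b : K × D, Relation.ReflTransGen (CycleStep N) a b)
    {a b : K × D} (h : CycleStep N a b) {u : K} (ha : u ≠ a.1)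
    (hb : u ≠ b.1) : ∃ δ, HasCycle N a b (u, δ) := by
  obtain ⟨c, hc⟩ := h
  by_cases hcu : c.1 = u
  · exact ⟨c.2, by rw [← hcu]; exact hc⟩
  obtain ⟨v, hv1, hv2, hv3, hv4⟩ := exists_notMem_of_five_le hK a.1 b.1 c.1 u
  obtain ⟨d, e, f, h⟩ := hasFibreCycle hconn hcu hv4.symm hv3
  have h' := h.rightMul (d⁻¹ * c.2)
  have hd : rightMul (c.1, d) (d⁻¹ * c.2) = c := by simp [rightMul]
  rw [hd] at h'
  exact ⟨_, hc.move h' ha.symm hv1.symm hb.symm hv2.symm⟩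

/-- The auxiliary points of the two steps are first put over different new fibres `u` and `v`; then
the second cycle moves `b` to `c` and fixes the other two points of the first. -/
theorem CycleStep.trans (hK : 5 ≤ Fintype.card K)
    (hconn : ∀ a b : K × D, Relation.ReflTransGen (CycleStep N) a b)
    {a b c : K × D} (h : CycleStep N a b) (h' : CycleStep N b c)
    (hac : a.1 ≠ c.1) : CycleStep N a c := by
  obtain ⟨_, hab⟩ := h
  obtain ⟨_, hbc⟩ := h'
  obtain ⟨u, hu1, hu2, hu3, -⟩ := exists_notMem_of_five_le hK a.1 b.1 c.1 c.1
  obtain ⟨v, hv1, hv2, hv3, hv4⟩ := exists_notMem_of_five_le hK a.1 b.1 c.1 u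
  obtain ⟨δ, h1⟩ := CycleStep.third hK hconn ⟨_, hab⟩ hu1 hu2
  obtain ⟨ε, h2⟩ := CycleStep.third hK hconn ⟨_, hbc⟩ hv2 hv3
  exact ⟨_, (h1.rot.rot.flip.move h2 hac hv1.symm hu3 hv4.symm).rot.rot.flip⟩

/-- Two points, possibly in the same fibre, have a common neighbour in another fibre. -/
def CycleLinked (N : Subgroup (Equiv.Perm (K × F))) (a b : K × D) : Prop :=
  ∃ m : K × D, m.1 ≠ a.1 ∧ m.1 ≠ b.1 ∧ CycleStep N a m ∧ CycleStep N m b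

theorem CycleStep.linked (hK : 5 ≤ Fintype.card K)
    (hconn : ∀ a b : K × D, Relation.ReflTransGen (CycleStep N) a b)
    {a b : K × D} (h : CycleStep N a b) : CycleLinked N a b := by
  obtain ⟨u, h1, h2, -⟩ := exists_notMem_of_five_le hK a.1 b.1 b.1 b.1
  obtain ⟨δ, hδ⟩ := h.third hK hconn h1 h2
  exact ⟨_, h1, h2, ⟨_, hδ.rot.rot.flip⟩, ⟨_, hδ.rot.flip⟩⟩

theorem CycleLinked.exists_over (hK : 5 ≤ Fintype.card K)
    (hconn : ∀ a b : K × D, Relation.ReflTransGen (CycleStep N) a b)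
    {a b : K × D} (h : CycleLinked N a b) {u : K} (ha : u ≠ a.1) (hb : u ≠ b.1) :
    ∃ δ, CycleStep N a (u, δ) ∧ CycleStep N (u, δ) b := by
  obtain ⟨m, h1, h2, h3, h4⟩ := h
  by_cases hm : m.1 = u
  · exact ⟨m.2, by rw [← hm]; exact ⟨h3, h4⟩⟩
  obtain ⟨δ, hδ⟩ := h3.third hK hconn ha (Ne.symm hm)
  exact ⟨δ, ⟨_, hδ.rot.rot.flip⟩, CycleStep.trans hK hconn ⟨_, hδ.rot.flip⟩ h4 hb⟩

/-- `CycleStep` joins different fibres only and cannot express that two points of one fibre are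
interchangeable; a detour over a free fibre gives a transitive relation that can. -/
theorem CycleLinked.trans (hK : 5 ≤ Fintype.card K)
    (hconn : ∀ a b : K × D, Relation.ReflTransGen (CycleStep N) a b)
    {a b c : K × D} (h : CycleLinked N a b) (h' : CycleLinked N b c) : CycleLinked N a c := by
  obtain ⟨u, hu1, hu2, hu3, -⟩ := exists_notMem_of_five_le hK a.1 b.1 c.1 c.1
  obtain ⟨v, hv1, hv2, hv3, hv4⟩ := exists_notMem_of_five_le hK a.1 b.1 c.1 u
  obtain ⟨δ, h1, h2⟩ := h.exists_over hK hconn hu1 hu2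
  obtain ⟨ε, h3, h4⟩ := h'.exists_over hK hconn hv2 hv3
  exact ⟨(v, ε), hv1, hv3, h1.trans hK hconn (h2.trans hK hconn h3 hv4.symm) hv1.symm, h4⟩

/-- Steps are links and links compose. Only reflexivity needs a cycle of its own, through `a` and
back. -/
theorem cycleLinked (hK : 5 ≤ Fintype.card K)
    (hconn : ∀ a b : K × D, Relation.ReflTransGen (CycleStep N) a b) (a b : K × D) :
    CycleLinked N a b := by
  induction hconn a b with
  | refl =>
    obtain ⟨u, hu, -⟩ := exists_notMem_of_five_le hK a.1 a.1 a.1 a.1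
    obtain ⟨v, hv1, hv2, -⟩ := exists_notMem_of_five_le hK a.1 u u u
    obtain ⟨d, e, f, h⟩ := hasFibreCycle hconn hu.symm hv2.symm hv1
    have h' := h.rightMul (d⁻¹ * a.2)
    have hd : rightMul (a.1, d) (d⁻¹ * a.2) = a := by simp [rightMul]
    rw [hd] at h'
    exact ⟨_, hu, hu, ⟨_, h'⟩, ⟨_, h'.flip⟩⟩
  | tail _ h ih => exact ih.trans hK hconn (h.linked hK hconn)

/-- If the pure cycles in `N` connect all points, then `N` contains all pure cycles. -/
theorem hasCycle_of_connected (hK : 5 ≤ Fintype.card K)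
    (hconn : ∀ a b : K × D, Relation.ReflTransGen (CycleStep N) a b) {a b c : K × D}
    (hab : a.1 ≠ b.1) (hbc : b.1 ≠ c.1) (hca : c.1 ≠ a.1) : HasCycle N a b c := by
  have step : ∀ a b : K × D, a.1 ≠ b.1 → CycleStep N a b := by
    intro a b h
    obtain ⟨m, -, -, h3, h4⟩ := cycleLinked hK hconn a b
    exact h3.trans hK hconn h4 h
  obtain ⟨u, hu1, hu2, hu3, -⟩ := exists_notMem_of_five_le hK a.1 b.1 c.1 c.1
  obtain ⟨v, hv1, hv2, hv3, hv4⟩ := exists_notMem_of_five_le hK a.1 b.1 c.1 u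
  obtain ⟨δ, h1⟩ := (step a b hab).third hK hconn hu1 hu2
  obtain ⟨ε, h2⟩ := (step (u, δ) c hu3).third hK hconn hv4 hv3
  exact h1.move h2 hca.symm hv1.symm hbc hv2.symm

end Connected

/-! ### Generation of the even elements with trivial total twist. -/

section Generation

variable [Fintype K] [DecidableEq K]

/-- The pure cycle through the points `(x, 1)`, `(σ x, 1)`, `(σ (σ x), 1)` is the untwisted lift of
the 3-cycle `σ`, and 3-cycles generate the alternating group. -/
theorem shear_three_cycle_mem
    (hN : ∀ a b c : K × D, a.1 ≠ b.1 → b.1 ≠ c.1 → c.1 ≠ a.1 → HasCycle N a b c)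
    {π : Equiv.Perm K} (hπ : π ∈ alternatingGroup K) : (shear π (1 : K → D)) ∈ N := by
  rw [← Equiv.Perm.closure_three_cycles_eq_alternating] at hπ
  induction hπ using Subgroup.closure_induction with
  | mem σ hσ =>
    obtain ⟨x, hx⟩ : ∃ x, σ x ≠ x := by
      by_contra! h
      exact hσ.ne_one (Equiv.ext h)
    have h3 : ∀ y, σ (σ (σ y)) = y := by
      intro y
      have := congrArg (fun τ : Equiv.Perm K => τ y) (hσ.orderOf ▸ pow_orderOf_eq_one σ)
      simpa [pow_succ] using this
    have hxx : σ (σ x) ≠ x := fun e => hx (by simpa [e] using h3 x)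
    obtain ⟨-, -, -, g, hg, g1, g2, g3, g4⟩ := hN (x, 1) (σ x, 1) (σ (σ x), 1) hx.symm
      (fun e => hx (σ.injective e.symm)) hxx
    have : g = shear σ (1 : K → D) := by
      ext ⟨y, l⟩ : 1
      simp only [one_smul] at g1 g2 g3 g4
      simp only [shear_apply, Pi.one_apply, one_smul]
      by_cases h1 : y = x
      · rw [h1, g1]
      by_cases h2 : y = σ x
      · rw [h2, g2]
      by_cases h4 : y = σ (σ x)
      · rw [h4, g3, h3]
      rw [g4 y l h1 h2 h4]
      by_contra hne
      have hy : σ y ≠ y := fun e => hne (by rw [e])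
      have hsupp : ({x, σ x, σ (σ x), y} : Finset K) ⊆ σ.support := by
        intro z hz
        simp only [mem_insert, mem_singleton] at hz
        rw [Equiv.Perm.mem_support]
        rcases hz with rfl | rfl | rfl | rfl
        · exact hx
        · exact fun e => hx (σ.injective e)
        · exact fun e => hx (σ.injective (σ.injective e))
        · exact hy
      have hc := card_le_card hsupp
      rw [hσ.card_support] at hc
      have h4' : #({x, σ x, σ (σ x), y} : Finset K) = 4 := by
        rw [card_insert_of_notMem, card_insert_of_notMem, card_insert_of_notMem, card_singleton]
        · simpa using Ne.symm h4
        · simpa using ⟨fun e => hx e.symm, Ne.symm h2⟩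
        · simpa using ⟨hx.symm, hxx.symm, Ne.symm h1⟩
      omega
    exact this ▸ hg
  | one => rw [shear_one]; exact N.one_mem
  | mul σ τ _ _ h1 h2 =>
    have := N.mul_mem h1 h2
    rw [shear_mul] at this
    convert this using 2
    funext x; simp
  | inv σ _ h =>
    have h' : (shear σ (1 : K → D) : Equiv.Perm (K × F))⁻¹ = shear σ⁻¹ (1 : K → D) := by
      rw [inv_eq_iff_mul_eq_one, shear_mul, ← shear_one (D := D)]
      congr 1
      · simp
      · funext x; simp
    rw [← h']
    exact N.inv_mem h

/-- Two opposite cycles over the fibres `x`, `y`, `z`, of which only the second is twisted at `y`: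
the permutations of the fibres cancel, and the twist remains at `x` and, inverted, at `y`. -/
theorem mulSingle_mem_baseSubgroup (hK : 5 ≤ Fintype.card K)
    (hN : ∀ a b c : K × D, a.1 ≠ b.1 → b.1 ≠ c.1 → c.1 ≠ a.1 → HasCycle N a b c)
    {x y : K} (hxy : x ≠ y) (δ : D) :
    Pi.mulSingle x δ * Pi.mulSingle y δ⁻¹ ∈ baseSubgroup (D := D) N := by
  obtain ⟨z, hzx, hzy⟩ := exists_third hK x y
  obtain ⟨-, -, -, g, hg, g1, g2, g3, g4⟩ := hN (x, 1) (z, 1) (y, 1) hzx.symm hzy hxy.symm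
  obtain ⟨-, -, -, k, hk, k1, k2, k3, k4⟩ := hN (y, δ) (z, 1) (x, 1) hzy.symm hzx hxy
  have : (shear 1 (Pi.mulSingle x δ * Pi.mulSingle y δ⁻¹ : K → D) : Equiv.Perm (K × F)) =
      g * k := by
    ext ⟨u, l⟩ : 1
    simp only [one_smul] at g1 g2 g3 g4 k1 k2 k3 k4
    rw [shear_apply, Equiv.Perm.mul_apply]
    by_cases h1 : u = x
    · subst h1; simp [k3, g3, hxy]
    by_cases h2 : u = y
    · subst h2
      have := k1 (δ⁻¹ • l)
      rw [smul_inv_smul] at this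
      rw [this, g2]; simp [hxy.symm]
    by_cases h3 : u = z
    · subst h3; simp [k2, g1, hzx, hzy]
    · rw [k4 u l h2 h3 h1, g4 u l h1 h3 h2]; simp [h1, h2]
  rw [mem_baseSubgroup, this]
  exact N.mul_mem hg hk

/-- Take the commutator of a twist by `a` at `x` balanced at `y` with a twist by `b` at `x` balanced
at another fibre `z`. The two supports share only `x`, so just the commutator of `a` and `b` at `x`
survives. -/
theorem mulSingle_commutator_mem_baseSubgroup (hK : 5 ≤ Fintype.card K)
    (hN : ∀ a b c : K × D, a.1 ≠ b.1 → b.1 ≠ c.1 → c.1 ≠ a.1 → HasCycle N a b c)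
    (x : K) {δ : D} (hδ : δ ∈ commutator D) :
    Pi.mulSingle x δ ∈ baseSubgroup (D := D) N := by
  have key : commutator D ≤
      (baseSubgroup (D := D) N).comap (MonoidHom.mulSingle (fun _ : K => D) x) := by
    rw [commutator_def, Subgroup.commutator_le]
    intro a _ b _
    obtain ⟨y, hyx, -⟩ := exists_third hK x x
    obtain ⟨z, hzx, hzy⟩ := exists_third hK x y
    have h1 := mulSingle_mem_baseSubgroup hK hN hyx.symm a
    have h2 := mulSingle_mem_baseSubgroup hK hN hzx.symm b
    have h3 := Subgroup.mul_mem _ (Subgroup.mul_mem _ (Subgroup.mul_mem _ h1 h2)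
      (Subgroup.inv_mem _ h1)) (Subgroup.inv_mem _ h2)
    rw [Subgroup.mem_comap]
    convert h3 using 1
    funext u
    by_cases hux : u = x
    · subst hux; simp [hyx.symm, hzx.symm, commutatorElement_def]
    · by_cases huy : u = y
      · subst huy; simp [hux, hzy.symm, commutatorElement_def]
      · by_cases huz : u = z
        · subst huz; simp [hux, huy, commutatorElement_def]
        · simp [hux, huy, huz, commutatorElement_def]
  exact key hδ

/-- All twists are collected at one fibre `x` by balanced pairs. What arrives at `x` has trivial
image in the abelianization, hence is in the commutator subgroup. -/
theorem mem_baseSubgroup_of_prod (hK : 5 ≤ Fintype.card K)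
    (hN : ∀ a b c : K × D, a.1 ≠ b.1 → b.1 ≠ c.1 → c.1 ≠ a.1 → HasCycle N a b c)
    (d : K → D) (hd : ∏ x, Abelianization.of (d x) = 1) : d ∈ baseSubgroup (D := D) N := by
  obtain ⟨x⟩ : Nonempty K := Fintype.card_pos_iff.1 (by omega)
  suffices h : ∀ s : Finset K, ∀ d : K → D, (∀ y, y ∉ s → y ≠ x → d y = 1) →
      ∏ x, Abelianization.of (d x) = 1 → d ∈ baseSubgroup (D := D) N from
    h univ d (by simp) hd
  intro s
  induction s using Finset.induction_on with
  | empty =>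
    intro d h1 h2
    have hd' : d = Pi.mulSingle x (d x) := by
      funext y
      by_cases hy : y = x
      · subst hy; simp
      · simp [hy, h1 y (by simp) hy]
    rw [hd']
    apply mulSingle_commutator_mem_baseSubgroup hK hN
    rw [Finset.prod_eq_single x (fun y _ hy => by rw [h1 y (by simp) hy, map_one]) (by simp)] at h2
    rwa [← Abelianization.ker_of, MonoidHom.mem_ker]
  | insert z s _ ih =>
    intro d h1 h2
    by_cases hzx : z = x
    · exact ih d (fun y hy hyx => h1 y (by simp [hy, hzx, hyx]) hyx) h2
    -- Multiplication by this balanced pair clears the entry at `z`, transfers it to `x` and leaves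
    -- the total twist unchanged.
    have h3 := mulSingle_mem_baseSubgroup hK hN hzx (d z)⁻¹
    rw [← Subgroup.mul_mem_cancel_right _ h3]
    apply ih
    · intro y hy hyx
      by_cases hyz : y = z
      · subst hyz; simp [hzx]
      · simp [hyz, hyx, h1 y (by simp [hy, hyz]) hyx]
    · simp only [Pi.mul_apply, map_mul, Finset.prod_mul_distrib, h2, one_mul]
      have h4 : ∀ (w : K) (e : D), ∏ u, Abelianization.of ((Pi.mulSingle w e : K → D) u) =
          Abelianization.of e := by
        intro w e
        rw [Finset.prod_eq_single w (fun y _ hy => by simp [hy]) (by simp)]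
        simp
      rw [h4, h4]
      simp

/-- If the pure cycles in `N` connect all points, then `N` contains all elements of the wreath
product that induce an even permutation of the fibres and whose total twist is trivial. -/
theorem shear_mem_of_connected (hK : 5 ≤ Fintype.card K)
    (hconn : ∀ a b : K × D, Relation.ReflTransGen (CycleStep N) a b)
    {π : Equiv.Perm K} (hπ : Equiv.Perm.sign π = 1) {d : K → D}
    (hd : ∏ x, Abelianization.of (d x) = 1) : shear π d ∈ N := by
  have hN : ∀ a b c : K × D, a.1 ≠ b.1 → b.1 ≠ c.1 → c.1 ≠ a.1 → HasCycle N a b c :=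
    fun a b c h1 h2 h3 => hasCycle_of_connected hK hconn h1 h2 h3
  have h1 := shear_three_cycle_mem hN (Equiv.Perm.mem_alternatingGroup.2 hπ)
  have h2 := mem_baseSubgroup.1 (mem_baseSubgroup_of_prod hK hN d hd)
  have := N.mul_mem h1 h2
  rw [shear_mul] at this
  simpa using this

end Generation

end Wreath

end Rubik

namespace Rubik

open Finset

/-! ### Signed permutations of the axes -/

/-- A factor of a position, or its opposite, according to a sign. -/
def flip {k : ℕ} (e : ℤˣ) (a : Fin k) : Fin k := if e = 1 then a else a.rev

@[simp] theorem flip_one {k : ℕ} (a : Fin k) : flip 1 a = a := if_pos rfl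

@[simp] theorem flip_neg_one {k : ℕ} (a : Fin k) : flip (-1) a = a.rev := if_neg (by decide)

theorem flip_mul {k : ℕ} (e e' : ℤˣ) (a : Fin k) : flip (e * e') a = flip e (flip e' a) := by
  rcases Int.units_eq_one_or e with rfl | rfl <;> rcases Int.units_eq_one_or e' with rfl | rfl <;>
    simp

theorem flip_flip {k : ℕ} (e : ℤˣ) (a : Fin k) : flip e (flip e a) = a := by
  rw [← flip_mul, Int.units_mul_self, flip_one]

theorem flip_eq_or {k : ℕ} (e : ℤˣ) (a : Fin k) : flip e a = a ∨ flip e a = a.rev := by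
  rcases Int.units_eq_one_or e with rfl | rfl <;> simp

/-- The axis permutation `σ` is part of a rotation of space that takes the position `p` to `q`. -/
def Reach {n k : ℕ} (p q : Pos n k) (σ : Equiv.Perm (Fin n)) : Prop :=
  ∃ ε : Fin n → ℤˣ, Equiv.Perm.sign σ * ∏ l, ε l = 1 ∧ ∀ l, q (σ l) = flip (ε l) (p l)

section Reach

variable {n k : ℕ} {p q r : Pos n k} {σ τ : Equiv.Perm (Fin n)}

theorem Reach.refl (p : Pos n k) : Reach p p 1 := ⟨1, by simp, by simp⟩

theorem Reach.trans (h : Reach p q σ) (h' : Reach q r τ) : Reach p r (τ * σ) := by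
  obtain ⟨ε, h1, h2⟩ := h
  obtain ⟨δ, h3, h4⟩ := h'
  refine ⟨fun l => δ (σ l) * ε l, ?_, fun l => ?_⟩
  · rw [map_mul, prod_mul_distrib, Equiv.prod_comp σ δ]
    calc _ = (Equiv.Perm.sign τ * ∏ l, δ l) * (Equiv.Perm.sign σ * ∏ l, ε l) := by
          simp only [mul_assoc, mul_left_comm]
      _ = 1 := by rw [h1, h3, one_mul]
  · rw [flip_mul, ← h2, ← h4, Equiv.Perm.mul_apply]

theorem Reach.symm (h : Reach p q σ) : Reach q p σ⁻¹ := by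
  obtain ⟨ε, h1, h2⟩ := h
  refine ⟨fun l => ε (σ⁻¹ l), ?_, fun l => ?_⟩
  · rw [Equiv.prod_comp σ⁻¹ ε, Equiv.Perm.sign_inv, h1]
  · obtain ⟨m, rfl⟩ := σ.surjective l
    simp [h2, flip_flip]

theorem Reach.mem_outer (h : Reach p q σ) (l : Fin n) : σ l ∈ outer q ↔ l ∈ outer p := by
  obtain ⟨ε, h1, h2⟩ := h
  simp only [outer, mem_filter, mem_univ, true_and, h2]
  rcases flip_eq_or (ε l) (p l) with e | e <;> rw [e]
  exact outer_rev _

theorem Reach.outer_eq (h : Reach p q σ) : outer q = (outer p).map σ.toEmbedding := by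
  ext x
  obtain ⟨l, rfl⟩ := σ.surjective x
  rw [h.mem_outer]
  simp

theorem Reach.card_outer (h : Reach p q σ) : #(outer q) = #(outer p) := by
  rw [h.outer_eq, card_map]

theorem prod_ite_neg_one (j : Fin n) : ∏ l, (if l = j then (-1 : ℤˣ) else 1) = -1 := by
  rw [prod_ite_eq' univ j]; simp

theorem rotate_swap {i j : Fin n} (h : i ≠ j) (p : Pos n k) (l : Fin n) :
    rotate i j p (Equiv.swap i j l) = flip (if l = j then -1 else 1) (p l) := by
  unfold rotate
  by_cases h1 : l = i
  · subst h1; simp [h, h.symm]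
  · by_cases h2 : l = j
    · subst h2; simp
    · simp [Equiv.swap_apply_of_ne_of_ne h1 h2, h1, h2]

theorem reach_rotate {i j : Fin n} (h : i ≠ j) (p : Pos n k) :
    Reach p (rotate i j p) (Equiv.swap i j) :=
  ⟨fun l => if l = j then -1 else 1, by rw [prod_ite_neg_one, Equiv.Perm.sign_swap h]; simp,
    rotate_swap h p⟩

theorem LayerTurn.reach (t : LayerTurn n k) (p : Pos n k) : Reach p (t.pos p) (t.axes p) := by
  unfold LayerTurn.pos LayerTurn.axes
  split_ifs
  · exact reach_rotate t.i_ne_j p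
  · exact Reach.refl p

theorem axesAfter_append (v w : Combination n k) (p : Pos n k) :
    axesAfter (v ++ w) p = axesAfter w (posAfter v p) * axesAfter v p := by
  induction v generalizing p with
  | nil => simp [axesAfter, posAfter]
  | cons t v ih => rw [List.cons_append, axesAfter, ih, axesAfter, posAfter, mul_assoc]

theorem reach_after (w : Combination n k) (p : Pos n k) :
    Reach p (posAfter w p) (axesAfter w p) := by
  induction w generalizing p with
  | nil => exact Reach.refl p
  | cons t w ih => exact (t.reach p).trans (ih _)

/-- The rotation of the whole cube. -/
def wholeTurn {i j : Fin n} (h : i ≠ j) (p : Pos n k) : LayerTurn n k :=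
  ⟨univ, p, i, j, mem_univ i, mem_univ j, h⟩

theorem wholeTurn_pos {i j : Fin n} (h : i ≠ j) (p q : Pos n k) :
    (wholeTurn h p).pos q = rotate i j q := if_pos (by simp [wholeTurn])

theorem wholeTurn_axes {i j : Fin n} (h : i ≠ j) (p q : Pos n k) :
    (wholeTurn h p).axes q = Equiv.swap i j := if_pos (by simp [wholeTurn])

/-- Two signed permutations compose as combinations of rotations of the whole cube. -/
def Realizable (n k : ℕ) (σ : Equiv.Perm (Fin n)) (ε : Fin n → ℤˣ) : Prop :=
  ∃ w : Combination n k, ∀ p, axesAfter w p = σ ∧ ∀ l, posAfter w p (σ l) = flip (ε l) (p l)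

theorem Realizable.mul {δ ε : Fin n → ℤˣ} (h : Realizable n k σ ε) (h' : Realizable n k τ δ) :
    Realizable n k (τ * σ) fun l => δ (σ l) * ε l := by
  obtain ⟨v, hv⟩ := h
  obtain ⟨w, hw⟩ := h'
  refine ⟨v ++ w, fun p => ⟨by rw [axesAfter_append, (hv p).1, (hw _).1], fun l => ?_⟩⟩
  rw [posAfter_append, Equiv.Perm.mul_apply, (hw _).2, (hv p).2, flip_mul]

theorem realizable_swap (hk : 0 < k) {i j : Fin n} (h : i ≠ j) :
    Realizable n k (Equiv.swap i j) fun l => if l = j then -1 else 1 := by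
  refine ⟨[wholeTurn h fun _ => ⟨0, hk⟩], fun p => ⟨?_, fun l => ?_⟩⟩
  · simp [axesAfter, wholeTurn_axes]
  · simp only [posAfter, wholeTurn_pos]
    exact rotate_swap h p l

/-- The square of the turn in directions `i` and `j` reverses just these two axes, so an even set of
reversals is obtained in pairs. -/
theorem realizable_flips (hk : 0 < k) (s : Finset (Fin n)) (hs : Even #s) :
    Realizable n k 1 fun l => if l ∈ s then -1 else 1 := by
  induction s using Finset.strongInduction with
  | H s ih =>
    rcases s.eq_empty_or_nonempty with rfl | ⟨i, hi⟩
    · exact ⟨[], fun p => ⟨rfl, fun l => by simp [posAfter]⟩⟩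
    obtain ⟨j, hj⟩ : (s.erase i).Nonempty := by
      rw [← card_pos, card_erase_of_mem hi]
      have := card_pos.2 ⟨i, hi⟩
      obtain ⟨m, hm⟩ := hs
      omega
    have hji := (mem_erase.1 hj).1
    have hjs := (mem_erase.1 hj).2
    have h1 := ih ((s.erase i).erase j)
      ((erase_ssubset hj).trans (erase_ssubset hi)) (by
        rw [card_erase_of_mem hj, card_erase_of_mem hi, Nat.sub_sub]
        have := card_pos.2 ⟨j, hj⟩
        rw [card_erase_of_mem hi] at this
        rw [Nat.even_sub (by omega)]
        simp [hs])
    have h2 := (realizable_swap hk hji.symm).mul (realizable_swap hk hji.symm)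
    have h3 := h1.mul h2
    rw [Equiv.swap_mul_self, one_mul] at h3
    convert h3 using 2 with l
    by_cases h4 : l = i
    · subst h4; simp [hi, hji.symm]
    · by_cases h5 : l = j
      · subst h5; simp [hjs, h4, hji.symm]
      · rw [Equiv.Perm.one_apply, Equiv.swap_apply_of_ne_of_ne h4 h5]; simp [h4, h5]

/-- Every signed permutation of determinant `1` is a product of rotations of the whole cube. -/
theorem realizable (hk : 0 < k) (σ : Equiv.Perm (Fin n)) (ε : Fin n → ℤˣ)
    (h : Equiv.Perm.sign σ * ∏ l, ε l = 1) : Realizable n k σ ε := by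
  induction σ using Equiv.Perm.swap_induction_on generalizing ε with
  | one =>
    have h1 : ∀ l, ε l = if l ∈ univ.filter (fun l => ε l = -1) then -1 else 1 := by
      intro l
      rcases Int.units_eq_one_or (ε l) with e | e <;> simp [e]
    rw [funext h1]
    apply realizable_flips hk
    rw [Equiv.Perm.sign_one, one_mul, prod_congr rfl fun l _ => h1 l, prod_ite_mem] at h
    simp only [univ_inter, prod_const] at h
    exact (neg_one_pow_eq_one_iff_even (by decide)).1 h
  | swap_mul σ i j hij ih =>
    -- The turn for `swap i j` reverses what comes from axis `j`, so the required sign is corrected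
    -- beforehand on the axis that `σ` sends to `j`.
    have h1 := (ih (fun l => ε l * if σ l = j then -1 else 1) (by
      rw [prod_mul_distrib, Equiv.prod_comp σ (fun l => if l = j then (-1 : ℤˣ) else 1),
        prod_ite_neg_one]
      rw [map_mul, Equiv.Perm.sign_swap hij] at h
      simpa using h)).mul (realizable_swap hk hij)
    convert h1 using 2 with l
    split_ifs <;> simp

theorem Reach.exists_combination (h : Reach p q σ) :
    ∃ w : Combination n k, posAfter w p = q ∧ axesAfter w p = σ := by
  obtain ⟨ε, h1, h2⟩ := h
  -- Without coordinates nothing forces `0 < k`, which `realizable` needs; but then the empty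
  -- combination serves.
  by_cases hn : n = 0
  · subst hn
    exact ⟨[], Subsingleton.elim _ _, Subsingleton.elim _ _⟩
  obtain ⟨w, hw⟩ := realizable (Fin.pos (p ⟨0, Nat.pos_of_ne_zero hn⟩)) σ ε h1
  refine ⟨w, funext fun l => ?_, (hw p).1⟩
  obtain ⟨m, rfl⟩ := σ.surjective l
  rw [(hw p).2, h2]

/-- A layer rotation acts on one cubie as a rotation of space, and turns of the whole cube give all
rotations of space. Linkedness thus becomes a condition on signed permutations. -/
theorem linked_iff : Linked p q ↔ ∃ σ, Reach p q σ := by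
  constructor
  · rintro ⟨w, rfl⟩; exact ⟨_, reach_after w p⟩
  · rintro ⟨σ, h⟩; obtain ⟨w, hw, -⟩ := h.exists_combination; exact ⟨w, hw⟩

theorem Reach.linked (h : Reach p q σ) : Linked p q := linked_iff.2 ⟨σ, h⟩

theorem cls_eq_iff : cls p = cls q ↔ Linked p q := Quotient.eq (r := linkedSetoid n k)

end Reach

/-- The outer axes of a cubie are carried to those of another one. -/
def outerEquiv {n k : ℕ} {p q : Pos n k} {σ : Equiv.Perm (Fin n)} (h : Reach p q σ) :
    outer p ≃ outer q :=
  σ.subtypeEquiv fun l => (h.mem_outer l).symm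

@[simp] theorem outerEquiv_apply {n k : ℕ} {p q : Pos n k} {σ : Equiv.Perm (Fin n)}
    (h : Reach p q σ) (l : outer p) : (outerEquiv h l : Fin n) = σ l := rfl

/-- A bijection between the outer axes of two cubies that is produced by a rotation of space. -/
def Carries {n k : ℕ} {p q : Pos n k} (f : outer p ≃ outer q) : Prop :=
  ∃ σ, Reach p q σ ∧ ∀ l : outer p, (f l : Fin n) = σ l

section Carries

variable {n k : ℕ} {p q r : Pos n k}

theorem Carries.refl (p : Pos n k) : Carries (Equiv.refl (outer p)) :=
  ⟨1, Reach.refl p, by simp⟩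

theorem Carries.trans {f : outer p ≃ outer q} {g : outer q ≃ outer r} (hf : Carries f)
    (hg : Carries g) : Carries (f.trans g) := by
  obtain ⟨σ, h1, h2⟩ := hf
  obtain ⟨τ, h3, h4⟩ := hg
  exact ⟨τ * σ, h1.trans h3, fun l => by simp [h4, h2]⟩

theorem Carries.symm {f : outer p ≃ outer q} (hf : Carries f) : Carries f.symm := by
  obtain ⟨σ, h1, h2⟩ := hf
  refine ⟨σ⁻¹, h1.symm, fun l => ?_⟩
  obtain ⟨m, rfl⟩ := f.surjective l
  simp [h2]

theorem Carries.linked {f : outer p ≃ outer q} (hf : Carries f) : Linked p q := by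
  obtain ⟨σ, h1, h2⟩ := hf
  exact h1.linked

theorem carries_outerEquiv {σ : Equiv.Perm (Fin n)} (h : Reach p q σ) : Carries (outerEquiv h) :=
  ⟨σ, h, fun _ => rfl⟩

theorem carries_iff {f : outer p ≃ outer q} : Carries f ↔
    ∃ w : Combination n k, posAfter w p = q ∧ ∀ l : outer p, (f l : Fin n) = axesAfter w p l := by
  constructor
  · rintro ⟨σ, h1, h2⟩
    obtain ⟨w, hw, hw'⟩ := h1.exists_combination
    exact ⟨w, hw, by rw [hw']; exact h2⟩
  · rintro ⟨w, rfl, h⟩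
    exact ⟨_, reach_after w p, h⟩

/-- The permutations produced by combinations are closed under products and inverses, so the closure
in `depGroup` adds nothing. -/
theorem mem_depGroup {P : Pos n k} {π : Equiv.Perm (outer P)} : π ∈ depGroup P ↔ Carries π := by
  let H : Subgroup (Equiv.Perm (outer P)) :=
    { carrier := {π | Carries π}
      one_mem' := Carries.refl P
      mul_mem' := fun {a b} ha hb => Carries.trans (f := b) (g := a) hb ha
      inv_mem' := fun {a} ha => Carries.symm ha }
  have : depGroup P = H := by
    unfold depGroup
    rw [show {π : Equiv.Perm (outer P) | ∃ w : Combination n k, posAfter w P = P ∧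
      ∀ l : outer P, (π l : Fin n) = axesAfter w P l} = H from Set.ext fun π => carries_iff.symm]
    exact Subgroup.closure_eq H
  rw [this]
  exact Iff.rfl

end Carries

end Rubik

namespace Rubik

open Finset

/-! ### Kinds of factors, and the dependent rotation groups -/

/-- The distance of a factor from the boundary; it determines the factor up to opposites. -/
def kd {k : ℕ} (a : Fin k) : ℕ := min a a.rev

section Kind

variable {n k : ℕ}

theorem kd_def (a : Fin k) : kd a = min (a : ℕ) (k - 1 - a) := by
  unfold kd
  rw [Fin.val_rev]
  congr 1
  omega

@[simp] theorem kd_rev (a : Fin k) : kd a.rev = kd a := by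
  unfold kd; rw [Fin.rev_rev, min_comm]

@[simp] theorem kd_flip (e : ℤˣ) (a : Fin k) : kd (flip e a) = kd a := by
  rcases flip_eq_or e a with h | h <;> simp [h]

theorem kd_eq_iff {a b : Fin k} : kd a = kd b ↔ ∃ e, b = flip e a := by
  constructor
  · intro h
    rw [kd_def, kd_def] at h
    have : b = a ∨ b = a.rev := by
      rw [Fin.ext_iff, Fin.ext_iff, Fin.val_rev]; omega
    rcases this with rfl | rfl
    · exact ⟨1, by simp⟩
    · exact ⟨-1, by simp⟩
  · rintro ⟨e, rfl⟩; simp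

theorem mem_outer {p : Pos n k} {l : Fin n} : l ∈ outer p ↔ kd (p l) = 0 := by
  rw [kd_def]; simp only [outer, mem_filter, mem_univ, true_and]; omega

theorem rev_eq_iff {a : Fin k} : a.rev = a ↔ 2 * kd a + 1 = k := by
  rw [kd_def, Fin.ext_iff, Fin.val_rev]; omega

theorem kd_lt (a : Fin k) : 2 * kd a + 1 ≤ k := by
  rw [kd_def]; omega

theorem flip_injective_left {a : Fin k} (h : a.rev ≠ a) {e e' : ℤˣ} (he : flip e a = flip e' a) :
    e = e' := by
  rcases Int.units_eq_one_or e with rfl | rfl <;> rcases Int.units_eq_one_or e' with rfl | rfl <;>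
    simp only [flip_one, flip_neg_one] at he <;> first | rfl | exact absurd he h | exact absurd he.symm h

theorem rev_ne_of_kd_zero (hk : 2 ≤ k) {a : Fin k} (h : kd a = 0) : a.rev ≠ a := by
  rw [Ne, rev_eq_iff]; omega

theorem exists_signs {p q : Pos n k} {σ : Equiv.Perm (Fin n)}
    (h : ∀ l, kd (q (σ l)) = kd (p l)) : ∃ ε : Fin n → ℤˣ, ∀ l, q (σ l) = flip (ε l) (p l) := by
  choose ε hε using fun l => kd_eq_iff.1 (h l).symm
  exact ⟨ε, hε⟩

/-- Either sign is allowed at a self-opposite factor, so the sign there can be chosen to make the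
determinant 1. -/
theorem reach_of_kd_of_rev_eq {p q : Pos n k} {σ : Equiv.Perm (Fin n)}
    (h : ∀ l, kd (q (σ l)) = kd (p l)) {m : Fin n} (hm : (p m).rev = p m) : Reach p q σ := by
  obtain ⟨ε, hε⟩ := exists_signs h
  refine ⟨fun l => ε l * if l = m then Equiv.Perm.sign σ * ∏ l, ε l else 1, ?_, fun l => ?_⟩
  · rw [prod_mul_distrib, prod_ite_eq' univ m, if_pos (mem_univ m), ← mul_assoc,
      Int.units_mul_self]
  · by_cases hl : l = m
    · subst hl
      have : ∀ e, flip e (p l) = p l := fun e => by rcases flip_eq_or e (p l) with h | h <;> simp [h, hm]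
      rw [hε, this, this]
    · simp [hε, hl]

/-- If `σ` leads to determinant -1, exchange the two axes of equal kind first. The sign of the
permutation changes, while the product of the axis signs does not, because the correction `e` enters
at both axes. -/
theorem reach_or_reach_swap {p q : Pos n k} {σ : Equiv.Perm (Fin n)}
    (h : ∀ l, kd (q (σ l)) = kd (p l)) {i j : Fin n} (hij : i ≠ j) (h' : kd (p i) = kd (p j)) :
    Reach p q σ ∨ Reach p q (σ * Equiv.swap i j) := by
  obtain ⟨ε, hε⟩ := exists_signs h
  rcases Int.units_eq_one_or (Equiv.Perm.sign σ * ∏ l, ε l) with h1 | h1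
  · exact Or.inl ⟨ε, h1, hε⟩
  right
  obtain ⟨e, he⟩ := kd_eq_iff.1 h'
  refine ⟨fun l => ε (Equiv.swap i j l) * ((if l = i then e else 1) * if l = j then e else 1),
    ?_, fun l => ?_⟩
  · rw [prod_mul_distrib, prod_mul_distrib, Equiv.prod_comp (Equiv.swap i j) ε,
      prod_ite_eq' univ i, prod_ite_eq' univ j, map_mul, Equiv.Perm.sign_swap hij]
    simp [h1, Int.units_mul_self]
  · rw [Equiv.Perm.mul_apply, hε]
    by_cases h2 : l = i
    · subst h2; simp [hij, flip_mul, he]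
    by_cases h3 : l = j
    · subst h3; simp [hij.symm, flip_mul, he, flip_flip]
    simp [Equiv.swap_apply_of_ne_of_ne h2 h3, h2, h3]

theorem linked_of_kd {p q : Pos n k} {σ : Equiv.Perm (Fin n)} (h : ∀ l, kd (q (σ l)) = kd (p l))
    (hp : (∃ m, (p m).rev = p m) ∨ ∃ i j, i ≠ j ∧ kd (p i) = kd (p j)) : Linked p q := by
  rcases hp with ⟨m, hm⟩ | ⟨i, j, hij, h'⟩
  · exact (reach_of_kd_of_rev_eq h hm).linked
  · rcases reach_or_reach_swap h hij h' with h | h <;> exact h.linked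

theorem Reach.kd_eq {p q : Pos n k} {σ : Equiv.Perm (Fin n)} (h : Reach p q σ) (l : Fin n) :
    kd (q (σ l)) = kd (p l) := by
  obtain ⟨ε, -, h⟩ := h
  rw [h, kd_flip]

/-- The side of the big cube, as a sign. -/
def side (a : Fin k) : ℤˣ := if (a : ℕ) = 0 then 1 else -1

theorem side_flip (hk : 2 ≤ k) (e : ℤˣ) {a : Fin k} (h : kd a = 0) :
    side (flip e a) = e * side a := by
  rw [kd_def] at h
  unfold side
  rcases Int.units_eq_one_or e with rfl | rfl
  · simp
  · rw [flip_neg_one, Fin.val_rev]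
    split_ifs <;> first | omega | simp

theorem flip_side {a b : Fin k} (ha : kd a = 0) (hb : kd b = 0) :
    b = flip (side b * side a) a := by
  rw [kd_def] at ha hb
  unfold side
  split_ifs <;> simp [Fin.ext_iff, Fin.val_rev] <;> omega

/-- Each sign is the quotient of the sides of the big cube at the new and the old axis. Since `σ`
permutes the outer axes, the product telescopes. -/
theorem prod_outer_signs (hk : 2 ≤ k) {p : Pos n k} {σ : Equiv.Perm (Fin n)} {ε : Fin n → ℤˣ}
    (h : ∀ l, σ l ∈ outer p ↔ l ∈ outer p) (hε : ∀ l ∈ outer p, p (σ l) = flip (ε l) (p l)) :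
    ∏ l ∈ outer p, ε l = 1 := by
  have h1 : ∀ l ∈ outer p, ε l = side (p (σ l)) * side (p l) := by
    intro l hl
    rw [hε l hl, side_flip hk _ (mem_outer.1 hl), mul_assoc, Int.units_mul_self, mul_one]
  rw [prod_congr rfl h1, prod_mul_distrib]
  have h2 : ∏ l ∈ outer p, side (p (σ l)) = ∏ l ∈ outer p, side (p l) := by
    apply prod_bij (fun l _ => σ l)
    · intro l hl; exact (h l).2 hl
    · intro a _ b _ e; exact σ.injective e
    · intro b hb
      exact ⟨σ⁻¹ b, by rw [← h]; simpa using hb, by simp⟩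
    · intro l _; rfl
  rw [h2, Int.units_mul_self]

/-- The inner factors of a cubie are pairwise different up to opposites, and none is its own
opposite. -/
def Chiral (p : Pos n k) : Prop :=
  ∀ l ∉ outer p, (p l).rev ≠ p l ∧ ∀ l' ∉ outer p, kd (p l') = kd (p l) → l' = l

theorem Chiral.of_reach {p q : Pos n k} {σ : Equiv.Perm (Fin n)} (hp : Chiral p)
    (h : Reach p q σ) : Chiral q := by
  intro l hl
  obtain ⟨l, rfl⟩ := σ.surjective l
  rw [h.mem_outer] at hl
  rw [Ne, rev_eq_iff, h.kd_eq, ← rev_eq_iff]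
  refine ⟨(hp l hl).1, fun l' hl' e => ?_⟩
  obtain ⟨l', rfl⟩ := σ.surjective l'
  rw [h.mem_outer] at hl'
  rw [h.kd_eq] at e
  rw [(hp l hl).2 l' hl' e]

theorem Chiral.of_linked {p q : Pos n k} (hp : Chiral p) (h : Linked p q) : Chiral q := by
  obtain ⟨σ, h⟩ := linked_iff.1 h
  exact hp.of_reach h

theorem mem_outer_ofSubtype {P : Pos n k} (π : Equiv.Perm (outer P)) (l : Fin n) :
    Equiv.Perm.ofSubtype π l ∈ outer P ↔ l ∈ outer P := by
  by_cases hl : l ∈ outer P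
  · rw [Equiv.Perm.ofSubtype_apply_of_mem _ hl]; simp [hl]
  · rw [Equiv.Perm.ofSubtype_apply_of_not_mem _ hl]

theorem kd_ofSubtype {P : Pos n k} (π : Equiv.Perm (outer P)) (l : Fin n) :
    kd (P (Equiv.Perm.ofSubtype π l)) = kd (P l) := by
  by_cases hl : l ∈ outer P
  · rw [mem_outer.1 hl, mem_outer.1 ((mem_outer_ofSubtype π l).2 hl)]
  · rw [Equiv.Perm.ofSubtype_apply_of_not_mem _ hl]

/-- Leave the inner axes fixed. The forced signs on the outer axes multiply to 1, so the determinant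
is the sign of the permutation. -/
theorem alternatingGroup_le_depGroup (hk : 2 ≤ k) (P : Pos n k) :
    alternatingGroup (outer P) ≤ depGroup P := by
  intro π hπ
  rw [Equiv.Perm.mem_alternatingGroup] at hπ
  rw [mem_depGroup]
  have h1 := mem_outer_ofSubtype π
  refine ⟨Equiv.Perm.ofSubtype π,
    ⟨fun l => if l ∈ outer P then side (P (Equiv.Perm.ofSubtype π l)) * side (P l) else 1, ?_, ?_⟩,
    fun l => by simp⟩
  · rw [Equiv.Perm.sign_ofSubtype, hπ, one_mul, prod_ite_mem, univ_inter]
    apply prod_outer_signs hk h1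
    intro l hl
    exact flip_side (mem_outer.1 hl) (mem_outer.1 ((h1 l).2 hl))
  · intro l
    by_cases hl : l ∈ outer P
    · beta_reduce
      rw [if_pos hl]
      exact flip_side (mem_outer.1 hl) (mem_outer.1 ((h1 l).2 hl))
    · beta_reduce
      rw [if_neg hl, flip_one, Equiv.Perm.ofSubtype_apply_of_not_mem _ hl]

/-- A self-opposite inner factor, or two inner factors equal up to opposites, repair the determinant
without affecting the outer axes. -/
theorem depGroup_of_not_chiral {P : Pos n k} (h : ¬ Chiral P) : depGroup P = ⊤ := by
  rw [eq_top_iff]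
  intro π _
  rw [mem_depGroup]
  unfold Chiral at h
  push Not at h
  obtain ⟨l, hl, h⟩ := h
  have h1 := kd_ofSubtype π
  by_cases hr : (P l).rev = P l
  · exact ⟨_, reach_of_kd_of_rev_eq h1 hr, fun l => by simp⟩
  · obtain ⟨l', hl', h2, h3⟩ := h hr
    rcases reach_or_reach_swap h1 h3 h2 with h4 | h4
    · exact ⟨_, h4, fun l => by simp⟩
    · refine ⟨_, h4, fun x => ?_⟩
      rw [Equiv.Perm.mul_apply, Equiv.swap_apply_of_ne_of_ne]
      · simp
      · rintro e; exact hl' (e ▸ x.2)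
      · rintro e; exact hl (e ▸ x.2)

/-- For a chiral cubie every inner axis must be fixed with sign 1. Determinant 1 then says that the
permutation of the outer axes is even. -/
theorem depGroup_of_chiral (hk : 2 ≤ k) {P : Pos n k} (h : Chiral P) :
    depGroup P = alternatingGroup (outer P) := by
  refine le_antisymm (fun π hπ => ?_) (alternatingGroup_le_depGroup hk P)
  rw [mem_depGroup] at hπ
  rw [Equiv.Perm.mem_alternatingGroup]
  obtain ⟨σ, hσ, hπ⟩ := hπ
  have h1 : ∀ l ∉ outer P, σ l = l := fun l hl =>
    (h l hl).2 _ (by rwa [hσ.mem_outer]) (hσ.kd_eq l)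
  have h2 : σ = Equiv.Perm.ofSubtype π := by
    ext l : 1
    by_cases hl : l ∈ outer P
    · rw [Equiv.Perm.ofSubtype_apply_of_mem _ hl, hπ]
    · rw [h1 l hl, Equiv.Perm.ofSubtype_apply_of_not_mem _ hl]
  have hm := hσ.mem_outer
  obtain ⟨ε, h3, h4⟩ := hσ
  have h5 : ∏ l, ε l = ∏ l ∈ outer P, ε l := by
    symm
    apply prod_subset (subset_univ _)
    intro l _ hl
    have := h4 l
    rw [h1 l hl] at this
    exact flip_injective_left (h l hl).1 (by rw [← this, flip_one])
  rwa [h5, prod_outer_signs hk hm fun l _ => h4 l, h2, Equiv.Perm.sign_ofSubtype, mul_one] at h3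

theorem card_outer_le_one_of_depGroup {P : Pos n k}
    (h : depGroup P = alternatingGroup (outer P)) (h' : depGroup P = ⊤) : #(outer P) ≤ 1 := by
  by_contra hc
  have : Nontrivial (outer P) := by
    rw [← Fintype.one_lt_card_iff_nontrivial]; simpa using hc
  have h1 := alternatingGroup.index_eq_two (α := outer P)
  rw [← h, h', Subgroup.index_top] at h1
  omega

/-- Above one orientation face, the dependent rotation group is alternating exactly for chiral
cubies. -/
theorem depGroup_eq_alternating_iff (hk : 2 ≤ k) {P : Pos n k} (hP : 1 < #(outer P)) :
    depGroup P = alternatingGroup (outer P) ↔ Chiral P := by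
  refine ⟨fun h => ?_, depGroup_of_chiral hk⟩
  by_contra hc
  have := card_outer_le_one_of_depGroup h (depGroup_of_not_chiral hc)
  omega

theorem depGroup_eq_top_iff (hk : 2 ≤ k) {P : Pos n k} (hP : 1 < #(outer P)) :
    depGroup P = ⊤ ↔ ¬ Chiral P := by
  refine ⟨fun h hc => ?_, depGroup_of_not_chiral⟩
  have := card_outer_le_one_of_depGroup (depGroup_of_chiral hk hc) h
  omega

/-- A cubie with an inner factor can be turned so that its outer axes are permuted arbitrarily. -/
theorem rigid_of_card_lt {p q : Pos n k} (f : outer p ≃ outer q) (h : #(outer p) < n) :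
    ∃ (σ : Equiv.Perm (Fin n)) (ε : Fin n → ℤˣ), Equiv.Perm.sign σ * ∏ l, ε l = 1 ∧
      ∀ l : outer p, (f l : Fin n) = σ l ∧ q (σ l) = if ε l = 1 then p l else (p l).rev := by
  obtain ⟨m, hm⟩ : ∃ m, m ∉ outer p := by
    by_contra! hc
    rw [Finset.eq_univ_of_forall hc, card_univ, Fintype.card_fin] at h
    omega
  let σ : Equiv.Perm (Fin n) := f.extendSubtype
  have hσ : ∀ l : outer p, σ l = f l := fun l => Equiv.extendSubtype_apply_of_mem f l l.2
  let δ : Fin n → ℤˣ := fun l => side (q (σ l)) * side (p l)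
  -- The factors of an assembly are only compared on outer axes, so the sign at the inner axis `m`
  -- is free to correct the determinant.
  refine ⟨σ, fun l => δ l * if l = m then Equiv.Perm.sign σ * ∏ l, δ l else 1, ?_, fun l => ?_⟩
  · rw [prod_mul_distrib, prod_ite_eq' univ m, if_pos (mem_univ m), ← mul_assoc,
      Int.units_mul_self]
  · refine ⟨(hσ l).symm, ?_⟩
    have hl : (l : Fin n) ≠ m := fun e => hm (e ▸ l.2)
    beta_reduce
    rw [if_neg hl, mul_one]
    have h1 : kd (p l) = 0 := mem_outer.1 l.2
    have h2 : kd (q (σ l)) = 0 := by rw [hσ]; exact mem_outer.1 (f l).2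
    exact flip_side h1 h2

theorem linked_of_two_le_card_outer {p q : Pos n k} {σ : Equiv.Perm (Fin n)}
    (h : ∀ l, kd (q (σ l)) = kd (p l)) (hp : 2 ≤ #(outer p)) : Linked p q := by
  obtain ⟨i, hi, j, hj, hij⟩ := Finset.one_lt_card.1 hp
  exact linked_of_kd h (Or.inr ⟨i, j, hij, by rw [mem_outer.1 hi, mem_outer.1 hj]⟩)

/-- Only one kind is self-opposite, so the kinds match as soon as outer axes go to outer axes.
Either two outer axes or a middle factor are present to adjust the determinant. -/
theorem IsCentral.linked (hn : 2 ≤ n) {m : ℕ} {p q : Pos n k} (hp : IsCentral m p)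
    (hq : IsCentral m q) : Linked p q := by
  have e : outer p ≃ outer q := Finset.equivOfCardEq (hp.1.trans hq.1.symm)
  let σ : Equiv.Perm (Fin n) := e.extendSubtype
  have h : ∀ l, kd (q (σ l)) = kd (p l) := by
    intro l
    by_cases hl : l ∈ outer p
    · rw [mem_outer.1 hl, mem_outer.1 (Equiv.extendSubtype_mem e l hl)]
    · have h1 := rev_eq_iff.1 (hp.2 l hl)
      have h2 := rev_eq_iff.1 (hq.2 _ (Equiv.extendSubtype_not_mem e l hl))
      change kd (q (e.extendSubtype l)) = _
      omega
  by_cases ho : 2 ≤ #(outer p)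
  · exact linked_of_two_le_card_outer h ho
  · have : ∃ l, l ∉ outer p := by
      by_contra! hc
      rw [Finset.eq_univ_of_forall hc, card_univ, Fintype.card_fin] at ho
      omega
    obtain ⟨l, hl⟩ := this
    exact linked_of_kd h (Or.inl ⟨l, hp.2 l hl⟩)

end Kind

end Rubik

namespace Rubik

open Finset

/-! ### The group generated by the layer rotations -/

section Slots

variable {n k : ℕ}

/-- An outer axis of a cubie position, or the corresponding orientation face. -/
abbrev Slot (n k : ℕ) := {s : Pos n k × Fin n // s.2 ∈ outer s.1}

/-- The layer rotation in the opposite direction. -/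
def LayerTurn.inv (t : LayerTurn n k) : LayerTurn n k :=
  ⟨t.free, t.level, t.j, t.i, t.j_mem, t.i_mem, t.i_ne_j.symm⟩

theorem LayerTurn.mem_layer_pos (t : LayerTurn n k) (p : Pos n k) :
    (∀ l, l ∉ t.free → t.pos p l = t.level l) ↔ ∀ l, l ∉ t.free → p l = t.level l := by
  unfold LayerTurn.pos
  split_ifs with h
  · refine ⟨fun _ => h, fun _ l hl => ?_⟩
    have h3 : l ≠ t.i := fun e => hl (e ▸ t.i_mem)
    have h4 : l ≠ t.j := fun e => hl (e ▸ t.j_mem)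
    simp [rotate, h3, h4, h l hl]
  · rfl

theorem LayerTurn.pos_of_mem (t : LayerTurn n k) {p : Pos n k}
    (h : ∀ l, l ∉ t.free → p l = t.level l) : t.pos p = rotate t.i t.j p := if_pos h

theorem LayerTurn.pos_of_not (t : LayerTurn n k) {p : Pos n k}
    (h : ¬ ∀ l, l ∉ t.free → p l = t.level l) : t.pos p = p := if_neg h

theorem LayerTurn.axes_of_mem (t : LayerTurn n k) {p : Pos n k}
    (h : ∀ l, l ∉ t.free → p l = t.level l) : t.axes p = Equiv.swap t.i t.j := if_pos h

theorem LayerTurn.axes_of_not (t : LayerTurn n k) {p : Pos n k}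
    (h : ¬ ∀ l, l ∉ t.free → p l = t.level l) : t.axes p = 1 := if_neg h

theorem LayerTurn.inv_pos_pos (t : LayerTurn n k) (p : Pos n k) : t.inv.pos (t.pos p) = p := by
  by_cases h : ∀ l, l ∉ t.free → p l = t.level l
  · rw [t.inv.pos_of_mem ((t.mem_layer_pos p).2 h), t.pos_of_mem h]
    exact rotate_rotate t.i_ne_j p
  · rw [t.inv.pos_of_not (mt (t.mem_layer_pos p).1 h), t.pos_of_not h]

theorem LayerTurn.inv_axes_axes (t : LayerTurn n k) (p : Pos n k) :
    t.inv.axes (t.pos p) * t.axes p = 1 := by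
  by_cases h : ∀ l, l ∉ t.free → p l = t.level l
  · rw [t.inv.axes_of_mem ((t.mem_layer_pos p).2 h), t.axes_of_mem h]
    exact (congrArg (· * _) (Equiv.swap_comm _ _)).trans (Equiv.swap_mul_self _ _)
  · rw [t.inv.axes_of_not (mt (t.mem_layer_pos p).1 h), t.axes_of_not h, one_mul]

/-- The permutation of the positions by a layer rotation. -/
noncomputable def LayerTurn.posPerm (t : LayerTurn n k) : Equiv.Perm (Pos n k) where
  toFun := t.pos
  invFun := t.inv.pos
  left_inv := t.inv_pos_pos
  right_inv := t.inv.inv_pos_pos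

/-- The permutation of the slots by a layer rotation. -/
noncomputable def LayerTurn.slotPerm (t : LayerTurn n k) : Equiv.Perm (Slot n k) where
  toFun s := ⟨(t.pos s.1.1, t.axes s.1.1 s.1.2), (mem_outer_pos t _ _).2 s.2⟩
  invFun s := ⟨(t.inv.pos s.1.1, t.inv.axes s.1.1 s.1.2), (mem_outer_pos t.inv _ _).2 s.2⟩
  left_inv s := by
    apply Subtype.ext
    exact Prod.ext (t.inv_pos_pos _) (DFunLike.congr_fun (t.inv_axes_axes s.1.1) s.1.2)
  right_inv s := by
    apply Subtype.ext
    exact Prod.ext (t.inv.inv_pos_pos _) (DFunLike.congr_fun (t.inv.inv_axes_axes s.1.1) s.1.2)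

theorem posAfter_bijective (w : Combination n k) : Function.Bijective (posAfter w) := by
  induction w with
  | nil => exact Function.bijective_id
  | cons t w ih => exact ih.comp t.posPerm.bijective

/-- The permutation of the positions by a combination. -/
noncomputable def combPos (w : Combination n k) : Equiv.Perm (Pos n k) :=
  Equiv.ofBijective _ (posAfter_bijective w)

theorem combPos_apply (w : Combination n k) (p : Pos n k) : combPos w p = posAfter w p := rfl

/-- The permutation of the slots by a combination. -/
noncomputable def combSlot : Combination n k → Equiv.Perm (Slot n k)
  | [] => 1
  | t :: w => combSlot w * t.slotPerm

theorem combSlot_apply (w : Combination n k) (s : Slot n k) :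
    (combSlot w s).1 = (posAfter w s.1.1, axesAfter w s.1.1 s.1.2) := by
  induction w generalizing s with
  | nil => rfl
  | cons t w ih => exact ih _

theorem combSlot_append (v w : Combination n k) : combSlot (v ++ w) = combSlot w * combSlot v := by
  induction v with
  | nil => simp [combSlot]
  | cons t v ih => rw [List.cons_append, combSlot, ih, combSlot, mul_assoc]

theorem combPos_append (v w : Combination n k) : combPos (v ++ w) = combPos w * combPos v :=
  Equiv.ext fun p => posAfter_append v w p

/-- The group of permutations of the slots by combinations. -/
noncomputable def slotGroup (n k : ℕ) : Subgroup (Equiv.Perm (Slot n k)) where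
  carrier := Set.range combSlot
  one_mem' := ⟨[], rfl⟩
  mul_mem' := by
    rintro _ _ ⟨v, rfl⟩ ⟨w, rfl⟩
    exact ⟨w ++ v, combSlot_append w v⟩
  inv_mem' := by
    rintro _ ⟨w, rfl⟩
    induction w with
    | nil => exact ⟨[], by simp [combSlot]⟩
    | cons t w ih =>
      obtain ⟨v, hv⟩ := ih
      exact ⟨v ++ [t.inv], by simp [combSlot_append, hv, combSlot]; rfl⟩

theorem combSlot_mem (w : Combination n k) : combSlot w ∈ slotGroup n k := ⟨w, rfl⟩

/-! ### Rotations of planes -/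

/-- The rotation of the plane through `v` in the directions `i` and `j`. -/
def planeTurn {i j : Fin n} (h : i ≠ j) (v : Pos n k) : LayerTurn n k :=
  ⟨{i, j}, v, i, j, by simp, by simp, h⟩

/-- The positions `p` and `v` lie in a common plane in the directions `i` and `j`. -/
def Coplanar (i j : Fin n) (v p : Pos n k) : Prop := ∀ l, l ≠ i → l ≠ j → p l = v l

theorem coplanar_rotate {i j : Fin n} {v p : Pos n k} :
    Coplanar i j v (rotate i j p) ↔ Coplanar i j v p := by
  refine forall_congr' fun l => forall_congr' fun h1 => forall_congr' fun h2 => ?_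
  simp [rotate, h1, h2]

theorem planeTurn_layer {i j : Fin n} (h : i ≠ j) (v p : Pos n k) :
    (∀ l, l ∉ (planeTurn h v).free → p l = (planeTurn h v).level l) ↔ Coplanar i j v p := by
  simp [planeTurn, Coplanar]

theorem planeTurn_pos_of_coplanar {i j : Fin n} (h : i ≠ j) {v p : Pos n k}
    (hp : Coplanar i j v p) : (planeTurn h v).pos p = rotate i j p :=
  if_pos ((planeTurn_layer h v p).2 hp)

theorem planeTurn_pos_of_not {i j : Fin n} (h : i ≠ j) {v p : Pos n k}
    (hp : ¬ Coplanar i j v p) : (planeTurn h v).pos p = p :=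
  if_neg (mt (planeTurn_layer h v p).1 hp)

theorem planeTurn_axes_of_coplanar {i j : Fin n} (h : i ≠ j) {v p : Pos n k}
    (hp : Coplanar i j v p) : (planeTurn h v).axes p = Equiv.swap i j :=
  if_pos ((planeTurn_layer h v p).2 hp)

theorem planeTurn_axes_of_not {i j : Fin n} (h : i ≠ j) {v p : Pos n k}
    (hp : ¬ Coplanar i j v p) : (planeTurn h v).axes p = 1 :=
  if_neg (mt (planeTurn_layer h v p).1 hp)

theorem planeTurn_inv {i j : Fin n} (h : i ≠ j) (v : Pos n k) :
    (planeTurn h v).inv = planeTurn h.symm v := by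
  simp only [planeTurn, LayerTurn.inv, LayerTurn.mk.injEq, and_true]
  exact Finset.pair_comm i j

/-- A combination of rotations of planes. -/
def IsPlanar (w : Combination n k) : Prop :=
  ∀ t ∈ w, ∃ (i j : Fin n) (h : i ≠ j) (v : Pos n k), t = planeTurn h v

theorem IsPlanar.append {v w : Combination n k} (hv : IsPlanar v) (hw : IsPlanar w) :
    IsPlanar (v ++ w) := by
  intro t ht
  rcases List.mem_append.1 ht with h | h
  exacts [hv t h, hw t h]

open Classical in
-- `Z` is a disjoint union of parallel planes, which are turned one after another.
theorem exists_planar_of_set {i j : Fin n} (h : i ≠ j) (Z : Finset (Pos n k))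
    (hZ : ∀ p ∈ Z, ∀ q, Coplanar i j p q → q ∈ Z) :
    ∃ w : Combination n k, IsPlanar w ∧ ∀ p,
      posAfter w p = (if p ∈ Z then rotate i j p else p) ∧
      axesAfter w p = if p ∈ Z then Equiv.swap i j else 1 := by
  induction Z using Finset.strongInduction with
  | H Z ih =>
    rcases Z.eq_empty_or_nonempty with rfl | ⟨v, hv⟩
    · exact ⟨[], by simp [IsPlanar], by simp [posAfter, axesAfter]⟩
    have hvv : Coplanar i j v v := fun _ _ _ => rfl
    obtain ⟨w, hw, hw'⟩ := ih (Z.filter fun q => ¬ Coplanar i j v q)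
      ⟨filter_subset _ _, fun hs => (mem_filter.1 (hs hv)).2 hvv⟩ (by
        intro p hp q hq
        rw [mem_filter] at hp ⊢
        refine ⟨hZ p hp.1 q hq, fun hc => hp.2 fun l h1 h2 => ?_⟩
        rw [← hq l h1 h2, hc l h1 h2])
    refine ⟨w ++ [planeTurn h v], hw.append (by
      intro t ht; exact ⟨i, j, h, v, by simpa using ht⟩), fun p => ?_⟩
    rw [posAfter_append, axesAfter_append, (hw' p).1, (hw' p).2]
    simp only [posAfter, axesAfter, one_mul, mem_filter]
    by_cases hc : Coplanar i j v p
    · have hp : p ∈ Z := hZ v hv p hc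
      simp [hc, hp, planeTurn_pos_of_coplanar, planeTurn_axes_of_coplanar]
    · by_cases hp : p ∈ Z
      · have hc' := mt coplanar_rotate.1 hc
        simp [hc, hp, planeTurn_pos_of_not h hc', planeTurn_axes_of_not h hc']
      · simp [hc, hp, planeTurn_pos_of_not h hc, planeTurn_axes_of_not h hc]

theorem LayerTurn.exists_planar (t : LayerTurn n k) :
    ∃ w : Combination n k, IsPlanar w ∧ ∀ p, posAfter w p = t.pos p ∧ axesAfter w p = t.axes p := by
  classical
  obtain ⟨w, hw, hw'⟩ := exists_planar_of_set t.i_ne_j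
    (univ.filter fun p : Pos n k => ∀ l, l ∉ t.free → p l = t.level l) (by
      intro p hp q hq
      simp only [mem_filter, mem_univ, true_and] at hp ⊢
      intro l hl
      rw [hq l (fun e => hl (e ▸ t.i_mem)) (fun e => hl (e ▸ t.j_mem)), hp l hl])
  refine ⟨w, hw, fun p => ?_⟩
  rw [(hw' p).1, (hw' p).2]
  simp only [mem_filter, mem_univ, true_and, LayerTurn.pos, LayerTurn.axes]

/-- Every combination acts like one of rotations of planes. -/
theorem exists_planar (w : Combination n k) :
    ∃ v : Combination n k, IsPlanar v ∧
      ∀ p, posAfter v p = posAfter w p ∧ axesAfter v p = axesAfter w p := by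
  induction w with
  | nil => exact ⟨[], by simp [IsPlanar], by simp⟩
  | cons t w ih =>
    obtain ⟨v, hv, hv'⟩ := ih
    obtain ⟨u, hu, hu'⟩ := t.exists_planar
    refine ⟨u ++ v, hu.append hv, fun p => ?_⟩
    rw [posAfter_append, axesAfter_append, (hu' p).1, (hu' p).2, (hv' _).1, (hv' _).2]
    exact ⟨rfl, rfl⟩

/-! ### Pure cycles as commutators -/

/-- The commutator of two permutations whose supports meet in one block is a pure 3-cycle. -/
theorem commutator_cycle {X P : Type*} (π : X → P) (A Y : Equiv.Perm X) (U V : P → Prop) (p : P)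
    (hA : ∀ x, U (π x) → U (π (A x))) (hA' : ∀ x, ¬ U (π x) → A x = x)
    (hY : ∀ x, V (π x) → V (π (Y x))) (hY' : ∀ x, ¬ V (π x) → Y x = x)
    (hUV : ∀ q, U q → V q → q = p) (hp : U p) (hp' : V p)
    (hAp : ∀ x, π x = p → π (A x) ≠ p) (hYp : ∀ x, π x = p → π (Y x) ≠ p) :
    (∀ x, π x = p → (A * Y * A⁻¹ * Y⁻¹) x = A x ∧ (A * Y * A⁻¹ * Y⁻¹) (A x) = Y x ∧
      (A * Y * A⁻¹ * Y⁻¹) (Y x) = x) ∧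
    ∀ x, π x ≠ p → π (A⁻¹ x) ≠ p → π (Y⁻¹ x) ≠ p → (A * Y * A⁻¹ * Y⁻¹) x = x := by
  have hAi : ∀ x, U (π x) → U (π (A⁻¹ x)) := by
    intro x hx
    by_contra hc
    have := hA' _ hc
    rw [Equiv.Perm.inv_def, Equiv.apply_symm_apply] at this
    exact hc (by rw [Equiv.Perm.inv_def, ← this]; exact hx)
  have hYi : ∀ x, V (π x) → V (π (Y⁻¹ x)) := by
    intro x hx
    by_contra hc
    have := hY' _ hc
    rw [Equiv.Perm.inv_def, Equiv.apply_symm_apply] at this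
    exact hc (by rw [Equiv.Perm.inv_def, ← this]; exact hx)
  have fixA : ∀ x, V (π x) → π x ≠ p → A x = x := fun x h1 h2 =>
    hA' x fun h3 => h2 (hUV _ h3 h1)
  have fixY : ∀ x, U (π x) → π x ≠ p → Y x = x := fun x h1 h2 =>
    hY' x fun h3 => h2 (hUV _ h1 h3)
  have invA : ∀ x, A x = x → A⁻¹ x = x := fun x h => by rw [Equiv.Perm.inv_eq_iff_eq, h]
  have invY : ∀ x, Y x = x → Y⁻¹ x = x := fun x h => by rw [Equiv.Perm.inv_eq_iff_eq, h]
  have hAip : ∀ x, π x = p → π (A⁻¹ x) ≠ p := fun x hx h => by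
    have := hAp _ h
    rw [Equiv.Perm.inv_def, Equiv.apply_symm_apply] at this
    exact this hx
  have hYip : ∀ x, π x = p → π (Y⁻¹ x) ≠ p := fun x hx h => by
    have := hYp _ h
    rw [Equiv.Perm.inv_def, Equiv.apply_symm_apply] at this
    exact this hx
  simp only [Equiv.Perm.mul_apply]
  refine ⟨fun x hx => ⟨?_, ?_, ?_⟩, fun x h1 h2 h3 => ?_⟩
  · have e : A⁻¹ (Y⁻¹ x) = Y⁻¹ x := invA _ (fixA _ (hYi x (hx ▸ hp')) (hYip x hx))
    rw [e]; simp
  · have e : Y⁻¹ (A x) = A x := invY _ (fixY _ (hA x (hx ▸ hp)) (hAp x hx))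
    have e' : A (Y x) = Y x := fixA _ (hY x (hx ▸ hp')) (hYp x hx)
    rw [e]; simpa using e'
  · have e : Y (A⁻¹ x) = A⁻¹ x := fixY _ (hAi x (hx ▸ hp)) (hAip x hx)
    rw [Equiv.Perm.inv_def Y, Equiv.symm_apply_apply, e]; simp
  · by_cases hU : U (π x)
    · rw [invY x (fixY x hU h1), fixY _ (hAi x hU) h2]; simp
    · by_cases hV : V (π x)
      · rw [invA _ (fixA _ (hYi x hV) h3)]; simpa using hA' x hU
      · rw [invY x (hY' x hV), invA x (hA' x hU), hY' x hV, hA' x hU]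

/-- A pure 3-cycle in the group of combinations that starts with the rotation of a plane. -/
def IsCubieCycle (c : Equiv.Perm (Slot n k)) (p q r : Pos n k) (f : outer p ≃ outer q)
    (g : outer p ≃ outer r) : Prop :=
  (∀ l : outer p, c ⟨(p, l), l.2⟩ = ⟨(q, f l), (f l).2⟩ ∧
    c ⟨(q, f l), (f l).2⟩ = ⟨(r, g l), (g l).2⟩ ∧ c ⟨(r, g l), (g l).2⟩ = ⟨(p, l), l.2⟩) ∧
  ∀ s : Slot n k, s.1.1 ≠ p → s.1.1 ≠ q → s.1.1 ≠ r → c s = s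

theorem posAfter_eq_of_not_coplanar {i j : Fin n} (hij : i ≠ j) (B : LayerTurn n k)
    (v q : Pos n k) (h : ¬ Coplanar i j v (B.inv.pos q)) :
    B.pos ((planeTurn hij v).pos (B.inv.pos q)) = q := by
  rw [planeTurn_pos_of_not hij h]
  exact B.inv.inv_pos_pos q

/-- `A` turns the plane through `p` in the directions `i` and `j`. The combination `w` turns the
parallel plane through `B⁻¹ p`, conjugated by the turn `B` of the `(j, l)`-plane at `p`, so it moves
`p` as well. In that plane `h` and `g` give the two coordinates of `B⁻¹`. By `hgp` the two parallel
planes differ, which leaves `p` as the only common point of the supports; `hx` and `hh` ensure that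
`w` moves `p`. The commutator of `A` and `w` is the desired cycle. -/
theorem exists_cycle_aux {i j l : Fin n} (hij : i ≠ j) (hil : i ≠ l) (hjl : j ≠ l)
    (p : Pos n k) (hj : (p j).rev ≠ p j) (hx : ¬ ((p i).rev = p i ∧ (p l).rev = p l))
    (A : LayerTurn n k) (hAne : A.pos p ≠ p)
    (hUinv : ∀ q, Coplanar i j p q → Coplanar i j p (A.pos q))
    (hAfix : ∀ q, ¬ Coplanar i j p q → A.pos q = q ∧ A.axes q = 1)
    (B : LayerTurn n k) (g h : Fin k → Fin k) (hg : Function.Injective g)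
    (hh : ∀ a, (h a).rev = h a → a.rev = a)
    (hgp : g (p j) ≠ p l)
    (hB : ∀ q, Coplanar j l p q → B.inv.pos q j = h (q l) ∧ B.inv.pos q l = g (q j) ∧
      ∀ m, m ≠ j → m ≠ l → B.inv.pos q m = q m)
    (hB' : ∀ q, ¬ Coplanar j l p q → B.inv.pos q = q) :
    ∃ c ∈ slotGroup n k, ∃ (r : Pos n k) (f : outer p ≃ outer (A.pos p))
      (g : outer p ≃ outer r),
      (∀ l : outer p, (f l : Fin n) = A.axes p l) ∧ Carries f ∧ Carries g ∧
      p ≠ A.pos p ∧ A.pos p ≠ r ∧ r ≠ p ∧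
      IsCubieCycle c p (A.pos p) r f g := by
  set v := B.inv.pos p with hv
  set T := planeTurn hij v with hT
  set w : Combination n k := [B.inv, T, B] with hw
  have hwp : ∀ q, posAfter w q = B.pos (T.pos (B.inv.pos q)) := fun q => rfl
  have hpp : Coplanar j l p p := fun _ _ _ => rfl
  obtain ⟨v1, v2, v3⟩ : v j = h (p l) ∧ v l = g (p j) ∧ ∀ m, m ≠ j → m ≠ l → v m = p m :=
    hB p hpp
  have hTv : T.pos v = rotate i j v := planeTurn_pos_of_coplanar hij fun _ _ _ => rfl
  have hTne : T.pos v ≠ v := by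
    rw [hTv]
    intro e
    have e1 := congrFun e i
    have e2 := congrFun e j
    simp only [rotate, if_true, if_neg hij.symm] at e1 e2
    have e3 : (v i).rev = v i := by
      conv_lhs => rw [← e1, Fin.rev_rev]
      exact e2.symm
    have hvi : v i = p i := v3 i hij hil
    have e4 : (h (p l)).rev = h (p l) := by rw [← v1]; exact e1.trans e2
    exact hx ⟨by rw [← hvi]; exact e3, hh _ e4⟩
  have hYne : posAfter w p ≠ p := by
    rw [hwp]
    intro e
    apply hTne
    have := congrArg B.inv.pos e
    rwa [B.inv_pos_pos] at this
  -- In the `(j, l)`-plane the `l`-th factor of `B⁻¹ q` determines `q j`; outside that plane `B⁻¹`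
  -- fixes `q`, and the `l`-th factors of the two parallel planes differ.
  have hUV : ∀ q, Coplanar i j p q → Coplanar i j v (B.inv.pos q) → q = p := by
    intro q hU hV
    have h1 := hV l hil.symm hjl.symm
    by_cases hq : Coplanar j l p q
    · rw [(hB q hq).2.1, v2] at h1
      funext m
      by_cases hmj : m = j
      · subst hmj; exact hg h1
      by_cases hmi : m = i
      · subst hmi; exact hq m hij hil
      · exact hU m hmi hmj
    · rw [hB' q hq, v2, hU l hil.symm hjl.symm] at h1
      exact absurd h1.symm hgp
  have hVinv : ∀ q, Coplanar i j v (B.inv.pos q) → Coplanar i j v (B.inv.pos (posAfter w q)) := by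
    intro q hq
    rw [hwp, B.inv_pos_pos, planeTurn_pos_of_coplanar hij hq, coplanar_rotate]
    exact hq
  have hYfix : ∀ q, ¬ Coplanar i j v (B.inv.pos q) → posAfter w q = q ∧ axesAfter w q = 1 := by
    intro q hq
    refine ⟨by rw [hwp]; exact posAfter_eq_of_not_coplanar hij B v q hq, ?_⟩
    change (1 * B.axes (T.pos (B.inv.pos q)) * T.axes (B.inv.pos q)) * B.inv.axes q = 1
    rw [planeTurn_pos_of_not hij hq, planeTurn_axes_of_not hij hq, one_mul, mul_one]
    exact B.inv.inv_axes_axes q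
  obtain ⟨c1, c2⟩ := commutator_cycle (fun s : Slot n k => s.1.1) A.slotPerm (combSlot w)
    (fun q => Coplanar i j p q) (fun q => Coplanar i j v (B.inv.pos q)) p
    (fun s hs => hUinv _ hs)
    (fun s hs => Subtype.ext (Prod.ext (hAfix _ hs).1 (DFunLike.congr_fun (hAfix _ hs).2 _)))
    (fun s hs => by rw [combSlot_apply]; exact hVinv _ hs)
    (fun s hs => by
      apply Subtype.ext
      rw [combSlot_apply, (hYfix _ hs).1, (hYfix _ hs).2]; rfl)
    hUV (fun _ _ _ => rfl) (fun _ _ _ => rfl)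
    (fun s hs => by change A.pos s.1.1 ≠ p; rw [hs]; exact hAne)
    (fun s hs => by rw [combSlot_apply]; change posAfter w s.1.1 ≠ p; rw [hs]; exact hYne)
  have hApos : ∀ s : Slot n k, (A.slotPerm s).1.1 = A.pos s.1.1 := fun s => rfl
  refine ⟨A.slotPerm * combSlot w * A.slotPerm⁻¹ * (combSlot w)⁻¹, ?_, posAfter w p,
    outerEquiv (A.reach p), outerEquiv (reach_after w p), fun l => rfl, carries_outerEquiv _,
    carries_outerEquiv _, hAne.symm, ?_, hYne, fun m => ?_, fun s h1 h2 h3 => c2 s h1 ?_ ?_⟩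
  · have hAm : A.slotPerm ∈ slotGroup n k := ⟨[A], by simp [combSlot]⟩
    have hYm := combSlot_mem w
    exact mul_mem (mul_mem (mul_mem hAm hYm) (inv_mem hAm)) (inv_mem hYm)
  · intro e
    refine hAne (hUV _ (hUinv p fun _ _ _ => rfl) ?_)
    rw [e]
    exact hVinv p fun _ _ _ => rfl
  · obtain ⟨d1, d2, d3⟩ := c1 ⟨(p, m), m.2⟩ rfl
    have e1 : A.slotPerm ⟨(p, m), m.2⟩ = ⟨(A.pos p, outerEquiv (A.reach p) m), Subtype.prop _⟩ := rfl
    have e2 : combSlot w ⟨(p, m), m.2⟩ =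
        ⟨(posAfter w p, outerEquiv (reach_after w p) m), Subtype.prop _⟩ :=
      Subtype.ext (combSlot_apply w _)
    rw [e1] at d1 d2
    rw [e2] at d2 d3
    exact ⟨d1, d2, d3⟩
  · intro e
    apply h2
    have := hApos (A.slotPerm⁻¹ s)
    rw [e] at this
    rw [← this, Equiv.Perm.inv_def, Equiv.apply_symm_apply]
  · intro e
    apply h3
    have := combSlot_apply w ((combSlot w)⁻¹ s)
    rw [Equiv.Perm.inv_def, Equiv.apply_symm_apply, ← Equiv.Perm.inv_def, e] at this
    rw [this]

/-- A rotation of a plane that moves the cubie `p` begins a pure 3-cycle. -/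
theorem exists_cycle {i j l : Fin n} (hij : i ≠ j) (hil : i ≠ l) (hjl : j ≠ l)
    (p : Pos n k) (hj : (p j).rev ≠ p j) (hx : ¬ ((p i).rev = p i ∧ (p l).rev = p l))
    {A : LayerTurn n k} (hA : A = planeTurn hij p ∨ A = planeTurn hij.symm p) :
    ∃ c ∈ slotGroup n k, ∃ (r : Pos n k) (f : outer p ≃ outer (A.pos p))
      (g : outer p ≃ outer r),
      (∀ l : outer p, (f l : Fin n) = A.axes p l) ∧ Carries f ∧ Carries g ∧
      p ≠ A.pos p ∧ A.pos p ≠ r ∧ r ≠ p ∧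
      IsCubieCycle c p (A.pos p) r f g := by
  have hfix : ∀ {a b : Fin n} (hab : a ≠ b) (q : Pos n k), ¬ Coplanar a b p q →
      (planeTurn hab p).pos q = q := fun hab q hq => planeTurn_pos_of_not hab hq
  have hcomm : ∀ {a b : Fin n} (q : Pos n k), Coplanar a b p q ↔ Coplanar b a p q :=
    fun q => ⟨fun h l h1 h2 => h l h2 h1, fun h l h1 h2 => h l h2 h1⟩
  have hAne : A.pos p ≠ p := by
    intro e
    rcases hA with rfl | rfl
    · rw [planeTurn_pos_of_coplanar hij fun _ _ _ => rfl] at e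
      have e1 := congrFun e i
      have e2 := congrFun e j
      simp only [rotate, if_true, if_neg hij.symm] at e1 e2
      exact hj (e1.trans e2)
    · rw [planeTurn_pos_of_coplanar hij.symm fun _ _ _ => rfl] at e
      have e1 := congrFun e i
      have e2 := congrFun e j
      simp only [rotate, if_true, if_neg hij] at e1 e2
      exact hj ((congrArg Fin.rev e1).trans e2)
  have hUinv : ∀ q, Coplanar i j p q → Coplanar i j p (A.pos q) := by
    intro q hq
    rcases hA with rfl | rfl
    · rw [planeTurn_pos_of_coplanar hij hq, coplanar_rotate]; exact hq
    · rw [planeTurn_pos_of_coplanar hij.symm ((hcomm q).1 hq), hcomm, coplanar_rotate, hcomm]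
      exact hq
  have hAfix : ∀ q, ¬ Coplanar i j p q → A.pos q = q ∧ A.axes q = 1 := by
    intro q hq
    rcases hA with rfl | rfl
    · exact ⟨planeTurn_pos_of_not hij hq, planeTurn_axes_of_not hij hq⟩
    · have hq' := mt (hcomm q).2 hq
      exact ⟨planeTurn_pos_of_not hij.symm hq', planeTurn_axes_of_not hij.symm hq'⟩
  -- The two directions of turning `B` put `p j` or its opposite at axis `l`. Since `p j` is not
  -- self-opposite, one of them differs from `p l`.
  by_cases hc : (p j).rev = p l
  · refine exists_cycle_aux hij hil hjl p hj hx A hAne hUinv hAfix (planeTurn hjl.symm p) id Fin.rev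
      Function.injective_id (fun a ha => ?_) (fun e => hj (hc.trans e.symm))
      (fun q hq => ?_) fun q hq => ?_
    · rw [Fin.rev_rev] at ha; exact ha.symm
    · rw [planeTurn_inv, planeTurn_pos_of_coplanar hjl hq]
      refine ⟨by simp [rotate], by simp [rotate, hjl.symm], fun m h1 h2 => by simp [rotate, h1, h2]⟩
    · rw [planeTurn_inv]; exact hfix _ q hq
  · refine exists_cycle_aux hij hil hjl p hj hx A hAne hUinv hAfix (planeTurn hjl p) Fin.rev id
      Fin.rev_injective (fun a ha => ha) hc
      (fun q hq => ?_) fun q hq => ?_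
    · rw [planeTurn_inv, planeTurn_pos_of_coplanar hjl.symm ((hcomm q).1 hq)]
      refine ⟨by simp [rotate, hjl], by simp [rotate], fun m h1 h2 => by simp [rotate, h1, h2]⟩
    · rw [planeTurn_inv]; exact hfix _ q (mt (hcomm q).2 hq)

end Slots

end Rubik

namespace Rubik

open Finset

/-! ### One class -/

section OneClass

variable {n k : ℕ}

theorem Reference.cls_base' (R : Reference n k) {K : Cls n k} {q : Pos n k} (h : Linked (R.base K) q) :
    cls q = K := by
  rw [← R.cls_base K]
  exact (cls_eq_iff.2 h).symm

theorem Reference.carries_right (R : Reference n k) (K : Cls n k) (q : Pos n k) (h : cls q = K) :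
    Carries (R.right K q h) :=
  carries_iff.2 (R.right_spec K q h)

/-- The slots of the cubies of a class, in terms of the right orientations. -/
def classSlot (R : Reference n k) (K : Cls n k) :
    {p : Pos n k // cls p = K} × outer (R.base K) ↪ Slot n k where
  toFun x := ⟨(x.1, R.right K x.1 x.1.2 x.2), Subtype.prop _⟩
  inj' := by
    rintro ⟨⟨x, hx⟩, l⟩ ⟨⟨y, hy⟩, m⟩ h
    have h1 := congrArg (fun s : Slot n k => s.1.1) h
    have h2 := congrArg (fun s : Slot n k => s.1.2) h
    simp only at h1 h2
    subst h1
    have := (R.right K x hx).injective (Subtype.ext h2)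
    rw [this]

theorem mem_range_classSlot {R : Reference n k} {K : Cls n k} {s : Slot n k} :
    s ∈ Set.range (classSlot R K) ↔ cls s.1.1 = K := by
  constructor
  · rintro ⟨x, rfl⟩; exact x.1.2
  · intro h
    refine ⟨(⟨s.1.1, h⟩, (R.right K s.1.1 h).symm ⟨s.1.2, s.2⟩), ?_⟩
    apply Subtype.ext
    change (s.1.1, ((R.right K s.1.1 h) ((R.right K s.1.1 h).symm ⟨s.1.2, s.2⟩) : Fin n)) = s.1
    rw [Equiv.apply_symm_apply]

theorem exists_viaEmbedding {α β : Type*} (ι : α ↪ β) (c : Equiv.Perm β)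
    (h : ∀ b, b ∉ Set.range ι → c b = b) : ∃ g : Equiv.Perm α, g.viaEmbedding ι = c := by
  have h1 : ∀ b, c b ∈ Set.range ι ↔ b ∈ Set.range ι := by
    intro b
    by_cases hb : b ∈ Set.range ι
    · refine ⟨fun _ => hb, fun _ => ?_⟩
      by_contra hc
      have := c.injective (h _ hc)
      exact hc (by rw [this]; exact hb)
    · rw [h b hb]
  refine ⟨(Equiv.ofInjective ι ι.injective).permCongr.symm (c.subtypePerm h1), ?_⟩
  ext b : 1
  by_cases hb : b ∈ Set.range ι
  · obtain ⟨a, rfl⟩ := hb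
    rw [Equiv.Perm.viaEmbedding_apply]
    have : (Equiv.ofInjective ι ι.injective) ((Equiv.ofInjective ι ι.injective).permCongr.symm
        (c.subtypePerm h1) a) = (c.subtypePerm h1) (Equiv.ofInjective ι ι.injective a) := by
      simp
    exact congrArg Subtype.val this
  · rw [Equiv.Perm.viaEmbedding_apply_of_notMem _ _ _ hb, h b hb]

/-- The permutations of the slots of a class by combinations that fix all other slots. -/
noncomputable def classGroup (R : Reference n k) (K : Cls n k) :
    Subgroup (Equiv.Perm ({p : Pos n k // cls p = K} × outer (R.base K))) :=
  (slotGroup n k).comap (Equiv.Perm.viaEmbeddingHom (classSlot R K))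

/-- A carrying of the base position, as a point of the wreath product action. -/
noncomputable def carryPoint (R : Reference n k) (K : Cls n k) {q : Pos n k}
    (f : outer (R.base K) ≃ outer q) (hf : Carries f) :
    {p : Pos n k // cls p = K} × depGroup (R.base K) :=
  (⟨q, R.cls_base' hf.linked⟩, ⟨f.trans (R.right K q (R.cls_base' hf.linked)).symm,
    mem_depGroup.2 (hf.trans (R.carries_right K q _).symm)⟩)

theorem classSlot_carryPoint (R : Reference n k) (K : Cls n k) {q : Pos n k}
    (f : outer (R.base K) ≃ outer q) (hf : Carries f) (l : outer (R.base K)) :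
    classSlot R K ((carryPoint R K f hf).1, (carryPoint R K f hf).2 • l) =
      ⟨(q, f l), (f l).2⟩ := by
  apply Subtype.ext
  change (q, ((R.right K q _) ((R.right K q _).symm (f l)) : Fin n)) = _
  rw [Equiv.apply_symm_apply]

theorem eq_carryPoint (R : Reference n k) (K : Cls n k)
    (a : {p : Pos n k // cls p = K} × depGroup (R.base K)) :
    ∃ hf, a = carryPoint R K ((a.2 : Equiv.Perm (outer (R.base K))).trans (R.right K a.1 a.1.2)) hf := by
  refine ⟨(mem_depGroup.1 a.2.2).trans (R.carries_right K _ _), ?_⟩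
  refine Prod.ext rfl (Subtype.ext ?_)
  simp only [carryPoint]
  ext l
  simp

/-- The cycle fixes all slots outside the class, so it restricts to the class; a carrying from the
base position then names each oriented position by an element of the wreath action. -/
theorem hasCycle_of_isCubieCycle (R : Reference n k) (K : Cls n k) {p q r : Pos n k}
    {e : outer (R.base K) ≃ outer p} (he : Carries e) {f : outer p ≃ outer q} (hf : Carries f)
    {g : outer p ≃ outer r} (hg : Carries g) (h1 : p ≠ q) (h2 : q ≠ r) (h3 : r ≠ p)
    {c : Equiv.Perm (Slot n k)} (hc : c ∈ slotGroup n k) (h : IsCubieCycle c p q r f g) :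
    HasCycle (classGroup R K) (carryPoint R K e he) (carryPoint R K (e.trans f) (he.trans hf))
      (carryPoint R K (e.trans g) (he.trans hg)) := by
  obtain ⟨γ, hγ⟩ := exists_viaEmbedding (classSlot R K) c (by
    intro s hs
    rw [mem_range_classSlot] at hs
    refine h.2 s ?_ ?_ ?_ <;> rintro rfl
    · exact hs (R.cls_base' he.linked)
    · exact hs (R.cls_base' (he.trans hf).linked)
    · exact hs (R.cls_base' (he.trans hg).linked))
  have key : ∀ x, classSlot R K (γ x) = c (classSlot R K x) := by
    intro x
    rw [← hγ, Equiv.Perm.viaEmbedding_apply]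
  refine ⟨fun e' => h1 (congrArg Subtype.val e'), fun e' => h2 (congrArg Subtype.val e'),
    fun e' => h3 (congrArg Subtype.val e'), γ, ?_, ?_, ?_, ?_, ?_⟩
  · rw [classGroup, Subgroup.mem_comap, Equiv.Perm.viaEmbeddingHom_apply, hγ]; exact hc
  · intro l
    apply (classSlot R K).injective
    rw [key, classSlot_carryPoint, classSlot_carryPoint]
    exact (h.1 (e l)).1
  · intro l
    apply (classSlot R K).injective
    rw [key, classSlot_carryPoint, classSlot_carryPoint]
    exact (h.1 (e l)).2.1
  · intro l
    apply (classSlot R K).injective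
    rw [key, classSlot_carryPoint, classSlot_carryPoint]
    exact (h.1 (e l)).2.2
  · intro u l hp hq hr
    apply (classSlot R K).injective
    rw [key]
    exact h.2 _ (fun e' => hp (Subtype.ext e')) (fun e' => hq (Subtype.ext e'))
      (fun e' => hr (Subtype.ext e'))

/-- At least two factors of the cubie differ from their opposites. -/
def IsMobile (p : Pos n k) : Prop := ∃ i j, i ≠ j ∧ (p i).rev ≠ p i ∧ (p j).rev ≠ p j

theorem IsMobile.of_linked {p q : Pos n k} (hp : IsMobile p) (h : Linked p q) : IsMobile q := by
  obtain ⟨σ, h⟩ := linked_iff.1 h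
  obtain ⟨i, j, hij, hi, hj⟩ := hp
  refine ⟨σ i, σ j, σ.injective.ne hij, ?_, ?_⟩ <;>
  rwa [Ne, rev_eq_iff, h.kd_eq, ← rev_eq_iff]

theorem planeTurn_level {i j : Fin n} (h : i ≠ j) {v p : Pos n k} (hp : Coplanar i j v p) :
    (planeTurn h v).pos = (planeTurn h p).pos ∧ (planeTurn h v).axes = (planeTurn h p).axes := by
  have hc : ∀ q, Coplanar i j v q ↔ Coplanar i j p q := fun q =>
    forall_congr' fun l => forall_congr' fun h1 => forall_congr' fun h2 => by rw [hp l h1 h2]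
  constructor <;> funext q <;> by_cases hq : Coplanar i j p q
  · rw [planeTurn_pos_of_coplanar h hq, planeTurn_pos_of_coplanar h ((hc q).2 hq)]
  · rw [planeTurn_pos_of_not h hq, planeTurn_pos_of_not h (mt (hc q).1 hq)]
  · rw [planeTurn_axes_of_coplanar h hq, planeTurn_axes_of_coplanar h ((hc q).2 hq)]
  · rw [planeTurn_axes_of_not h hq, planeTurn_axes_of_not h (mt (hc q).1 hq)]

/-- If the factor at `i` is self-opposite, mobility gives two axes with other factors, of which at
least one is not `j`. Otherwise any third axis will do. -/
theorem exists_third_axis (hn : 3 ≤ n) {p : Pos n k} (hp : IsMobile p) (i j : Fin n) :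
    ∃ l, i ≠ l ∧ j ≠ l ∧ ¬ ((p i).rev = p i ∧ (p l).rev = p l) := by
  by_cases hi : (p i).rev = p i
  · obtain ⟨a, b, hab, ha, hb⟩ := hp
    by_cases haj : a = j
    · exact ⟨b, fun e => hb (e ▸ hi), fun e => hab (haj.trans e), fun h => hb h.2⟩
    · exact ⟨a, fun e => ha (e ▸ hi), fun e => haj e.symm, fun h => ha h.2⟩
  · have h : #({i, j} : Finset (Fin n)) ≤ 2 := Finset.card_le_two
    obtain ⟨l, -, hl⟩ := Finset.exists_mem_notMem_of_card_lt_card (s := {i, j}) (t := univ)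
      (by rw [Finset.card_univ, Fintype.card_fin]; omega)
    simp only [mem_insert, mem_singleton, not_or] at hl
    exact ⟨l, Ne.symm hl.1, Ne.symm hl.2, fun h => hi h.1⟩

theorem rotate_eq_self_iff {i j : Fin n} (hij : i ≠ j) {p : Pos n k} :
    rotate i j p = p ↔ p i = p j ∧ (p j).rev = p j := by
  constructor
  · intro e
    have e1 := congrFun e i
    have e2 := congrFun e j
    simp only [rotate, if_true, if_neg hij.symm] at e1 e2
    exact ⟨e2, e1.trans e2⟩
  · rintro ⟨e1, e2⟩
    funext l
    unfold rotate
    split_ifs with h1 h2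
    · rw [h1, e1, e2]
    · rw [h2, e1]
    · rfl

/-- A cubie moved by the turn begins a pure cycle. A cubie of the plane that keeps its place has
equal self-opposite factors at `i` and `j`; these are inner since `2 ≤ k`, so its orientation is
kept too. -/
theorem cycleStep_planeTurn (hn : 3 ≤ n) (hk : 2 ≤ k) (R : Reference n k) (K : Cls n k)
    (hK : IsMobile (R.base K)) {i j : Fin n} (hij : i ≠ j) (v : Pos n k) {p : Pos n k}
    {e : outer (R.base K) ≃ outer p} (he : Carries e) :
    Relation.ReflTransGen (CycleStep (classGroup R K)) (carryPoint R K e he)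
      (carryPoint R K (e.trans (outerEquiv ((planeTurn hij v).reach p)))
        (he.trans (carries_outerEquiv _))) := by
  have hp : IsMobile p := hK.of_linked he.linked
  have same : ∀ (q : Pos n k) (f : outer p ≃ outer q) (hf : Carries f), q = p →
      (∀ l : outer p, (f l : Fin n) = l) →
      carryPoint R K (e.trans f) (he.trans hf) = carryPoint R K e he := by
    rintro q f hf rfl h
    have : f = Equiv.refl _ := Equiv.ext fun l => Subtype.ext (h l)
    subst this
    rfl
  by_cases hc : Coplanar i j v p
  · by_cases hm : rotate i j p = p
    · rw [same _ _ (carries_outerEquiv _) ((planeTurn_pos_of_coplanar hij hc).trans hm)]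
      rintro ⟨l, hl⟩
      rw [outerEquiv_apply, planeTurn_axes_of_coplanar hij hc]
      obtain ⟨h1, h2⟩ := (rotate_eq_self_iff hij).1 hm
      apply Equiv.swap_apply_of_ne_of_ne
      · rintro rfl
        exact rev_ne_of_kd_zero hk (mem_outer.1 hl) (by rw [h1, h2])
      · rintro rfl
        exact rev_ne_of_kd_zero hk (mem_outer.1 hl) h2
    · apply Relation.ReflTransGen.single
      have main : ∃ c ∈ slotGroup n k, ∃ (r : Pos n k)
          (f : outer p ≃ outer ((planeTurn hij p).pos p)) (g : outer p ≃ outer r),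
          (∀ l : outer p, (f l : Fin n) = (planeTurn hij p).axes p l) ∧ Carries f ∧ Carries g ∧
          p ≠ (planeTurn hij p).pos p ∧ (planeTurn hij p).pos p ≠ r ∧ r ≠ p ∧
          IsCubieCycle c p ((planeTurn hij p).pos p) r f g := by
        -- The construction of a cycle needs a factor that is not self-opposite on its second axis.
        -- If `j` does not qualify then `i` does, and the same turn is read in the opposite order.
        by_cases hj : (p j).rev = p j
        · have hi : (p i).rev ≠ p i := by
            intro hi
            apply hm
            rw [rotate_eq_self_iff hij]
            have h1 := rev_eq_iff.1 hi
            have h2 := rev_eq_iff.1 hj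
            have h3 : kd (p i) = kd (p j) := by omega
            obtain ⟨ε, hε⟩ := kd_eq_iff.1 h3
            rcases flip_eq_or ε (p i) with h | h
            · exact ⟨by rw [hε, h], hj⟩
            · exact ⟨by rw [hε, h, hi], hj⟩
          obtain ⟨l, h1, h2, h3⟩ := exists_third_axis hn hp j i
          exact exists_cycle hij.symm h1 h2 p hi h3 (Or.inr rfl)
        · obtain ⟨l, h1, h2, h3⟩ := exists_third_axis hn hp i j
          exact exists_cycle hij h1 h2 p hj h3 (Or.inl rfl)
      obtain ⟨c, hcm, r, f, g, hf, hf', hg, h1, h2, h3, h4⟩ := main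
      refine ⟨carryPoint R K (e.trans g) (he.trans hg), ?_⟩
      have := hasCycle_of_isCubieCycle R K he hf' hg h1 h2 h3 hcm h4
      obtain ⟨hpos, haxes⟩ := planeTurn_level hij hc
      have hpp := congrFun hpos p
      have : ∀ (q : Pos n k) (f' : outer p ≃ outer q) (hf'' : Carries f'),
          q = (planeTurn hij p).pos p → (∀ l : outer p, (f' l : Fin n) = f l) →
          carryPoint R K (e.trans f') (he.trans hf'') = carryPoint R K (e.trans f) (he.trans hf') := by
        rintro q f' hf'' rfl h
        have : f' = f := Equiv.ext fun l => Subtype.ext (h l)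
        subst this
        rfl
      rw [this _ _ (carries_outerEquiv _) hpp (by intro l; rw [hf, outerEquiv_apply, haxes])]
      assumption
  · rw [same _ _ (carries_outerEquiv _) (planeTurn_pos_of_not hij hc)
      (by intro l; rw [outerEquiv_apply, planeTurn_axes_of_not hij hc]; rfl)]

/-- Every point of the wreath action is a carrying of the base position. Two carryings differ by a
combination, which may be taken to consist of turns of planes, and each turn gives at most one step.
-/
theorem cycle_connected (hn : 3 ≤ n) (hk : 2 ≤ k) (R : Reference n k) (K : Cls n k)
    (hK : IsMobile (R.base K)) (a b : {p : Pos n k // cls p = K} × depGroup (R.base K)) :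
    Relation.ReflTransGen (CycleStep (classGroup R K)) a b := by
  have key : ∀ w : Combination n k, IsPlanar w → ∀ {p : Pos n k}
      {e : outer (R.base K) ≃ outer p} (he : Carries e) (q : Pos n k)
      (f : outer (R.base K) ≃ outer q) (hf : Carries f), q = posAfter w p →
      (∀ l, (f l : Fin n) = axesAfter w p (e l)) →
      Relation.ReflTransGen (CycleStep (classGroup R K)) (carryPoint R K e he)
        (carryPoint R K f hf) := by
    intro w
    induction w with
    | nil =>
      rintro - p e he q f hf rfl h
      have : f = e := Equiv.ext fun l => Subtype.ext (h l)
      subst this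
      exact Relation.ReflTransGen.refl
    | cons t w ih =>
      rintro hw p e he q f hf hq h
      obtain ⟨i, j, hij, v, rfl⟩ := hw t (List.mem_cons_self)
      exact (cycleStep_planeTurn hn hk R K hK hij v he).trans
        (ih (fun t ht => hw t (List.mem_cons_of_mem _ ht)) _ q f hf hq h)
  obtain ⟨ha, ha'⟩ := eq_carryPoint R K a
  obtain ⟨hb, hb'⟩ := eq_carryPoint R K b
  rw [ha', hb']
  obtain ⟨w, h1, h2⟩ := carries_iff.1 (ha.symm.trans hb)
  obtain ⟨v, hv, hv'⟩ := exists_planar w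
  refine key v hv ha _ _ hb (by rw [(hv' _).1, h1]) fun l => ?_
  rw [(hv' _).2]
  have := h2 ((((a.2 : Equiv.Perm (outer (R.base K)))).trans (R.right K a.1 a.1.2)) l)
  rw [Equiv.trans_apply, Equiv.symm_apply_apply] at this
  exact this

/-- Four positions come from turning two factors that are not self-opposite; they all have the same
`l`-th factor. A fifth is got by changing that factor. -/
theorem five_le_card_class (hn : 3 ≤ n) {K : Cls n k} {p : Pos n k} (hp : IsMobile p)
    (hpK : cls p = K) [Fintype {q : Pos n k // cls q = K}] :
    5 ≤ Fintype.card {q : Pos n k // cls q = K} := by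
  have hp' := hp
  obtain ⟨i, j, hij, hi, hj⟩ := hp
  obtain ⟨l, hil, hjl, -⟩ := exists_third_axis hn hp' i j
  have hrot : ∀ {a b : Fin n} (_ : a ≠ b) (q : Pos n k), Linked q (rotate a b q) :=
    fun hab q => (reach_rotate hab q).linked
  obtain ⟨q, hq, hql⟩ : ∃ q, Linked p q ∧ q l ≠ p l := by
    by_cases hl : (p l).rev = p l
    · refine ⟨_, hrot hjl p, fun e => hj ?_⟩
      simp only [rotate, if_neg hjl.symm, if_true] at e
      rw [e, hl]
    · refine ⟨_, (hrot hjl p).trans (hrot hjl _), fun e => hl ?_⟩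
      simpa [rotate, hjl.symm] using e
  have h1 := hrot hij p
  have h2 := h1.trans (hrot hij _)
  have h3 := h2.trans (hrot hij _)
  classical
  set s : Finset (Pos n k) := {p, rotate i j p, rotate i j (rotate i j p),
    rotate i j (rotate i j (rotate i j p)), q}
  have hs : #s = 5 := by
    have e1 : ∀ r : Pos n k, r l = p l → r ≠ q := fun r hr e => hql (e ▸ hr)
    have key : ∀ r r' : Pos n k, (r i ≠ r' i ∨ r j ≠ r' j) → r ≠ r' := by
      rintro r r' (h | h) rfl <;> exact h rfl
    have hi' := Ne.symm hi
    have hj' := Ne.symm hj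
    rw [card_insert_of_notMem, card_insert_of_notMem, card_insert_of_notMem, card_insert_of_notMem,
      card_singleton]
    · simp only [mem_singleton]
      exact e1 _ (by simp [rotate, hil.symm, hjl.symm])
    · simp only [mem_insert, mem_singleton, not_or]
      refine ⟨key _ _ ?_, e1 _ (by simp [rotate, hil.symm, hjl.symm])⟩
      simp only [rotate, if_true, if_neg hij.symm, Fin.rev_rev]
      by_contra! hc
      exact hj (hc.2.trans hc.1)
    · simp only [mem_insert, mem_singleton, not_or]
      refine ⟨key _ _ ?_, key _ _ ?_, e1 _ (by simp [rotate, hil.symm, hjl.symm])⟩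
      · simp only [rotate, if_true, if_neg hij.symm]
        by_contra! hc
        exact hi (hc.1.symm.trans hc.2.symm)
      · simp only [rotate, if_true, if_neg hij.symm, Fin.rev_rev]
        exact Or.inl hj
    · simp only [mem_insert, mem_singleton, not_or]
      refine ⟨key _ _ ?_, key _ _ ?_, key _ _ ?_, e1 _ rfl⟩
      · simp only [rotate, if_true, if_neg hij.symm]
        by_contra! hc
        exact hj (by rw [← hc.1, hc.2])
      · simp only [rotate, if_true, if_neg hij.symm]
        exact Or.inl hi'
      · simp only [rotate, if_true, if_neg hij.symm, Fin.rev_rev]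
        by_contra! hc
        exact hi (hc.1.trans hc.2).symm
  have hsK : ∀ r ∈ s, cls r = K := by
    intro r hr
    rw [← hpK]
    refine (cls_eq_iff.2 ?_).symm
    simp only [s, mem_insert, mem_singleton] at hr
    rcases hr with rfl | rfl | rfl | rfl | rfl
    exacts [Linked.refl _, h1, h2, h3, hq]
  rw [← hs, ← Fintype.card_coe]
  exact Fintype.card_le_of_injective (fun r : s => (⟨r.1, hsK r.1 r.2⟩ : {q : Pos n k // cls q = K}))
    fun a b h => Subtype.ext (congrArg (fun x => x.1) h)

open Classical in
/-- On a mobile class, the combinations that fix all other slots realize every even permutation of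
the cubies with trivial total twist. -/
theorem exists_on_class (hn : 3 ≤ n) (hk : 2 ≤ k) (R : Reference n k) (K : Cls n k)
    (hK : IsMobile (R.base K)) {σ : Equiv.Perm {p : Pos n k // cls p = K}}
    (hσ : Equiv.Perm.sign σ = 1) {d : {p : Pos n k // cls p = K} → depGroup (R.base K)}
    (hd : ∏ x, Abelianization.of (d x) = 1) :
    ∃ g ∈ slotGroup n k, (∀ x l, g (classSlot R K (x, l)) = classSlot R K (σ x, d x • l)) ∧
      ∀ s : Slot n k, cls s.1.1 ≠ K → g s = s := by
  have := shear_mem_of_connected (N := classGroup R K)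
    (five_le_card_class hn hK (R.cls_base K)) (cycle_connected hn hk R K hK) hσ hd
  rw [classGroup, Subgroup.mem_comap, Equiv.Perm.viaEmbeddingHom_apply] at this
  refine ⟨_, this, fun x l => ?_, fun s hs => ?_⟩
  · rw [Equiv.Perm.viaEmbedding_apply]; rfl
  · exact Equiv.Perm.viaEmbedding_apply_of_notMem _ _ _ (by rwa [mem_range_classSlot])

end OneClass

end Rubik

namespace Rubik

open Finset

/-! ### Assemblies and their colourings -/

section Assemblies

variable {n k : ℕ}

theorem Assembly.rigid' (a : Assembly n k) (p : Pos n k) :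
    ∃ (σ : Equiv.Perm (Fin n)) (ε : Fin n → ℤˣ), Equiv.Perm.sign σ * ∏ l, ε l = 1 ∧
      ∀ l : outer p, (a.face p l : Fin n) = σ l ∧ a.place p (σ l) = flip (ε l) (p l) :=
  a.rigid p

/-- The assembly after a combination. -/
noncomputable def Assembly.act (a : Assembly n k) (w : Combination n k) : Assembly n k where
  place := a.place.trans (combPos w)
  linked_place p := (a.linked_place p).trans (reach_after w _).linked
  face p := (a.face p).trans (outerEquiv (reach_after w (a.place p)))
  rigid p := by
    obtain ⟨σ, ε, h1, h2⟩ := a.rigid' p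
    obtain ⟨δ, h3, h4⟩ := reach_after w (a.place p)
    refine ⟨axesAfter w (a.place p) * σ, fun l => δ (σ l) * ε l, ?_, fun l => ⟨?_, ?_⟩⟩
    · rw [map_mul, prod_mul_distrib, Equiv.prod_comp σ δ]
      calc _ = (Equiv.Perm.sign (axesAfter w (a.place p)) * ∏ l, δ l) *
            (Equiv.Perm.sign σ * ∏ l, ε l) := by simp only [mul_assoc, mul_left_comm]
        _ = 1 := by rw [h1, h3, one_mul]
    · rw [Equiv.Perm.mul_apply, ← (h2 l).1]; rfl
    · change posAfter w (a.place p) _ = flip (δ (σ l) * ε l) (p l)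
      rw [flip_mul, ← (h2 l).2, ← h4, Equiv.Perm.mul_apply]

theorem Assembly.act_place (a : Assembly n k) (w : Combination n k) (p : Pos n k) :
    (a.act w).place p = posAfter w (a.place p) := rfl

theorem Assembly.act_face (a : Assembly n k) (w : Combination n k) (p : Pos n k) (l : outer p) :
    ((a.act w).face p l : Fin n) = axesAfter w (a.place p) (a.face p l) := rfl

/-- Two cubies look the same. -/
def SameColour (p q : Pos n k) : Prop := outer q = outer p ∧ ∀ l ∈ outer p, q l = p l

theorem SameColour.refl (p : Pos n k) : SameColour p p := ⟨rfl, fun _ _ => rfl⟩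

theorem SameColour.symm {p q : Pos n k} (h : SameColour p q) : SameColour q p :=
  ⟨h.1.symm, fun l hl => (h.2 l (h.1 ▸ hl)).symm⟩

theorem SameColour.trans {p q r : Pos n k} (h : SameColour p q) (h' : SameColour q r) :
    SameColour p r :=
  ⟨h'.1.trans h.1, fun l hl => (h'.2 l (h.1.symm ▸ hl)).trans (h.2 l hl)⟩

theorem Face.ext' {f g : Face n k} (h : f.pos = g.pos) (h' : f.axes = g.axes) : f = g := by
  cases f; cases g; cases h; cases h'; rfl

/-- The painted face of dimension `n - 1` on an outer axis. -/
def axisFace (hn : 3 ≤ n) (p : Pos n k) (l : outer p) : Face n k :=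
  ⟨p, {l.1}, by simp, by simp, by simpa using hn⟩

/-- For `3 ≤ n` the faces of dimension `n - 1` are painted, and the colour of each of them shows one
outer axis together with its side. -/
theorem sameColour_of_colours (hn : 3 ≤ n) {p q : Pos n k} (h : colours p = colours q) :
    SameColour p q := by
  have key : ∀ {p q : Pos n k}, colours p = colours q → ∀ l ∈ outer p, l ∈ outer q ∧ q l = p l := by
    intro p q h l hl
    have h1 : (axisFace hn p ⟨l, hl⟩).colour ∈ colours q := h ▸ ⟨_, rfl, rfl⟩
    obtain ⟨f, hf, hc⟩ := h1
    have h2 := congrFun hc l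
    rw [Face.colour, Face.colour, if_pos (show l ∈ (axisFace hn p ⟨l, hl⟩).axes by
      simp [axisFace])] at h2
    split_ifs at h2 with h3
    refine ⟨hf ▸ f.subset_outer h3, ?_⟩
    rw [← hf]
    exact Option.some.inj h2
  refine ⟨Finset.ext fun l => ⟨fun hl => (key h.symm l hl).1, fun hl => (key h l hl).1⟩, fun l hl =>
    (key h l hl).2⟩

theorem SameColour.colours_eq {p q : Pos n k} (h : SameColour p q) : colours p = colours q := by
  have key : ∀ {p q : Pos n k}, SameColour p q → colours p ⊆ colours q := by
    rintro p q h c ⟨f, rfl, rfl⟩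
    refine ⟨⟨q, f.axes, by rw [h.1]; exact f.subset_outer, f.nonempty, f.card_add_two_le⟩, rfl, ?_⟩
    funext l
    unfold Face.colour
    split_ifs with hl
    · exact congrArg some (h.2 l (f.subset_outer hl))
    · rfl
  exact Set.Subset.antisymm (key h) (key h.symm)

theorem colours_eq_iff (hn : 3 ≤ n) {p q : Pos n k} : colours p = colours q ↔ SameColour p q :=
  ⟨sameColour_of_colours hn, SameColour.colours_eq⟩

theorem mem_cluster (hn : 3 ≤ n) {p q : Pos n k} :
    q ∈ cluster p ↔ Linked p q ∧ SameColour p q := by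
  classical
  rw [cluster, mem_filter, eq_comm (a := colours q), colours_eq_iff hn]
  simp

/-- The assembly `a` is got from `b` by exchanging cubies that look the same. -/
def SameUpTo (ρ : Equiv.Perm (Pos n k)) (a b : Assembly n k) : Prop :=
  ∀ p, SameColour p (ρ p) ∧ b.place (ρ p) = a.place p ∧
    ∀ l h h', (b.face (ρ p) ⟨l, h'⟩ : Fin n) = a.face p ⟨l, h⟩

theorem SameUpTo.linked {ρ : Equiv.Perm (Pos n k)} {a b : Assembly n k} (h : SameUpTo ρ a b)
    (p : Pos n k) : Linked p (ρ p) := by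
  have h1 := a.linked_place p
  rw [← (h p).2.1] at h1
  exact h1.trans (b.linked_place _).symm

/-- Exchanging cubies that look the same. -/
noncomputable def Assembly.relabel (b : Assembly n k) (ρ : Equiv.Perm (Pos n k))
    (hρ : ∀ p, Linked p (ρ p)) (hc : ∀ p, SameColour p (ρ p)) : Assembly n k where
  place := ρ.trans b.place
  linked_place p := (hρ p).trans (b.linked_place _)
  face p := (Equiv.subtypeEquivRight fun l => by rw [(hc p).1]).trans (b.face (ρ p))
  rigid p := by
    obtain ⟨σ, ε, h1, h2⟩ := b.rigid (ρ p)
    refine ⟨σ, ε, h1, fun l => ?_⟩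
    have hl : (l : Fin n) ∈ outer (ρ p) := by rw [(hc p).1]; exact l.2
    have h3 := h2 ⟨l, hl⟩
    refine ⟨h3.1, ?_⟩
    rw [← (hc p).2 l l.2]
    exact h3.2

theorem sameUpTo_relabel (b : Assembly n k) (ρ : Equiv.Perm (Pos n k))
    (hρ : ∀ p, Linked p (ρ p)) (hc : ∀ p, SameColour p (ρ p)) :
    SameUpTo ρ (b.relabel ρ hρ hc) b :=
  fun p => ⟨hc p, rfl, fun _ _ _ => rfl⟩

theorem Assembly.paint_eq_some {a : Assembly n k} {f : Face n k} {l : Fin n} {c : Fin k} :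
    a.paint f l = some c ↔ ∃ p, a.place p = f.pos ∧ p l = c ∧
      ∃ h : l ∈ outer p, (a.face p ⟨l, h⟩ : Fin n) ∈ f.axes := by
  unfold Assembly.paint
  constructor
  · intro h
    split_ifs at h with h1
    exact ⟨_, by simp, Option.some.inj h, h1⟩
  · rintro ⟨p, h1, h2, h3⟩
    have : a.place.symm f.pos = p := by rw [← h1, Equiv.symm_apply_apply]
    rw [this, if_pos h3, h2]

theorem colouring_ext {c d : Colouring n k} (h : ∀ f l x, c f l = some x ↔ d f l = some x) :
    c = d :=
  funext fun f => funext fun l => Option.ext fun x => h f l x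

theorem SameUpTo.paint_eq {ρ : Equiv.Perm (Pos n k)} {a b : Assembly n k} (h : SameUpTo ρ a b) :
    a.paint = b.paint := by
  apply colouring_ext
  intro f l x
  rw [Assembly.paint_eq_some, Assembly.paint_eq_some]
  constructor
  · rintro ⟨p, h1, h2, h3, h4⟩
    obtain ⟨g1, g2, g3⟩ := h p
    have h3' : l ∈ outer (ρ p) := by rw [g1.1]; exact h3
    exact ⟨ρ p, g2.trans h1, (g1.2 l h3).trans h2, h3', by rw [g3 l h3 h3']; exact h4⟩
  · rintro ⟨q, h1, h2, h3, h4⟩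
    obtain ⟨p, rfl⟩ := ρ.surjective q
    obtain ⟨g1, g2, g3⟩ := h p
    have h3' : l ∈ outer p := by rw [← g1.1]; exact h3
    exact ⟨p, g2.symm.trans h1, (g1.2 l h3').symm.trans h2, h3', by rw [← g3 l h3' h3]; exact h4⟩

/-- The faces of dimension `n - 1` at a position show all outer coordinates of the cubie there and
how they are turned, so only the inner coordinates remain undetermined. -/
theorem sameUpTo_of_paint_eq (hn : 3 ≤ n) {a b : Assembly n k} (h : a.paint = b.paint) :
    ∃ ρ, SameUpTo ρ a b := by
  have key : ∀ {a b : Assembly n k}, a.paint = b.paint → ∀ p l (hl : l ∈ outer p),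
      ∃ h' : l ∈ outer (b.place.symm (a.place p)), b.place.symm (a.place p) l = p l ∧
        (b.face _ ⟨l, h'⟩ : Fin n) = a.face p ⟨l, hl⟩ := by
    intro a b h p l hl
    have h1 : a.paint (axisFace hn (a.place p) (a.face p ⟨l, hl⟩)) l = some (p l) :=
      Assembly.paint_eq_some.2 ⟨p, rfl, rfl, hl, by simp [axisFace]⟩
    rw [h, Assembly.paint_eq_some] at h1
    obtain ⟨q, h2, h3, h4, h5⟩ := h1
    have hq : b.place.symm (a.place p) = q := by
      rw [Equiv.symm_apply_eq, h2]; rfl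
    subst hq
    exact ⟨h4, h3, by simpa [axisFace] using h5⟩
  refine ⟨a.place.trans b.place.symm, fun p => ⟨⟨?_, fun l hl => ?_⟩, by simp, fun l hl hl' => ?_⟩⟩
  -- The colours give an inclusion of outer axes; both cubies stand at the same position, hence are
  -- linked and have equally many.
  · apply (Finset.eq_of_subset_of_card_le (fun l hl => (key h p l hl).1) _).symm
    have hl : Linked p ((a.place.trans b.place.symm) p) := by
      have h1 := a.linked_place p
      have h2 := b.linked_place ((a.place.trans b.place.symm) p)
      simp only [Equiv.trans_apply, Equiv.apply_symm_apply] at h2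
      exact h1.trans h2.symm
    obtain ⟨σ, hσ⟩ := linked_iff.1 hl
    exact hσ.card_outer.le
  · exact (key h p l hl).2.1
  · exact (key h p l hl).2.2

theorem faceAfter_pos_axes (w : Combination n k) (f : Face n k) :
    (faceAfter w f).pos = posAfter w f.pos ∧
      (faceAfter w f).axes = f.axes.map (axesAfter w f.pos).toEmbedding := by
  induction w generalizing f with
  | nil =>
    refine ⟨rfl, ?_⟩
    ext x
    simp only [faceAfter, axesAfter, Finset.mem_map_equiv]
    rfl
  | cons t w ih =>
    obtain ⟨h1, h2⟩ := ih (t.face f)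
    refine ⟨h1, h2.trans ?_⟩
    simp only [LayerTurn.face, Finset.map_map]
    congr 1

theorem faceAfter_surjective (w : Combination n k) : Function.Surjective (faceAfter w) := by
  induction w with
  | nil => exact Function.surjective_id
  | cons t w ih =>
    refine ih.comp fun f => ⟨t.inv.face f, Face.ext' (t.inv.inv_pos_pos f.pos) ?_⟩
    ext x
    simp only [LayerTurn.face, Finset.mem_map_equiv]
    have := DFunLike.congr_fun (t.inv.inv_axes_axes f.pos)
    change (t.inv.axes f.pos).symm ((t.axes (t.inv.pos f.pos)).symm x) ∈ f.axes ↔ _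
    have e : (t.inv.axes f.pos).symm ((t.axes (t.inv.pos f.pos)).symm x) = x := by
      rw [Equiv.symm_apply_eq, Equiv.symm_apply_eq]
      exact (this x).symm
    rw [e]

theorem Assembly.paint_act (a : Assembly n k) (w : Combination n k) (f : Face n k) :
    (a.act w).paint (faceAfter w f) = a.paint f := by
  funext l
  apply Option.ext
  intro x
  rw [Assembly.paint_eq_some, Assembly.paint_eq_some]
  obtain ⟨h1, h2⟩ := faceAfter_pos_axes w f
  have hpos : ∀ p, (a.act w).place p = (faceAfter w f).pos ↔ a.place p = f.pos := by
    intro p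
    rw [h1, Assembly.act_place]
    exact (posAfter_bijective w).injective.eq_iff
  refine exists_congr fun p => ?_
  rw [hpos]
  refine and_congr_right fun hp => and_congr_right fun _ => exists_congr fun h => ?_
  rw [h2, ← hp]
  exact Finset.mem_map' (axesAfter w (a.place p)).toEmbedding

theorem connected_iff {a b : Assembly n k} :
    Connected a.paint b.paint ↔ ∃ w, (a.act w).paint = b.paint := by
  constructor
  · rintro ⟨w, hw⟩
    refine ⟨w, funext fun f => ?_⟩
    obtain ⟨f, rfl⟩ := faceAfter_surjective w f
    rw [hw, a.paint_act]
  · rintro ⟨w, hw⟩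
    exact ⟨w, fun f => by rw [← hw, a.paint_act]⟩

end Assemblies

/-! ### Orientations -/

section Orientations

variable {n k : ℕ} (R : Reference n k) {K : Cls n k}

theorem Reference.right_congr {x y : Pos n k} (e : x = y) (hx : cls x = K) (hy : cls y = K)
    (l : outer (R.base K)) : (R.right K x hx l : Fin n) = R.right K y hy l := by
  subst e; rfl

theorem Reference.orientation_spec (a : Assembly n k) (p : Pos n k) (h : cls p = K)
    (l : outer (R.base K)) :
    (a.face p (R.number K p h (R.orientation a K p h l)) : Fin n) =
      R.right K (a.place p) (cls_place a h) l := by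
  simp [Reference.orientation]

theorem Reference.eq_orientation (a : Assembly n k) (p : Pos n k) (h : cls p = K)
    (φ : Equiv.Perm (outer (R.base K)))
    (hφ : ∀ l, (a.face p (R.number K p h (φ l)) : Fin n) = R.right K (a.place p) (cls_place a h) l) :
    φ = R.orientation a K p h := by
  ext l : 1
  apply (R.number K p h).injective
  apply (a.face p).injective
  apply Subtype.ext
  rw [hφ, R.orientation_spec]

theorem Reference.orientation_sameUpTo {ρ : Equiv.Perm (Pos n k)} {a b : Assembly n k}
    (hρ : SameUpTo ρ a b) (p : Pos n k) (h : cls p = K) (h' : cls (ρ p) = K) :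
    R.orientation b K (ρ p) h' = R.orientation a K p h := by
  apply R.eq_orientation
  intro l
  obtain ⟨h1, h2, h3⟩ := hρ p
  have h4 := R.number_spec K p (ρ p) h h' h1.colours_eq
  have h5 := R.orientation_spec b (ρ p) h' l
  rw [R.right_congr h2 _ (cls_place a h)] at h5
  rw [← h5, ← h3 _ (Subtype.prop _) (by rw [h1.1]; exact Subtype.prop _)]
  congr 2
  exact Subtype.ext (h4 _)

/-- The change of the orientation of a cubie at a position by a combination. -/
noncomputable def Reference.twist (K : Cls n k) (w : Combination n k) (x : Pos n k) (hx : cls x = K) :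
    depGroup (R.base K) :=
  ⟨((R.right K x hx).trans (outerEquiv (reach_after w x))).trans
      (R.right K (posAfter w x) ((cls_eq_iff.2 (reach_after w x).linked).symm.trans hx)).symm,
    mem_depGroup.2 (((R.carries_right K x hx).trans (carries_outerEquiv _)).trans
      (R.carries_right K _ _).symm)⟩

/-- The change of orientation depends on the position passed through and not on the cubie, and it
multiplies on the right by an element of the dependent group. -/
theorem Reference.orientation_act (a : Assembly n k) (w : Combination n k) (p : Pos n k)
    (h : cls p = K) :
    R.orientation (a.act w) K p h =
      R.orientation a K p h * (R.twist K w (a.place p) (cls_place a h))⁻¹ := by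
  refine (R.eq_orientation _ _ _ _ fun l => ?_).symm
  set T := R.twist K w (a.place p) (cls_place a h) with hT
  obtain ⟨m, rfl⟩ := (T : Equiv.Perm (outer (R.base K))).surjective l
  rw [Assembly.act_face, Equiv.Perm.mul_apply, InvMemClass.coe_inv, Equiv.Perm.inv_def,
    Equiv.symm_apply_apply, R.orientation_spec]
  have h1 : R.right K (posAfter w (a.place p)) (cls_place (a.act w) h)
      ((T : Equiv.Perm (outer (R.base K))) m) =
      outerEquiv (reach_after w (a.place p)) (R.right K (a.place p) (cls_place a h) m) :=
    Equiv.apply_symm_apply _ _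
  exact (congrArg Subtype.val h1).symm

/-- Renumbering by `other` multiplies on the left and a dependent change multiplies on the right, so
the two do not interfere, and the choice between the two numberings stays the same. -/
theorem Reference.depOrientation_mul (a b : Assembly n k) {p q : Pos n k} (hp : cls p = K)
    (hq : cls q = K) (δ : depGroup (R.base K))
    (h : R.orientation b K q hq = R.orientation a K p hp * δ) :
    R.depOrientation b K q hq = R.depOrientation a K p hp * δ := by
  have h1 : R.orientation b K q hq ∈ depGroup (R.base K) ↔
      R.orientation a K p hp ∈ depGroup (R.base K) := by
    rw [h]; exact Subgroup.mul_mem_cancel_right _ δ.2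
  apply Subtype.ext
  unfold Reference.depOrientation
  by_cases h2 : R.orientation a K p hp ∈ depGroup (R.base K)
  · rw [dif_pos h2, dif_pos (h1.2 h2)]; exact h
  · rw [dif_neg h2, dif_neg (mt h1.1 h2)]
    simp only [h, Subgroup.coe_mul, mul_assoc]

open Classical in
theorem Reference.O_sameUpTo {ρ : Equiv.Perm (Pos n k)} {a b : Assembly n k}
    (hρ : SameUpTo ρ a b) (K : Cls n k) : R.O K a = R.O K b := by
  have hcls : ∀ p, cls (ρ p) = K ↔ cls p = K := fun p => by
    rw [cls_eq_iff.2 (hρ.linked p).symm]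
  unfold Reference.O
  rw [← Equiv.prod_comp (ρ.subtypePerm hcls) (fun p : {p : Pos n k // cls p = K} =>
    Abelianization.of (R.depOrientation b K p p.2))]
  refine prod_congr rfl fun p _ => ?_
  congr 1
  have := R.depOrientation_mul a b p.2 ((hcls p).2 p.2) 1
    (by rw [R.orientation_sameUpTo hρ p p.2]; simp)
  rw [mul_one] at this
  exact this.symm

/-- Right orientations are carried over from the base position, so reaching the right orientation
there is possible exactly when the orientation permutation is in the dependent group. The right
orientation of the base position itself need not be the identity, but lies in that group. -/
theorem Reference.simpleOrientation_eq [DecidablePred (· ∈ depGroup (R.base K))]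
    (a : Assembly n k) (p : Pos n k) (hp : cls p = K) :
    R.simpleOrientation a p = if R.orientation a K p hp ∈ depGroup (R.base K) then 1 else 0 := by
  subst hp
  classical
  unfold Reference.simpleOrientation
  refine if_congr ?_ rfl rfl
  set φ := R.orientation a (cls p) p rfl
  have hR : R.right (cls p) (R.base (cls p)) (R.cls_base _) ∈ depGroup (R.base (cls p)) :=
    mem_depGroup.2 (R.carries_right _ _ _)
  have hx := R.carries_right (cls p) (a.place p) (cls_place a rfl)
  have spec := R.orientation_spec a p (K := cls p) rfl
  constructor
  · rintro ⟨w, hw, h⟩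
    let f : outer (a.place p) ≃ outer (R.base (cls p)) :=
      outerEquiv (p := a.place p) (q := R.base (cls p)) (σ := axesAfter w (a.place p))
        (hw ▸ reach_after w (a.place p))
    have hf : Carries f := carries_outerEquiv _
    have h1 : (R.right (cls p) (R.base (cls p)) (R.cls_base _) : Equiv.Perm _) * φ ∈
        depGroup (R.base (cls p)) := by
      refine mem_depGroup.2 ?_
      have : (R.right (cls p) (R.base (cls p)) (R.cls_base _) : Equiv.Perm _) * φ =
          (R.right (cls p) (a.place p) (cls_place a rfl)).trans f := by
        ext l
        rw [Equiv.Perm.mul_apply, ← h, Equiv.trans_apply, outerEquiv_apply, ← spec]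
      rw [this]
      exact hx.trans hf
    exact (Subgroup.mul_mem_cancel_left _ hR).1 h1
  · intro h
    have h1 : (R.right (cls p) (R.base (cls p)) (R.cls_base _) : Equiv.Perm _) * φ ∈
        depGroup (R.base (cls p)) := Subgroup.mul_mem _ hR h
    obtain ⟨w, hw, h2⟩ := carries_iff.1 (hx.symm.trans (mem_depGroup.1 h1))
    refine ⟨w, hw, fun l => ?_⟩
    obtain ⟨m, rfl⟩ := φ.surjective l
    have h3 := h2 (R.right (cls p) (a.place p) (cls_place a rfl) m)
    rw [Equiv.trans_apply, Equiv.symm_apply_apply] at h3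
    have h4 : a.face p (R.number (cls p) p rfl (φ m)) =
        R.right (cls p) (a.place p) (cls_place a rfl) m := Subtype.ext (spec m)
    rw [h4, ← h3]
    rfl

theorem Reference.simpleOrientation_sameUpTo {ρ : Equiv.Perm (Pos n k)} {a b : Assembly n k}
    (hρ : SameUpTo ρ a b) (p : Pos n k) :
    R.simpleOrientation a p = R.simpleOrientation b (ρ p) := by
  classical
  have h : cls (ρ p) = cls p := cls_eq_iff.2 (hρ.linked p).symm
  rw [R.simpleOrientation_eq a p rfl, R.simpleOrientation_eq b (ρ p) h,
    R.orientation_sameUpTo hρ p rfl h]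

theorem Reference.simpleOrientation_act (a : Assembly n k) (w : Combination n k) (p : Pos n k) :
    R.simpleOrientation (a.act w) p = R.simpleOrientation a p := by
  classical
  rw [R.simpleOrientation_eq _ p rfl, R.simpleOrientation_eq _ p rfl, R.orientation_act]
  refine if_congr ?_ rfl rfl
  exact Subgroup.mul_mem_cancel_right _ (Subgroup.inv_mem _ (Subtype.prop _))

theorem Reference.Cl_act (a : Assembly n k) (w : Combination n k) (s : Finset (Pos n k)) :
    R.Cl s (a.act w) = R.Cl s a :=
  sum_congr rfl fun p _ => R.simpleOrientation_act a w p

theorem Reference.Cl_sameUpTo (hn : 3 ≤ n) {ρ : Equiv.Perm (Pos n k)} {a b : Assembly n k}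
    (hρ : SameUpTo ρ a b) (p : Pos n k) : R.Cl (cluster p) a = R.Cl (cluster p) b := by
  unfold Reference.Cl
  refine sum_bij (fun q _ => ρ q) (fun q hq => ?_) (fun _ _ _ _ e => ρ.injective e)
    (fun q hq => ?_) fun q _ => R.simpleOrientation_sameUpTo hρ q
  · rw [mem_cluster hn] at hq ⊢
    exact ⟨hq.1.trans (hρ.linked q), hq.2.trans (hρ q).1⟩
  · obtain ⟨q, rfl⟩ := ρ.surjective q
    rw [mem_cluster hn] at hq
    exact ⟨q, (mem_cluster hn).2 ⟨hq.1.trans (hρ.linked q).symm, hq.2.trans (hρ q).1.symm⟩, rfl⟩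

/-! ### Invariance of the orientation invariant -/

open Classical in
/-- The total change of orientation of a class by a combination. -/
noncomputable def Reference.totalTwist (K : Cls n k) (w : Combination n k) :
    Abelianization (depGroup (R.base K)) :=
  ∏ x : {p : Pos n k // cls p = K}, Abelianization.of (R.twist K w x x.2)

theorem cls_posAfter (w : Combination n k) (p : Pos n k) : cls (posAfter w p) = cls p :=
  (cls_eq_iff.2 (reach_after w p).linked).symm

open Classical in
theorem Reference.O_act (a : Assembly n k) (w : Combination n k) (K : Cls n k) :
    R.O K (a.act w) = R.O K a * (R.totalTwist K w)⁻¹ := by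
  have hcls : ∀ p, cls (a.place p) = K ↔ cls p = K := fun p => by
    rw [cls_eq_iff.2 (a.linked_place p).symm]
  unfold Reference.O Reference.totalTwist
  rw [← Equiv.prod_comp (a.place.subtypePerm hcls) (fun x : {p : Pos n k // cls p = K} =>
    Abelianization.of (R.twist K w x x.2)), ← prod_inv_distrib, ← prod_mul_distrib]
  refine prod_congr rfl fun p _ => ?_
  rw [← map_inv, ← map_mul]
  congr 1
  exact R.depOrientation_mul a (a.act w) p.2 p.2 _ (R.orientation_act a w p p.2)

theorem Reference.twist_append (v w : Combination n k) (x : Pos n k) (hx : cls x = K) :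
    R.twist K (v ++ w) x hx =
      R.twist K w (posAfter v x) ((cls_posAfter v x).trans hx) * R.twist K v x hx := by
  apply Subtype.ext
  refine Equiv.ext fun l => ?_
  have h1 : ∀ (w : Combination n k) (x : Pos n k) (hx : cls x = K) (l : outer (R.base K)),
      (R.right K (posAfter w x) ((cls_posAfter w x).trans hx)
        ((R.twist K w x hx : Equiv.Perm (outer (R.base K))) l) : Fin n) =
      axesAfter w x (R.right K x hx l) := fun w x hx l =>
    congrArg Subtype.val (Equiv.apply_symm_apply (R.right K (posAfter w x) _) _)
  apply (R.right K (posAfter (v ++ w) x) ((cls_posAfter _ x).trans hx)).injective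
  apply Subtype.ext
  rw [h1, R.right_congr (posAfter_append v w x) _ ((cls_posAfter w _).trans
    ((cls_posAfter v x).trans hx)), Subgroup.coe_mul, Equiv.Perm.mul_apply, h1, h1,
    axesAfter_append, Equiv.Perm.mul_apply]

open Classical in
-- The twist is a cocycle over the action on positions, so its product over a class is
-- multiplicative; single layer rotations are then all that must be examined.
theorem Reference.totalTwist_append (v w : Combination n k) :
    R.totalTwist K (v ++ w) = R.totalTwist K w * R.totalTwist K v := by
  have hcls : ∀ p, cls (combPos v p) = K ↔ cls p = K := fun p => by
    rw [combPos_apply, cls_posAfter]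
  unfold Reference.totalTwist
  rw [← Equiv.prod_comp ((combPos v).subtypePerm hcls) (fun x : {p : Pos n k // cls p = K} =>
    Abelianization.of (R.twist K w x x.2)), ← prod_mul_distrib]
  refine prod_congr rfl fun p _ => ?_
  rw [R.twist_append, map_mul]
  rfl

end Orientations

end Rubik

namespace Rubik

open Finset

/-! ### Permutations built from cycles of length four -/

section FourCycles

variable {α : Type*}

theorem sameCycle_of_pow_four {f : Equiv.Perm α} (h4 : f ^ 4 = 1) {x y : α} (h : f.SameCycle x y) :
    y = x ∨ y = f x ∨ y = f (f x) ∨ y = f (f (f x)) := by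
  obtain ⟨i, rfl⟩ := h
  have h5 : f ^ i = f ^ (i % 4) := by
    conv_lhs => rw [← Int.emod_add_mul_ediv i 4, zpow_add, zpow_mul]
    norm_cast
    rw [h4]; simp
  rw [h5]
  have h6 : i % 4 = 0 ∨ i % 4 = 1 ∨ i % 4 = 2 ∨ i % 4 = 3 := by omega
  rcases h6 with h6 | h6 | h6 | h6 <;> rw [h6]
  · left; rfl
  · right; left; simp
  · right; right; left; rfl
  · right; right; right; rfl

open Classical in
-- Only orbits of lengths 1 and 4 occur, and the product over each of them is 1.
theorem prod_eq_one_of_pow_four [Fintype α] {G : Type*} [CommMonoid G] {f : Equiv.Perm α}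
    (h4 : f ^ 4 = 1) (h2 : ∀ x, f (f x) = x → f x = x) (c : α → G) (hc : ∀ x, f x = x → c x = 1)
    (hc4 : ∀ x, c x * c (f x) * c (f (f x)) * c (f (f (f x))) = 1) : ∏ x, c x = 1 := by
  refine prod_cancels_of_partition_cancels (Equiv.Perm.SameCycle.setoid f) fun x _ => ?_
  by_cases hx : f x = x
  · refine prod_eq_one fun y hy => ?_
    have h := sameCycle_of_pow_four h4 (Equiv.Perm.SameCycle.symm (mem_filter.1 hy).2)
    simp only [hx, or_self] at h
    rw [h]; exact hc x hx
  · have h4x : f (f (f (f x))) = x := DFunLike.congr_fun h4 x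
    have n1 : f (f x) ≠ x := fun e => hx (h2 x e)
    have n2 : f (f (f x)) ≠ x := fun e => hx (by rw [← e, h4x, e])
    have e : univ.filter (fun y => (Equiv.Perm.SameCycle.setoid f).r y x) =
        {x, f x, f (f x), f (f (f x))} := by
      ext y
      simp only [mem_filter, mem_univ, true_and, mem_insert, mem_singleton]
      constructor
      · exact fun h => sameCycle_of_pow_four h4 (Equiv.Perm.SameCycle.symm h)
      · rintro (rfl | rfl | rfl | rfl)
        · exact Equiv.Perm.SameCycle.refl _ _
        · exact (Equiv.Perm.sameCycle_apply_left).2 (Equiv.Perm.SameCycle.refl _ _)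
        · change f.SameCycle _ _
          simp only [Equiv.Perm.sameCycle_apply_left]
          exact Equiv.Perm.SameCycle.refl _ _
        · change f.SameCycle _ _
          simp only [Equiv.Perm.sameCycle_apply_left]
          exact Equiv.Perm.SameCycle.refl _ _
    refine (congrArg (fun s => ∏ y ∈ s, c y) e).trans ?_
    rw [prod_insert, prod_insert, prod_pair, ← hc4 x, mul_assoc, mul_assoc]
    · simpa using fun e => hx e.symm
    · simp only [mem_insert, mem_singleton, EmbeddingLike.apply_eq_iff_eq, not_or]
      exact ⟨fun e => hx e.symm, fun e => n1 e.symm⟩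
    · simp only [mem_insert, mem_singleton, not_or]
      exact ⟨fun e => hx e.symm, fun e => n1 e.symm, fun e => n2 e.symm⟩

open Classical in
/-- The sign of the restriction of a permutation to a set that it preserves. -/
noncomputable def signOn [Fintype α] (S : α → Prop) (f : Equiv.Perm α) : ℤˣ :=
  if h : ∀ x, S (f x) ↔ S x then Equiv.Perm.sign (f.subtypePerm h) else 1

open Classical in
theorem signOn_eq [Fintype α] {S : α → Prop} {f : Equiv.Perm α} (h : ∀ x, S (f x) ↔ S x) :
    signOn S f = Equiv.Perm.sign (f.subtypePerm h) := dif_pos h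

theorem signOn_mul [Fintype α] {S : α → Prop} {f g : Equiv.Perm α} (hf : ∀ x, S (f x) ↔ S x)
    (hg : ∀ x, S (g x) ↔ S x) : signOn S (f * g) = signOn S f * signOn S g := by
  classical
  rw [signOn_eq hf, signOn_eq hg, signOn_eq (f := f * g) fun x => (hf _).trans (hg x), ← map_mul]
  rfl

theorem signOn_inv [Fintype α] {S : α → Prop} {f : Equiv.Perm α} (hf : ∀ x, S (f x) ↔ S x) :
    signOn S f⁻¹ = signOn S f := by
  classical
  have hi : ∀ x, S (f⁻¹ x) ↔ S x := fun x => by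
    rw [← hf]; simp
  have h := signOn_mul hf hi
  rw [mul_inv_cancel] at h
  have h1 : signOn S (1 : Equiv.Perm α) = 1 := by
    rw [signOn_eq fun _ => Iff.rfl]
    exact Equiv.Perm.sign_one
  rw [h1] at h
  exact (eq_inv_of_mul_eq_one_right h.symm).trans (Int.units_inv_eq_self _)

theorem signOn_congr [Fintype α] {S : α → Prop} {f g : Equiv.Perm α} (h : ∀ x, S x → f x = g x)
    (hf : ∀ x, S (f x) ↔ S x) (hg : ∀ x, S (g x) ↔ S x) : signOn S f = signOn S g := by
  rw [signOn_eq hf, signOn_eq hg]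
  congr 1
  ext x
  exact h x x.2

theorem signOn_eq_one [Fintype α] {S : α → Prop} {f : Equiv.Perm α} (h : ∀ x, S x → f x = x) :
    signOn S f = 1 := by
  classical
  by_cases hf : ∀ x, S (f x) ↔ S x
  · rw [signOn_congr (g := 1) h hf fun _ => Iff.rfl, signOn_eq fun _ => Iff.rfl]
    exact Equiv.Perm.sign_one
  · exact dif_neg hf

theorem signOn_swap [Fintype α] [DecidableEq α] {S : α → Prop} {x y : α}
    (hxy : x ≠ y) (hx : S x)
    (hy : S y) {f : Equiv.Perm α} (hf : ∀ z, S z → f z = Equiv.swap x y z) : signOn S f = -1 := by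
  classical
  have h1 : ∀ z, S z → S (f z) := by
    intro z hz
    rw [hf z hz, Equiv.swap_apply_def]
    split_ifs
    exacts [hy, hx, hz]
  have h2 : ∀ z, S (f z) ↔ S z := by
    refine fun z => ⟨fun hz => ?_, h1 z⟩
    have h3 := hf _ (h1 _ hz)
    have h4 := hf _ hz
    have h5 : f (f z) = z := f.injective (by rw [h3, h4, Equiv.swap_apply_self])
    exact h5 ▸ h1 _ hz
  have e : f.subtypePerm h2 = Equiv.swap (⟨x, hx⟩ : {z // S z}) ⟨y, hy⟩ := by
    ext z
    refine (hf z z.2).trans ?_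
    rw [Equiv.swap_apply_def, Equiv.swap_apply_def]
    simp only [Subtype.ext_iff]
    split_ifs <;> rfl
  rw [signOn_eq h2, e]
  convert Equiv.Perm.sign_swap (x := (⟨x, hx⟩ : {z // S z})) (y := ⟨y, hy⟩)
    fun e => hxy (congrArg Subtype.val e)

/-- On `S` the permutation is a single 4-cycle, which is odd. -/
theorem signOn_four [Fintype α] {S : α → Prop} {f : Equiv.Perm α} (hf : ∀ x, S (f x) ↔ S x) {x : α}
    (hx : S x) (h4 : f (f (f (f x))) = x) (h2 : f (f x) ≠ x)
    (h : ∀ y, S y → f y = y ∨ y = x ∨ y = f x ∨ y = f (f x) ∨ y = f (f (f x))) :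
    signOn S f = -1 := by
  classical
  rw [signOn_eq hf]
  set g := f.subtypePerm hf with hg
  have n0 : f x ≠ x := fun e => h2 (by rw [e, e])
  have n2 : f (f (f x)) ≠ x := fun e => n0 (by rw [← e, h4, e])
  let x' : {x // S x} := ⟨x, hx⟩
  have h' : ∀ y, g y ≠ y → y = x' ∨ y = g x' ∨ y = g (g x') ∨ y = g (g (g x')) := by
    intro y hy
    rcases h y y.2 with e | e | e | e | e
    · exact absurd (Subtype.ext e) hy
    · exact Or.inl (Subtype.ext e)
    · exact Or.inr (Or.inl (Subtype.ext e))
    · exact Or.inr (Or.inr (Or.inl (Subtype.ext e)))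
    · exact Or.inr (Or.inr (Or.inr (Subtype.ext e)))
  have m0 : x' ≠ g x' := fun e => n0 (congrArg Subtype.val e).symm
  have m1 : x' ≠ g (g x') := fun e => h2 (congrArg Subtype.val e).symm
  have m2 : x' ≠ g (g (g x')) := fun e => n2 (congrArg Subtype.val e).symm
  have hcyc : g.IsCycle := by
    refine ⟨x', m0.symm, fun y hy => ?_⟩
    rcases h' y hy with rfl | rfl | rfl | rfl <;>
      simp only [Equiv.Perm.sameCycle_apply_right, Equiv.Perm.SameCycle.refl]
  have hsupp : g.support = {x', g x', g (g x'), g (g (g x'))} := by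
    ext y
    simp only [Equiv.Perm.mem_support, mem_insert, mem_singleton]
    refine ⟨h' y, ?_⟩
    rintro (rfl | rfl | rfl | rfl)
    · exact m0.symm
    all_goals simpa using m0.symm
  rw [hcyc.sign, hsupp, card_insert_of_notMem, card_insert_of_notMem, card_pair]
  · decide
  · simpa using m0
  · simpa using ⟨m0, m1⟩
  · simpa using ⟨m0, m1, m2⟩

end FourCycles

/-! ### The total twist of a combination vanishes -/

section TotalTwist

variable {n k : ℕ}

theorem rotate_four {i j : Fin n} (h : i ≠ j) (p : Pos n k) :
    rotate i j (rotate i j (rotate i j (rotate i j p))) = p := by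
  funext l
  unfold rotate
  by_cases h1 : l = i
  · subst h1; simp [h.symm]
  · by_cases h2 : l = j
    · subst h2; simp [h.symm]
    · simp [h1, h2]

theorem rotate_two {i j : Fin n} (h : i ≠ j) {p : Pos n k} (hp : rotate i j (rotate i j p) = p) :
    (p i).rev = p i ∧ (p j).rev = p j := by
  have h1 := congrFun hp i
  have h2 := congrFun hp j
  simp only [rotate, if_true, if_neg h.symm] at h1 h2
  exact ⟨h1, h2⟩

theorem LayerTurn.pos_four (t : LayerTurn n k) (p : Pos n k) :
    t.pos (t.pos (t.pos (t.pos p))) = p := by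
  by_cases h : ∀ l, l ∉ t.free → p l = t.level l
  · have h1 := (t.mem_layer_pos p).2 h
    have h2 := (t.mem_layer_pos _).2 h1
    have h3 := (t.mem_layer_pos _).2 h2
    rw [t.pos_of_mem h3, t.pos_of_mem h2, t.pos_of_mem h1, t.pos_of_mem h, rotate_four t.i_ne_j]
  · simp only [t.pos_of_not h]

theorem LayerTurn.axes_four (t : LayerTurn n k) (p : Pos n k) :
    t.axes (t.pos (t.pos (t.pos p))) * t.axes (t.pos (t.pos p)) * t.axes (t.pos p) * t.axes p =
      1 := by
  by_cases h : ∀ l, l ∉ t.free → p l = t.level l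
  · have h1 := (t.mem_layer_pos p).2 h
    have h2 := (t.mem_layer_pos _).2 h1
    have h3 := (t.mem_layer_pos _).2 h2
    rw [t.axes_of_mem h3, t.axes_of_mem h2, t.axes_of_mem h1, t.axes_of_mem h,
      Equiv.swap_mul_self, one_mul, Equiv.swap_mul_self]
  · simp [t.pos_of_not h, t.axes_of_not h]

/-- The square reverses two factors. If it fixes a position of the layer, both are the middle
factor, and then the rotation itself fixes the position. So no orbit has length 2. -/
theorem LayerTurn.pos_two (t : LayerTurn n k) {p : Pos n k} (hp : t.pos (t.pos p) = p) :
    t.pos p = p := by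
  by_cases h : ∀ l, l ∉ t.free → p l = t.level l
  · have h1 := (t.mem_layer_pos p).2 h
    have hp' := hp
    rw [t.pos_of_mem h1, t.pos_of_mem h] at hp
    have h2 := rotate_two t.i_ne_j hp
    rw [rev_eq_iff, rev_eq_iff] at h2
    have h3 : p t.i = p t.j := by
      obtain ⟨e, he⟩ := kd_eq_iff.1 (show kd (p t.i) = kd (p t.j) by omega)
      rcases flip_eq_or e (p t.i) with h | h <;> rw [h] at he
      · exact he.symm
      · rw [he]; exact (rev_eq_iff.2 h2.1).symm
    rw [t.pos_of_mem h, rotate_eq_self_iff t.i_ne_j]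
    exact ⟨h3, rev_eq_iff.2 h2.2⟩
  · exact t.pos_of_not h

theorem LayerTurn.axes_of_pos_eq (hk : 2 ≤ k) (t : LayerTurn n k) {p : Pos n k} (hp : t.pos p = p)
    (l : outer p) : t.axes p l = l := by
  by_cases h : ∀ l, l ∉ t.free → p l = t.level l
  · rw [t.pos_of_mem h, rotate_eq_self_iff t.i_ne_j] at hp
    rw [t.axes_of_mem h]
    have hl := rev_ne_of_kd_zero hk (mem_outer.1 l.2)
    refine Equiv.swap_apply_of_ne_of_ne (fun e => hl ?_) (fun e => hl ?_)
    · rw [e, hp.1]; exact hp.2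
    · rw [e]; exact hp.2
  · rw [t.axes_of_not h]; rfl

theorem Reference.twist_eq_one (R : Reference n k) {K : Cls n k} (w : Combination n k) {x : Pos n k}
    (hx : cls x = K) (h : posAfter w x = x) (h' : ∀ l : outer x, axesAfter w x l = l) :
    R.twist K w x hx = 1 := by
  apply Subtype.ext
  refine Equiv.ext fun l => ?_
  apply (R.right K (posAfter w x) ((cls_posAfter w x).trans hx)).injective
  apply Subtype.ext
  have h1 : (R.right K (posAfter w x) ((cls_posAfter w x).trans hx)
        ((R.twist K w x hx : Equiv.Perm (outer (R.base K))) l) : Fin n) =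
      axesAfter w x (R.right K x hx l) :=
    congrArg Subtype.val (Equiv.apply_symm_apply (R.right K (posAfter w x) _) _)
  rw [h1, h', ← R.right_congr h ((cls_posAfter w x).trans hx) hx]
  rfl

open Classical in
-- For a single rotation the twist is trivial at a fixed position, and the four twists along an
-- orbit of length 4 multiply to the twist of the fourth power, which does nothing.
theorem Reference.totalTwist_eq_one (hk : 2 ≤ k) (R : Reference n k) (K : Cls n k)
    (w : Combination n k) : R.totalTwist K w = 1 := by
  induction w with
  | nil => exact prod_eq_one fun x _ => (congrArg Abelianization.of
      (R.twist_eq_one [] x.2 rfl fun _ => rfl)).trans (map_one _)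
  | cons t w ih =>
    rw [← List.singleton_append, R.totalTwist_append, ih, one_mul]
    have hcls : ∀ p, cls (t.posPerm p) = K ↔ cls p = K := fun p => by
      rw [show t.posPerm p = posAfter [t] p from rfl, cls_posAfter]
    refine prod_eq_one_of_pow_four (f := t.posPerm.subtypePerm hcls) ?_ ?_ _ ?_ ?_
    · ext x : 2
      exact t.pos_four x
    · intro x hx
      exact Subtype.ext (t.pos_two (congrArg Subtype.val hx))
    · intro x hx
      have hx' : t.pos x = x := congrArg Subtype.val hx
      rw [R.twist_eq_one [t] x.2 hx' (fun l => t.axes_of_pos_eq hk hx' l), map_one]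
    · intro x
      have h1 : ∀ (y : Pos n k) (hy : cls y = K), cls (t.pos y) = K := fun y hy => by
        rw [← hy]; exact cls_posAfter [t] y
      have h2 : R.twist K [t, t, t, t] x x.2 = 1 := by
        refine R.twist_eq_one _ x.2 (t.pos_four x) fun l => ?_
        have := DFunLike.congr_fun (t.axes_four x) l.1
        simpa [axesAfter] using this
      have h3 : R.twist K [t, t, t, t] x x.2 =
          R.twist K [t] (t.pos (t.pos (t.pos x))) (h1 _ (h1 _ (h1 _ x.2))) *
            R.twist K [t] (t.pos (t.pos x)) (h1 _ (h1 _ x.2)) *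
            R.twist K [t] (t.pos x) (h1 _ x.2) * R.twist K [t] x x.2 := by
        rw [← List.singleton_append, R.twist_append [t] [t, t, t]]
        congr 1
        refine (R.twist_append [t] [t, t] (t.pos x) (h1 _ x.2)).trans ?_
        congr 1
        exact R.twist_append [t] [t] (t.pos (t.pos x)) (h1 _ (h1 _ x.2))
      have h4 := (congrArg Abelianization.of (h3.symm.trans h2)).trans (map_one _)
      rw [map_mul, map_mul, map_mul] at h4
      rw [← h4]
      change _ * Abelianization.of (R.twist K [t] (t.pos x) _) *
        Abelianization.of (R.twist K [t] (t.pos (t.pos x)) _) *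
        Abelianization.of (R.twist K [t] (t.pos (t.pos (t.pos x))) _) = _
      ac_rfl

theorem Reference.O_act_eq (hk : 2 ≤ k) (R : Reference n k) (a : Assembly n k) (w : Combination n k)
    (K : Cls n k) : R.O K (a.act w) = R.O K a := by
  rw [R.O_act, R.totalTwist_eq_one hk, inv_one, mul_one]

end TotalTwist

end Rubik

namespace Rubik

open Finset

/-! ### The signs of the rotations of planes -/

section Signs

variable {n k : ℕ}

/-- A set of positions that is a union of classes. -/
def IsClassSet (S : Pos n k → Prop) : Prop := ∀ p q, Linked p q → (S p ↔ S q)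

theorem isClassSet_central (m : ℕ) : IsClassSet (n := n) (k := k) (IsCentral m) :=
  fun _ _ h => ⟨fun hp => hp.of_linked h, fun hq => hq.of_linked h.symm⟩

theorem isClassSet_cls (K : Cls n k) : IsClassSet fun p : Pos n k => cls p = K := fun p q h => by
  simp only [cls_eq_iff.2 h]

theorem linked_combPos (w : Combination n k) (p : Pos n k) : Linked p (combPos w p) := ⟨w, rfl⟩

theorem IsClassSet.combPos {S : Pos n k → Prop} (hS : IsClassSet S) (w : Combination n k)
    (p : Pos n k) : S (combPos w p) ↔ S p := (hS _ _ (linked_combPos w p)).symm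

theorem combPos_cons (t : LayerTurn n k) (w : Combination n k) :
    combPos (t :: w) = combPos w * combPos [t] := combPos_append [t] w

theorem eq_of_rev_eq {a b : Fin k} (ha : a.rev = a) (hb : b.rev = b) : a = b := by
  rw [Fin.ext_iff, Fin.val_rev] at *
  omega

theorem eq_or_eq_rev_of_kd {a b : Fin k} (h : kd a = kd b) : b = a ∨ b = a.rev := by
  obtain ⟨e, rfl⟩ := kd_eq_iff.1 h
  exact flip_eq_or e a

theorem Coplanar.trans' {i j : Fin n} {v p q : Pos n k} (h : Coplanar i j v p)
    (h' : Coplanar i j v q) : Coplanar i j p q := fun l h1 h2 => by rw [h l h1 h2, h' l h1 h2]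

theorem Coplanar.ext {i j : Fin n} {p q : Pos n k} (h : Coplanar i j p q) (hi : q i = p i)
    (hj : q j = p j) : q = p := by
  funext l
  by_cases h1 : l = i
  · rw [h1, hi]
  · by_cases h2 : l = j
    · rw [h2, hj]
    · exact h l h1 h2

theorem coplanar_self {i j : Fin n} (p : Pos n k) : Coplanar i j p p := fun _ _ _ => rfl

theorem rotate_fst {i j : Fin n} (p : Pos n k) : rotate i j p i = (p j).rev := if_pos rfl

theorem rotate_snd {i j : Fin n} (h : i ≠ j) (p : Pos n k) : rotate i j p j = p i := by
  simp [rotate, h.symm]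

/-- Two positions in a plane are related by its rotations. -/
def PlaneRelated (i j : Fin n) (p q : Pos n k) : Prop :=
  q = p ∨ q = rotate i j p ∨ q = rotate i j (rotate i j p) ∨
    q = rotate i j (rotate i j (rotate i j p))

theorem planeRelated_of_values {i j : Fin n} (hij : i ≠ j) {p q : Pos n k} (h : Coplanar i j p q)
    (h' : q i = p i ∧ q j = p j ∨ q i = (p j).rev ∧ q j = p i ∨
      q i = (p i).rev ∧ q j = (p j).rev ∨ q i = p j ∧ q j = (p i).rev) : PlaneRelated i j p q := by
  have hc : ∀ {q r : Pos n k}, Coplanar i j (rotate i j q) r ↔ Coplanar i j q r := fun {q r} =>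
    forall_congr' fun l => forall_congr' fun h1 => forall_congr' fun h2 => by
      simp [rotate, h1, h2]
  rcases h' with h' | h' | h' | h'
  · exact Or.inl (h.ext h'.1 h'.2)
  · exact Or.inr (Or.inl ((hc.2 h).ext (by rw [rotate_fst, h'.1]) (by rw [rotate_snd hij, h'.2])))
  · refine Or.inr (Or.inr (Or.inl ((hc.2 (hc.2 h)).ext ?_ ?_))) <;>
      simp only [rotate_fst, rotate_snd hij, h'.1, h'.2]
  · refine Or.inr (Or.inr (Or.inr ((hc.2 (hc.2 (hc.2 h))).ext ?_ ?_))) <;>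
      simp only [rotate_fst, rotate_snd hij, h'.1, h'.2, Fin.rev_rev]

/-- These are the four corners of the plane, which form one orbit. -/
theorem planeRelated_of_outer {i j : Fin n} (hij : i ≠ j) {p q : Pos n k} (h : Coplanar i j p q)
    (hi : kd (p i) = 0) (hj : kd (p j) = 0) (hi' : kd (q i) = 0) (hj' : kd (q j) = 0) :
    PlaneRelated i j p q := by
  apply planeRelated_of_values hij h
  rcases eq_or_eq_rev_of_kd (hi.trans hi'.symm) with h1 | h1 <;>
    rcases eq_or_eq_rev_of_kd (hj.trans hj'.symm) with h2 | h2 <;>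
    rcases eq_or_eq_rev_of_kd (hi.trans hj.symm) with h3 | h3 <;>
    rw [h1, h2, h3] <;> simp

/-- These are the midpoints of the four edges of the plane, which form one orbit. -/
theorem planeRelated_of_central {i j : Fin n} (hij : i ≠ j) {p q : Pos n k} (h : Coplanar i j p q)
    (hi : kd (p i) = 0) (hj : (p j).rev = p j)
    (hq : kd (q i) = 0 ∧ (q j).rev = q j ∨ kd (q j) = 0 ∧ (q i).rev = q i) :
    PlaneRelated i j p q := by
  apply planeRelated_of_values hij h
  rcases hq with ⟨h1, h2⟩ | ⟨h1, h2⟩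
  · rw [eq_of_rev_eq h2 hj]
    rcases eq_or_eq_rev_of_kd (hi.trans h1.symm) with h3 | h3 <;> rw [h3] <;> simp [hj]
  · rw [eq_of_rev_eq h2 hj]
    rcases eq_or_eq_rev_of_kd (hi.trans h1.symm) with h3 | h3 <;> rw [h3] <;> simp [hj]

/-- The plane contains just one nontrivial orbit of `S`. It has length 4 because the factor of `p`
at `i` is not self-opposite. -/
theorem signOn_planeTurn {S : Pos n k → Prop} (hS : IsClassSet S) {i j : Fin n} (hij : i ≠ j)
    {v p : Pos n k} (hp : Coplanar i j v p) (hSp : S p) (hpp : (p i).rev ≠ p i)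
    (h : ∀ q, S q → Coplanar i j v q → rotate i j q = q ∨ PlaneRelated i j p q) :
    signOn S (combPos [planeTurn hij v]) = -1 := by
  have e : ∀ q, Coplanar i j v q → combPos [planeTurn hij v] q = rotate i j q := fun q hq =>
    planeTurn_pos_of_coplanar hij hq
  have h1 := coplanar_rotate.2 hp
  have h2 := coplanar_rotate.2 h1
  have h3 := coplanar_rotate.2 h2
  refine signOn_four (hS.combPos _) hSp ?_ ?_ fun q hq => ?_
  · rw [e _ hp, e _ h1, e _ h2, e _ h3, rotate_four hij]
  · rw [e _ hp, e _ h1]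
    exact fun h => hpp (rotate_two hij h).1
  · rw [e _ hp, e _ h1, e _ h2]
    by_cases hc : Coplanar i j v q
    · rw [e _ hc]
      exact h q hq hc
    · exact Or.inl (planeTurn_pos_of_not hij hc)

theorem signOn_planeTurn_one {S : Pos n k → Prop} {i j : Fin n} (hij : i ≠ j) {v : Pos n k}
    (h : ∀ q, S q → Coplanar i j v q → rotate i j q = q) :
    signOn S (combPos [planeTurn hij v]) = 1 := by
  refine signOn_eq_one fun q hq => ?_
  by_cases hc : Coplanar i j v q
  · exact (planeTurn_pos_of_coplanar hij hc).trans (h q hq hc)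
  · exact planeTurn_pos_of_not hij hc

theorem card_outer_of_coplanar {i j : Fin n} (hij : i ≠ j) {v p : Pos n k} (h : Coplanar i j v p) :
    #(outer p) = #(outer v \ {i, j}) + ((if kd (p i) = 0 then 1 else 0) +
      if kd (p j) = 0 then 1 else 0) := by
  have h1 : outer p \ {i, j} = outer v \ {i, j} := by
    ext l
    simp only [mem_sdiff, mem_insert, mem_singleton, not_or, mem_outer]
    exact and_congr_left fun hl => by rw [h l hl.1 hl.2]
  rw [← h1, ← card_sdiff_add_card_inter (outer p) {i, j}]
  congr 1
  rw [inter_comm, ← filter_mem_eq_inter, card_filter, sum_pair hij]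
  simp only [mem_outer]

theorem card_outer_sdiff_add_two_le {i j : Fin n} (hij : i ≠ j) (v : Pos n k) :
    #(outer v \ {i, j}) + 2 ≤ n := by
  rw [← card_pair hij]
  have h := card_le_univ (outer v ∪ {i, j})
  rw [← card_sdiff_add_card, Fintype.card_fin] at h
  exact h

theorem rotate_eq_self {i j : Fin n} (hij : i ≠ j) {p : Pos n k} (hi : (p i).rev = p i)
    (hj : (p j).rev = p j) : rotate i j p = p :=
  (rotate_eq_self_iff hij).2 ⟨eq_of_rev_eq hi hj, hj⟩

/-- The middle index. -/
theorem exists_middle (h : Odd k) : ∃ c : Fin k, c.rev = c := by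
  obtain ⟨r, rfl⟩ := h
  exact ⟨⟨r, by omega⟩, by rw [Fin.ext_iff, Fin.val_rev]; simp; omega⟩

theorem odd_of_rev_eq {c : Fin k} (h : c.rev = c) : Odd k := by
  rw [rev_eq_iff] at h
  exact ⟨kd c, h.symm⟩

theorem IsCentral.kd_or {m : ℕ} {p : Pos n k} (h : IsCentral m p) (l : Fin n) :
    kd (p l) = 0 ∨ (p l).rev = p l := by
  by_cases hl : l ∈ outer p
  · exact Or.inl (mem_outer.1 hl)
  · exact Or.inr (h.2 l hl)

theorem isCentral_of_coplanar {i j : Fin n} (hij : i ≠ j) {v p : Pos n k} (h : Coplanar i j v p)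
    (hv : ∀ l, l ≠ i → l ≠ j → kd (v l) = 0 ∨ (v l).rev = v l)
    (hi : kd (p i) = 0 ∨ (p i).rev = p i) (hj : kd (p j) = 0 ∨ (p j).rev = p j) {m : ℕ}
    (hm : m = #(outer v \ {i, j}) + ((if kd (p i) = 0 then 1 else 0) +
      if kd (p j) = 0 then 1 else 0)) : IsCentral m p := by
  refine ⟨(card_outer_of_coplanar hij h).trans hm.symm, fun l hl => ?_⟩
  rw [mem_outer] at hl
  by_cases h1 : l = i
  · subst h1; exact hi.resolve_left hl
  · by_cases h2 : l = j
    · subst h2; exact hj.resolve_left hl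
    · rw [h l h1 h2] at hl ⊢; exact (hv l h1 h2).resolve_left hl

/-- A rotation of a plane is odd on two of the central classes, or on none. -/
theorem signOn_central (hk : 2 ≤ k) (hodd : Odd k) {i j : Fin n} (hij : i ≠ j) {v : Pos n k}
    (hv : ∀ l, l ≠ i → l ≠ j → kd (v l) = 0 ∨ (v l).rev = v l) (m : ℕ) :
    signOn (IsCentral m) (combPos [planeTurn hij v]) =
      (if m = #(outer v \ {i, j}) + 1 then -1 else 1) *
        if m = #(outer v \ {i, j}) + 2 then -1 else 1 := by
  obtain ⟨c, hc⟩ := exists_middle hodd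
  have hc0 : kd c ≠ 0 := fun h => rev_ne_of_kd_zero hk h hc
  let z : Fin k := ⟨0, by omega⟩
  have hz : kd z = 0 := by rw [kd_def]; simp [z]
  have hzr := rev_ne_of_kd_zero hk hz
  have hcop : ∀ x y, Coplanar i j v (Function.update (Function.update v j y) i x) := by
    intro x y l h1 h2
    rw [Function.update_of_ne h1, Function.update_of_ne h2]
  have hi : ∀ x y, Function.update (Function.update v j y) i x i = x := fun x y =>
    Function.update_self ..
  have hj : ∀ x y, Function.update (Function.update v j y) i x j = y := fun x y => by
    rw [Function.update_of_ne hij.symm, Function.update_self]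
  have hcard : ∀ q, IsCentral m q → Coplanar i j v q → m = #(outer v \ {i, j}) +
      ((if kd (q i) = 0 then 1 else 0) + if kd (q j) = 0 then 1 else 0) := fun q hq hvq =>
    hq.1.symm.trans (card_outer_of_coplanar hij hvq)
  by_cases h1 : m = #(outer v \ {i, j}) + 1
  · rw [if_pos h1, if_neg (by omega), mul_one]
    refine signOn_planeTurn (isClassSet_central m) hij (hcop z c)
      (isCentral_of_coplanar hij (hcop z c) hv (by rw [hi]; exact Or.inl hz)
        (by rw [hj]; exact Or.inr hc) (by rw [hi, hj, if_pos hz, if_neg hc0, h1]))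
      (by rw [hi]; exact hzr) fun q hq hvq => Or.inr ?_
    have h2 := hcard q hq hvq
    refine planeRelated_of_central hij ((hcop z c).trans' hvq) (by rw [hi]; exact hz)
      (by rw [hj]; exact hc) ?_
    have h3 := hq.kd_or i
    have h4 := hq.kd_or j
    split_ifs at h2 with h5 h6 h6
    · omega
    · exact Or.inl ⟨h5, h4.resolve_left h6⟩
    · exact Or.inr ⟨h6, h3.resolve_left h5⟩
    · omega
  · by_cases h2 : m = #(outer v \ {i, j}) + 2
    · rw [if_neg h1, if_pos h2, one_mul]
      refine signOn_planeTurn (isClassSet_central m) hij (hcop z z)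
        (isCentral_of_coplanar hij (hcop z z) hv (by rw [hi]; exact Or.inl hz)
          (by rw [hj]; exact Or.inl hz) (by rw [hi, hj, if_pos hz, h2]))
        (by rw [hi]; exact hzr) fun q hq hvq => Or.inr ?_
      have h3 := hcard q hq hvq
      refine planeRelated_of_outer hij ((hcop z z).trans' hvq) (by rw [hi]; exact hz)
        (by rw [hj]; exact hz) ?_ ?_ <;>
      · by_contra h4
        rw [if_neg h4] at h3
        split_ifs at h3 <;> omega
    · rw [if_neg h1, if_neg h2, mul_one]
      refine signOn_planeTurn_one hij fun q hq hvq => ?_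
      have h3 := hcard q hq hvq
      have h4 : kd (q i) ≠ 0 ∧ kd (q j) ≠ 0 := by
        constructor <;> intro h4 <;> rw [if_pos h4] at h3 <;> split_ifs at h3 <;> omega
      exact rotate_eq_self hij ((hq.kd_or i).resolve_left h4.1) ((hq.kd_or j).resolve_left h4.2)

/-- A plane whose levels are all outer or middle contributes two minus signs: one from the edge
midpoints and one from the corners, which belong to consecutive central classes. Any other plane
contains no central cubie. -/
theorem prod_signOn_central (hk : 2 ≤ k) (hodd : Odd k) (w : Combination n k) :
    ∏ m ∈ Icc 1 n, signOn (IsCentral m) (combPos w) = 1 := by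
  obtain ⟨w', hw', h⟩ := exists_planar w
  have e : combPos w = combPos w' := Equiv.ext fun p => (h p).1.symm
  rw [e]
  clear h e
  induction w' with
  | nil => exact prod_eq_one fun m _ => signOn_eq_one fun _ _ => rfl
  | cons t w' ih =>
    rw [prod_congr rfl fun m _ => (congrArg _ (combPos_cons t w')).trans
      (signOn_mul ((isClassSet_central m).combPos _) ((isClassSet_central m).combPos _)),
      prod_mul_distrib, ih fun t ht => hw' t (List.mem_cons_of_mem _ ht), one_mul]
    obtain ⟨i, j, hij, v, rfl⟩ := hw' t List.mem_cons_self
    by_cases hv : ∀ l, l ≠ i → l ≠ j → kd (v l) = 0 ∨ (v l).rev = v l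
    · have h2 := card_outer_sdiff_add_two_le hij v
      rw [prod_congr rfl fun m _ => signOn_central hk hodd hij hv m, prod_mul_distrib,
        prod_ite_eq', prod_ite_eq', if_pos (mem_Icc.2 (by omega)), if_pos (mem_Icc.2 (by omega))]
      rfl
    · push Not at hv
      obtain ⟨l, h1, h2, h3, h4⟩ := hv
      refine prod_eq_one fun m _ => signOn_planeTurn_one hij fun q hq hvq => ?_
      have := hq.kd_or l
      rw [hvq l h1 h2] at this
      exact absurd this (by simp [h3, h4])

end Signs

/-! ### The frame -/

section Frame

variable {n k : ℕ}

/-- The opposite position. -/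
def opp (p : Pos n k) : Pos n k := fun l => (p l).rev

@[simp] theorem opp_opp (p : Pos n k) : opp (opp p) = p := funext fun l => Fin.rev_rev (p l)

theorem outer_opp (p : Pos n k) : outer (opp p) = outer p := by
  ext l
  rw [mem_outer, mem_outer, opp, ← flip_neg_one, kd_flip]

theorem isCentral_opp {m : ℕ} {p : Pos n k} (h : IsCentral m p) : IsCentral m (opp p) :=
  ⟨by rw [outer_opp, h.1], fun l hl => by
    rw [outer_opp] at hl
    simp only [opp, h.2 l hl]⟩

theorem IsCentral.exists_axis {p : Pos n k} (h : IsCentral 1 p) : ∃ l, outer p = {l} :=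
  card_eq_one.1 h.1

theorem IsCentral.eq_or_eq_opp {p q : Pos n k} (hp : IsCentral 1 p) (hq : IsCentral 1 q)
    (h : outer q = outer p) : q = p ∨ q = opp p := by
  obtain ⟨l, hl⟩ := hp.exists_axis
  have h1 : l ∈ outer p := by simp [hl]
  have h2 : l ∈ outer q := h ▸ h1
  have h3 : ∀ x, x ≠ l → q x = p x ∧ q x = opp p x := by
    intro x hx
    have hx1 : x ∉ outer p := by simpa [hl] using hx
    have hx2 : x ∉ outer q := h ▸ hx1
    have e := eq_of_rev_eq (hq.2 x hx2) (hp.2 x hx1)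
    exact ⟨e, e.trans (hp.2 x hx1).symm⟩
  rcases eq_or_eq_rev_of_kd ((mem_outer.1 h1).trans (mem_outer.1 h2).symm) with h4 | h4
  · left; funext x
    by_cases hx : x = l
    · rw [hx, h4]
    · exact (h3 x hx).1
  · right; funext x
    by_cases hx : x = l
    · rw [hx, h4]; rfl
    · exact (h3 x hx).2

theorem opp_ne (hk : 2 ≤ k) {m : ℕ} (hm : 0 < m) {p : Pos n k} (hp : IsCentral m p) : opp p ≠ p := by
  obtain ⟨l, hl⟩ := card_pos.1 (hp.1.symm ▸ hm)
  exact fun e => rev_ne_of_kd_zero hk (mem_outer.1 hl) (congrFun e l)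

theorem exists_frame (hk : 2 ≤ k) (hodd : Odd k) (l : Fin n) :
    ∃ p : Pos n k, IsCentral 1 p ∧ outer p = {l} := by
  obtain ⟨c, hc⟩ := exists_middle hodd
  have hc0 : kd c ≠ 0 := fun h => rev_ne_of_kd_zero hk h hc
  let p : Pos n k := fun x => if x = l then ⟨0, by omega⟩ else c
  have h : outer p = {l} := by
    ext x
    rw [mem_outer, mem_singleton]
    by_cases hx : x = l
    · simp [p, hx, kd_def]
    · simp [p, hx, hc0]
  refine ⟨p, ⟨by rw [h, card_singleton], fun x hx => ?_⟩, h⟩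
  rw [h, mem_singleton] at hx
  simp [p, hx, hc]

/-- A permutation of the frame that preserves opposite positions and permutes the axes by `τ`. -/
def FrameAct (f : Equiv.Perm (Pos n k)) (τ : Equiv.Perm (Fin n)) : Prop :=
  ∀ q, IsCentral 1 q → outer (f q) = (outer q).map τ.toEmbedding ∧ f (opp q) = opp (f q)

theorem FrameAct.mul {f g : Equiv.Perm (Pos n k)} {σ τ : Equiv.Perm (Fin n)} (hf : FrameAct f σ)
    (hg : FrameAct g τ) (h : ∀ q, IsCentral 1 q → IsCentral 1 (g q)) :
    FrameAct (f * g) (σ * τ) := by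
  intro q hq
  obtain ⟨h1, h2⟩ := hg q hq
  obtain ⟨h3, h4⟩ := hf _ (h q hq)
  refine ⟨?_, ?_⟩
  · rw [Equiv.Perm.mul_apply, h3, h1, map_map]; rfl
  · rw [Equiv.Perm.mul_apply, h2, h4]; rfl

theorem FrameAct.unique (hk : 2 ≤ k) (hodd : Odd k) {f : Equiv.Perm (Pos n k)}
    {σ τ : Equiv.Perm (Fin n)}
    (h : ∀ q, IsCentral 1 q → outer (f q) = (outer q).map σ.toEmbedding)
    (h' : ∀ q, IsCentral 1 q → outer (f q) = (outer q).map τ.toEmbedding) : σ = τ := by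
  ext l : 1
  obtain ⟨p, hp, hl⟩ := exists_frame hk hodd l
  have e := (h p hp).symm.trans (h' p hp)
  rw [hl, map_singleton, map_singleton, singleton_inj] at e
  exact e

/-- A plane through the centre moves four frame cubies in a 4-cycle and transposes two axes, so both
signs are -1. Any other plane fixes the frame. -/
theorem exists_frameAct (hk : 2 ≤ k) (hodd : Odd k) (w : Combination n k) :
    ∃ τ, FrameAct (combPos w) τ ∧ signOn (IsCentral 1) (combPos w) * Equiv.Perm.sign τ = 1 := by
  obtain ⟨w', hw', h⟩ := exists_planar w
  have e : combPos w = combPos w' := Equiv.ext fun p => (h p).1.symm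
  rw [e]
  clear h e
  induction w' with
  | nil =>
    refine ⟨1, fun q _ => ⟨?_, rfl⟩, ?_⟩
    · ext x; simp [combPos_apply, posAfter]; rfl
    · rw [signOn_eq_one fun _ _ => rfl, map_one, one_mul]
  | cons t w' ih =>
    obtain ⟨τ, h1, h2⟩ := ih fun t ht => hw' t (List.mem_cons_of_mem _ ht)
    obtain ⟨i, j, hij, v, rfl⟩ := hw' t List.mem_cons_self
    suffices h : ∃ σ, FrameAct (combPos [planeTurn hij v]) σ ∧
        signOn (IsCentral 1) (combPos [planeTurn hij v]) * Equiv.Perm.sign σ = 1 by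
      obtain ⟨σ, h3, h4⟩ := h
      rw [combPos_cons]
      refine ⟨τ * σ, h1.mul h3 fun q hq => ((isClassSet_central 1).combPos _ _).2 hq, ?_⟩
      rw [signOn_mul ((isClassSet_central 1).combPos _) ((isClassSet_central 1).combPos _), map_mul,
        mul_mul_mul_comm, h2, h4, one_mul]
    by_cases hv : ∀ l, l ≠ i → l ≠ j → (v l).rev = v l
    · refine ⟨Equiv.swap i j, fun q hq => ?_, ?_⟩
      · by_cases hc : Coplanar i j v q
        · have hc' : Coplanar i j v (opp q) := fun l h1 h2 => by
            rw [opp, hc l h1 h2, hv l h1 h2]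
          simp only [combPos_apply, posAfter, planeTurn_pos_of_coplanar hij hc,
            planeTurn_pos_of_coplanar hij hc']
          refine ⟨(reach_rotate hij q).outer_eq, ?_⟩
          funext l
          simp only [rotate, opp]
          split_ifs <;> rfl
        · have hc' : ¬ Coplanar i j v (opp q) := fun h => hc fun l h1 h2 => by
            rw [← Fin.rev_rev (q l), show (q l).rev = opp q l from rfl, h l h1 h2, hv l h1 h2]
          simp only [combPos_apply, posAfter, planeTurn_pos_of_not hij hc,
            planeTurn_pos_of_not hij hc', and_true]
          obtain ⟨l, hl⟩ := hq.exists_axis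
          rw [hl, map_singleton, singleton_inj]
          refine (Equiv.swap_apply_of_ne_of_ne ?_ ?_).symm <;> rintro rfl <;> refine hc ?_ <;>
          · intro x h1 h2
            refine eq_of_rev_eq (hq.2 x ?_) (hv x h1 h2)
            rw [hl, mem_singleton]; assumption
      · have h3 : #(outer v \ {i, j}) = 0 := by
          rw [card_eq_zero, sdiff_eq_empty_iff_subset]
          intro l hl
          by_contra hc
          simp only [mem_insert, mem_singleton, not_or] at hc
          exact rev_ne_of_kd_zero hk (mem_outer.1 hl) (hv l hc.1 hc.2)
        rw [signOn_central hk hodd hij (fun l h1 h2 => Or.inr (hv l h1 h2)), h3,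
          Equiv.Perm.sign_swap hij]
        rfl
    · push Not at hv
      obtain ⟨l, h3, h4, h5⟩ := hv
      -- The level at `l` is not the middle one, so a frame cubie of this plane has `l` as its outer
      -- axis and the middle factor at both `i` and `j`.
      have key : ∀ q, IsCentral 1 q → combPos [planeTurn hij v] q = q := by
        intro q hq
        by_cases hc : Coplanar i j v q
        · refine (planeTurn_pos_of_coplanar hij hc).trans ?_
          have hl : l ∈ outer q := by
            by_contra hl
            exact h5 (hc l h3 h4 ▸ hq.2 l hl)
          obtain ⟨x, hx⟩ := hq.exists_axis
          rw [hx, mem_singleton] at hl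
          subst hl
          refine rotate_eq_self hij (hq.2 i ?_) (hq.2 j ?_) <;> rw [hx, mem_singleton]
          exacts [h3.symm, h4.symm]
        · exact planeTurn_pos_of_not hij hc
      refine ⟨1, fun q hq => ?_, ?_⟩
      · rw [key q hq, key _ (isCentral_opp hq)]
        exact ⟨by ext x; simp; rfl, rfl⟩
      · rw [signOn_eq_one key, map_one, one_mul]

end Frame

end Rubik

namespace Rubik

open Finset

/-! ### Invariance of the central invariants -/

section CentralInvariants

variable {n k : ℕ}

theorem Assembly.symm_linked (a : Assembly n k) (q : Pos n k) : Linked q (a.place.symm q) := by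
  have h := a.linked_place (a.place.symm q)
  rw [Equiv.apply_symm_apply] at h
  exact h.symm

/-- The permutation of the positions by which `a` differs from `r`. -/
def relPerm (r a : Assembly n k) : Equiv.Perm (Pos n k) := r.place.symm.trans a.place

theorem relPerm_apply_place (r a : Assembly n k) (p : Pos n k) :
    relPerm r a (r.place p) = a.place p := by simp [relPerm]

theorem linked_relPerm (r a : Assembly n k) (p : Pos n k) : Linked p (relPerm r a p) :=
  (r.symm_linked p).trans (a.linked_place _)

theorem IsClassSet.relPerm {S : Pos n k → Prop} (hS : IsClassSet S) (r a : Assembly n k)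
    (p : Pos n k) : S (relPerm r a p) ↔ S p := (hS _ _ (linked_relPerm r a p)).symm

theorem relPerm_mul (r a b : Assembly n k) : relPerm a b * relPerm r a = relPerm r b := by
  ext1 p; simp [relPerm]

theorem relPerm_act (r a : Assembly n k) (w : Combination n k) :
    relPerm r (a.act w) = combPos w * relPerm r a := rfl

open Classical in
theorem sign_centralPerm (m : ℕ) (r a : Assembly n k) :
    Equiv.Perm.sign (centralPerm m r a) = signOn (IsCentral m) (relPerm r a) := by
  rw [signOn_eq ((isClassSet_central m).relPerm r a)]
  change @Equiv.Perm.sign _ _ _ ((relPerm r a).subtypePerm _) = _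
  congr!

theorem Reference.C_eq (R : Reference n k) (hodd : Odd k) (a : Assembly n k) :
    R.C a = ∏ m ∈ Icc 1 n, signOn (IsCentral m) (relPerm R.central a) := by
  unfold Reference.C
  rw [if_pos hodd]
  exact prod_congr rfl fun m _ => sign_centralPerm m _ _

theorem Reference.B₂_eq (R : Reference n k) (hodd : Odd k) (a : Assembly n k) :
    R.B₂ a = signOn (IsCentral 1) (relPerm (R.frame (B₁ a)) a) *
      Equiv.Perm.sign (pairPerm (R.frame (B₁ a)) a) := by
  unfold Reference.B₂
  rw [if_pos hodd]
  exact congrArg (· * _) (sign_centralPerm 1 _ _)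

theorem Reference.C_of_not_odd (R : Reference n k) (h : ¬ Odd k) (a : Assembly n k) : R.C a = 1 :=
  if_neg h

theorem Reference.B₂_of_not_odd (R : Reference n k) (h : ¬ Odd k) (a : Assembly n k) :
    R.B₂ a = 1 := if_neg h

/-- Two assemblies with the same places of the central cubies. -/
def SameCentral (a b : Assembly n k) : Prop :=
  ∀ m, 1 ≤ m → ∀ p, IsCentral m p → a.place p = b.place p

theorem symm_eq_of_place_eq {S : Pos n k → Prop} (hS : IsClassSet S) {a b : Assembly n k}
    (h : ∀ p, S p → a.place p = b.place p) {q : Pos n k} (hq : S q) :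
    a.place.symm q = b.place.symm q := by
  have h1 := h _ ((hS _ _ (a.symm_linked q)).1 hq)
  rw [Equiv.apply_symm_apply] at h1
  rw [Equiv.eq_symm_apply, ← h1]

theorem B₁_congr {a b : Assembly n k} (h : ∀ p, IsCentral 1 p → a.place p = b.place p) :
    B₁ a = B₁ b := by
  have h1 : ∀ q, IsCentral 1 q → a.place.symm q = b.place.symm q := fun q hq =>
    symm_eq_of_place_eq (isClassSet_central 1) h hq
  ext s
  refine exists_congr fun q => and_congr_right fun hq => ?_
  have h2 := h1 _ (isCentral_opp hq)
  unfold opp at h2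
  rw [h1 q hq, h2]

theorem pairPerm_congr {r a b : Assembly n k} (h : ∀ p, IsCentral 1 p → a.place p = b.place p) :
    pairPerm r a = pairPerm r b := by
  unfold pairPerm
  congr 1
  funext τ
  refine propext (forall_congr' fun p => forall_congr' fun hp => ?_)
  rw [h p hp]

theorem signOn_relPerm_congr {S : Pos n k → Prop} (hS : IsClassSet S) {r a b : Assembly n k}
    (h : ∀ p, S p → a.place p = b.place p) :
    signOn S (relPerm r a) = signOn S (relPerm r b) :=
  signOn_congr (fun p hp => h _ ((hS _ _ (r.symm_linked p)).1 hp)) (hS.relPerm r a) (hS.relPerm r b)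

theorem Reference.B₂_congr (R : Reference n k) {a b : Assembly n k}
    (h : ∀ p, IsCentral 1 p → a.place p = b.place p) : R.B₂ a = R.B₂ b := by
  by_cases hodd : Odd k
  · rw [R.B₂_eq hodd, R.B₂_eq hodd, B₁_congr h, pairPerm_congr h,
      signOn_relPerm_congr (isClassSet_central 1) h]
  · rw [R.B₂_of_not_odd hodd, R.B₂_of_not_odd hodd]

theorem Reference.C_congr (R : Reference n k) {a b : Assembly n k} (h : SameCentral a b) :
    R.C a = R.C b := by
  by_cases hodd : Odd k
  · rw [R.C_eq hodd, R.C_eq hodd]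
    exact prod_congr rfl fun m hm =>
      signOn_relPerm_congr (isClassSet_central m) (h m (mem_Icc.1 hm).1)
  · rw [R.C_of_not_odd hodd, R.C_of_not_odd hodd]

/-- The inner factors of a central cubie are all the middle one, so within its class its colours
determine it and `ρ` fixes it. -/
theorem SameUpTo.sameCentral {ρ : Equiv.Perm (Pos n k)} {a b : Assembly n k}
    (h : SameUpTo ρ a b) : SameCentral a b := by
  intro m _ p hp
  have h1 : ρ p = p := by
    have h2 := hp.of_linked (h.linked p)
    have h3 := (h p).1
    funext l
    by_cases hl : l ∈ outer p
    · exact h3.2 l hl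
    · exact eq_of_rev_eq (h2.2 l (by rwa [h3.1])) (hp.2 l hl)
  rw [← (h p).2.1, h1]

theorem Reference.C_act (hk : 2 ≤ k) (R : Reference n k) (a : Assembly n k) (w : Combination n k) :
    R.C (a.act w) = R.C a := by
  by_cases hodd : Odd k
  · rw [R.C_eq hodd, R.C_eq hodd, relPerm_act]
    rw [prod_congr rfl fun m _ => signOn_mul ((isClassSet_central m).combPos w)
      ((isClassSet_central m).relPerm _ _), prod_mul_distrib, prod_signOn_central hk hodd, one_mul]
  · rw [R.C_of_not_odd hodd, R.C_of_not_odd hodd]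

theorem B₁_eq (a : Assembly n k) : B₁ a =
    {s | ∃ q, IsCentral 1 q ∧ s = {a.place.symm q, a.place.symm (opp q)}} := rfl

theorem not_isCentral_of_not_odd {m : ℕ} (hm : m < n) (h : ¬ Odd k) (p : Pos n k) :
    ¬ IsCentral m p := by
  intro hp
  obtain ⟨l, hl⟩ : ∃ l, l ∉ outer p := by
    by_contra! hc
    have := hp.1
    rw [eq_univ_iff_forall.2 hc, card_univ, Fintype.card_fin] at this
    omega
  exact h (odd_of_rev_eq (hp.2 l hl))

/-- On the frame a combination commutes with passing to the opposite position. For even `k` there is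
no frame and both sides are empty. -/
theorem B₁_act (hn : 3 ≤ n) (hk : 2 ≤ k) (a : Assembly n k) (w : Combination n k) :
    B₁ (a.act w) = B₁ a := by
  by_cases hodd : Odd k
  · obtain ⟨τ, h, -⟩ := exists_frameAct (n := n) hk hodd w
    have e : ∀ q, (a.act w).place.symm (combPos w q) = a.place.symm q := fun q =>
      congrArg a.place.symm ((combPos w).symm_apply_apply q)
    rw [B₁_eq, B₁_eq]
    ext s
    constructor
    · rintro ⟨q, hq, rfl⟩
      obtain ⟨q, rfl⟩ := (combPos w).surjective q
      have hq' := ((isClassSet_central 1).combPos w q).1 hq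
      exact ⟨q, hq', by rw [← (h q hq').2, e, e]⟩
    · rintro ⟨q, hq, rfl⟩
      exact ⟨combPos w q, ((isClassSet_central 1).combPos w q).2 hq, by rw [← (h q hq).2, e, e]⟩
  · rw [B₁_eq, B₁_eq]
    ext s
    constructor <;> rintro ⟨q, hq, -⟩ <;>
      exact absurd hq (not_isCentral_of_not_odd (by omega) hodd q)

/-- With the same pairs, the relative permutation takes opposite frame positions to opposite ones,
so it induces a permutation of the axes. -/
theorem exists_frameAct_of_B₁_eq (hk : 2 ≤ k) (hodd : Odd k) {a b : Assembly n k}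
    (h : B₁ a = B₁ b) : ∃ τ, FrameAct (relPerm a b) τ := by
  have h1 : ∀ q, IsCentral 1 q → relPerm a b (opp q) = opp (relPerm a b q) := by
    intro q hq
    have h2 : ({a.place.symm q, a.place.symm (opp q)} : Set (Pos n k)) ∈ B₁ b :=
      h ▸ ⟨q, hq, rfl⟩
    obtain ⟨r, hr, e⟩ := h2
    have e' : ({relPerm a b q, relPerm a b (opp q)} : Set (Pos n k)) = {r, opp r} := by
      have := congrArg (Set.image b.place) e
      rw [Set.image_pair, Set.image_pair, Equiv.apply_symm_apply, Equiv.apply_symm_apply] at this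
      exact this
    rcases Set.pair_eq_pair_iff.1 e' with ⟨h3, h4⟩ | ⟨h3, h4⟩
    · rw [h3, h4]
    · rw [h3, h4, opp_opp]
  have h2 : ∀ l : Fin n, ∃ m, ∀ q, IsCentral 1 q → outer q = {l} → outer (relPerm a b q) = {m} := by
    intro l
    obtain ⟨p, hp, hl⟩ := exists_frame hk hodd l
    obtain ⟨m, hm⟩ := (((isClassSet_central 1).relPerm a b p).2 hp).exists_axis
    refine ⟨m, fun q hq hql => ?_⟩
    rcases hp.eq_or_eq_opp hq (hql.trans hl.symm) with rfl | rfl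
    · exact hm
    · rw [h1 p hp, outer_opp, hm]
  choose t ht using h2
  have hinj : Function.Injective t := by
    intro l l' e
    obtain ⟨p, hp, hl⟩ := exists_frame hk hodd l
    obtain ⟨p', hp', hl'⟩ := exists_frame hk hodd l'
    have h3 := ht l p hp hl
    have h4 := ht l' p' hp' hl'
    have hp1 := ((isClassSet_central 1).relPerm a b p).2 hp
    have hp1' := ((isClassSet_central 1).relPerm a b p').2 hp'
    rw [← singleton_inj, ← hl, ← hl']
    rcases hp1.eq_or_eq_opp hp1' (by rw [h4, h3, e]) with h5 | h5
    · rw [(relPerm a b).injective h5]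
    · rw [← h1 p hp] at h5
      rw [(relPerm a b).injective h5, outer_opp]
  refine ⟨Equiv.ofBijective t (Finite.injective_iff_bijective.1 hinj), fun q hq => ⟨?_, h1 q hq⟩⟩
  obtain ⟨l, hl⟩ := hq.exists_axis
  rw [ht l q hq hl, hl, map_singleton]
  rfl

/-- Every axis carries a frame cubie, so the permutation chosen by `epsilon` is the only one with
its property. -/
theorem pairPerm_eq (hk : 2 ≤ k) (hodd : Odd k) {r a : Assembly n k} {τ : Equiv.Perm (Fin n)}
    (h : FrameAct (relPerm r a) τ) : pairPerm r a = τ := by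
  have h1 : ∀ σ : Equiv.Perm (Fin n), (∀ p : Pos n k, IsCentral 1 p →
      outer (a.place p) = (outer (r.place p)).map σ.toEmbedding) →
      ∀ q, IsCentral 1 q → outer (relPerm r a q) = (outer q).map σ.toEmbedding := by
    intro σ hσ q hq
    have := hσ (r.place.symm q) (hq.of_linked (r.symm_linked q))
    rw [Equiv.apply_symm_apply] at this
    exact this
  have h2 := Classical.epsilon_spec (p := fun τ : Equiv.Perm (Fin n) => ∀ p : Pos n k,
    IsCentral 1 p → outer (a.place p) = (outer (r.place p)).map τ.toEmbedding) ⟨τ, fun p hp => by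
      rw [← (h _ (hp.of_linked (r.linked_place p))).1, relPerm_apply_place]⟩
  exact FrameAct.unique hk hodd (h1 _ h2) fun q hq => (h q hq).1

/-- The second frame invariant compares two assemblies with the same pairs. -/
theorem Reference.B₂_eq_iff (hk : 2 ≤ k) (hodd : Odd k) (R : Reference n k) {a b : Assembly n k}
    (h : B₁ a = B₁ b) {τ : Equiv.Perm (Fin n)} (hτ : FrameAct (relPerm a b) τ) :
    R.B₂ a = R.B₂ b ↔ signOn (IsCentral 1) (relPerm a b) * Equiv.Perm.sign τ = 1 := by
  set r := R.frame (B₁ a) with hr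
  obtain ⟨σ, hσ⟩ := exists_frameAct_of_B₁_eq hk hodd (a := r) (b := a)
    (R.B₁_frame a)
  have hσ' : FrameAct (relPerm r b) (τ * σ) := by
    rw [← relPerm_mul r a b]
    exact hτ.mul hσ fun q hq => ((isClassSet_central 1).relPerm _ _ _).2 hq
  rw [R.B₂_eq hodd, R.B₂_eq hodd, ← h, ← hr, pairPerm_eq hk hodd hσ, pairPerm_eq hk hodd hσ',
    ← relPerm_mul r a b, signOn_mul ((isClassSet_central 1).relPerm _ _)
      ((isClassSet_central 1).relPerm _ _), map_mul, mul_mul_mul_comm, eq_comm, mul_eq_right]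

theorem Reference.B₂_act (hn : 3 ≤ n) (hk : 2 ≤ k) (R : Reference n k) (a : Assembly n k)
    (w : Combination n k) : R.B₂ (a.act w) = R.B₂ a := by
  by_cases hodd : Odd k
  · obtain ⟨τ, h, h'⟩ := exists_frameAct (n := n) hk hodd w
    have e : relPerm a (a.act w) = combPos w := by
      rw [relPerm_act]; ext1 p; simp [relPerm]
    exact ((R.B₂_eq_iff hk hodd (B₁_act hn hk a w).symm (e ▸ h)).2 (e ▸ h')).symm
  · rw [R.B₂_of_not_odd hodd, R.B₂_of_not_odd hodd]

theorem Reference.sameInvariants_act (hn : 3 ≤ n) (hk : 2 ≤ k) (R : Reference n k)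
    (a : Assembly n k) (w : Combination n k) : R.SameInvariants (a.act w) a :=
  ⟨B₁_act hn hk a w, R.B₂_act hn hk a w, R.C_act hk a w, fun K _ => R.O_act_eq hk a w K,
    fun s _ => R.Cl_act a w s⟩

theorem SameUpTo.sameInvariants (hn : 3 ≤ n) (R : Reference n k) {ρ : Equiv.Perm (Pos n k)}
    {a b : Assembly n k} (h : SameUpTo ρ a b) : R.SameInvariants a b := by
  have h1 := h.sameCentral
  refine ⟨B₁_congr (h1 1 le_rfl), R.B₂_congr (h1 1 le_rfl), R.C_congr h1,
    fun K _ => R.O_sameUpTo h K, ?_⟩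
  rintro s ⟨p, rfl, -⟩
  exact R.Cl_sameUpTo hn h p

theorem Reference.SameInvariants.symm {R : Reference n k} {a b : Assembly n k}
    (h : R.SameInvariants a b) : R.SameInvariants b a :=
  ⟨h.1.symm, h.2.1.symm, h.2.2.1.symm, fun K hK => (h.2.2.2.1 K hK).symm,
    fun s hs => (h.2.2.2.2 s hs).symm⟩

theorem Reference.SameInvariants.trans {R : Reference n k} {a b c : Assembly n k}
    (h : R.SameInvariants a b) (h' : R.SameInvariants b c) : R.SameInvariants a c :=
  ⟨h.1.trans h'.1, h.2.1.trans h'.2.1, h.2.2.1.trans h'.2.2.1,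
    fun K hK => (h.2.2.2.1 K hK).trans (h'.2.2.2.1 K hK),
    fun s hs => (h.2.2.2.2 s hs).trans (h'.2.2.2.2 s hs)⟩

theorem Reference.sameInvariants_of_connected (hn : 3 ≤ n) (hk : 2 ≤ k) (R : Reference n k)
    {a b : Assembly n k} (h : Connected a.paint b.paint) : R.SameInvariants a b := by
  obtain ⟨w, hw⟩ := connected_iff.1 h
  obtain ⟨ρ, hρ⟩ := sameUpTo_of_paint_eq hn hw
  exact (R.sameInvariants_act hn hk a w).symm.trans (hρ.sameInvariants hn R)

end CentralInvariants

end Rubik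

namespace Rubik

open Finset

/-! ### Matching the frame -/

section Completeness

variable {n k : ℕ}

/-- By `B₁` the frames differ by a signed permutation of the axes. A rotation of the whole cube
realizes it up to the sign on one axis `l₀`. A wrong sign there would be an exchange of two frame
cubies, which is odd and contradicts `B₂`. -/
theorem exists_act_frame (hk : 2 ≤ k) (R : Reference n k) (hn : 3 ≤ n) {a b : Assembly n k}
    (h : R.SameInvariants a b) :
    ∃ w, ∀ p, IsCentral 1 p → (a.act w).place p = b.place p := by
  by_cases hodd : Odd k
  swap
  · exact ⟨[], fun p hp => absurd hp (not_isCentral_of_not_odd (by omega) hodd p)⟩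
  obtain ⟨τ, hτ⟩ := exists_frameAct_of_B₁_eq hk hodd h.1
  have hsign := (R.B₂_eq_iff hk hodd h.1 hτ).1 h.2.1
  choose P hP hPl using fun l => exists_frame hk hodd (n := n) l
  have h1 : ∀ l, ∃ e : ℤˣ, relPerm a b (P l) (τ l) = flip e (P l l) := by
    intro l
    have h1 : τ l ∈ outer (relPerm a b (P l)) := by rw [(hτ _ (hP l)).1, hPl]; simp
    have h2 : l ∈ outer (P l) := by rw [hPl]; simp
    obtain ⟨e, he⟩ := kd_eq_iff.1 ((mem_outer.1 h2).trans (mem_outer.1 h1).symm)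
    exact ⟨e, he⟩
  choose ε hε using h1
  let l₀ : Fin n := ⟨0, by omega⟩
  -- The sign at `l₀` is given up to obtain determinant 1.
  let δ : Fin n → ℤˣ := fun l =>
    ε l * if l = l₀ then Equiv.Perm.sign τ * ∏ l, ε l else 1
  have hδ : Equiv.Perm.sign τ * ∏ l, δ l = 1 := by
    rw [prod_mul_distrib, prod_ite_eq' univ l₀, if_pos (mem_univ l₀), ← mul_assoc,
      Int.units_mul_self]
  obtain ⟨w, hw⟩ := realizable (n := n) (k := k) (by omega) τ δ hδ
  refine ⟨w, ?_⟩
  -- the combination agrees with `relPerm a b` up to the exchange of one pair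
  have hfr : FrameAct (combPos w) τ := by
    intro q hq
    refine ⟨by rw [← (hw q).1]; exact (reach_after w q).outer_eq, ?_⟩
    funext x
    obtain ⟨l, rfl⟩ := τ.surjective x
    change posAfter w (opp q) (τ l) = (posAfter w q (τ l)).rev
    rw [(hw _).2, (hw _).2, opp, ← flip_neg_one, ← flip_neg_one, ← flip_mul, ← flip_mul, mul_comm]
  obtain ⟨τ', hτ', hsign'⟩ := exists_frameAct (n := n) hk hodd w
  rw [FrameAct.unique hk hodd (fun q hq => (hτ' q hq).1) fun q hq => (hfr q hq).1] at hsign'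
  set f := (combPos w)⁻¹ * relPerm a b with hf
  have hcentral := isClassSet_central (n := n) (k := k) 1
  have hinv : ∀ q, IsCentral 1 ((combPos w)⁻¹ q) ↔ IsCentral 1 q := fun q => by
    rw [← hcentral.combPos w]; simp
  have hfsign : signOn (IsCentral 1) f = 1 := by
    rw [signOn_mul hinv (hcentral.relPerm a b), signOn_inv (hcentral.combPos w),
      mul_right_cancel (hsign'.trans hsign.symm), Int.units_mul_self]
  have hval : ∀ q, IsCentral 1 q → ∀ l, outer q = {l} → relPerm a b q (τ l) = flip (ε l) (q l) := by
    intro q hq l hl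
    rcases (hP l).eq_or_eq_opp hq (hl.trans (hPl l).symm) with rfl | rfl
    · exact hε l
    · rw [(hτ _ (hP l)).2, opp, opp, hε, ← flip_neg_one, ← flip_neg_one, ← flip_mul, ← flip_mul,
        mul_comm]
  have heq : ∀ q, IsCentral 1 q → ∀ l, outer q = {l} → δ l = ε l → relPerm a b q = combPos w q := by
    intro q hq l hl hδl
    have ho : outer (relPerm a b q) = outer (combPos w q) := by rw [(hτ q hq).1, (hfr q hq).1]
    have h2 : relPerm a b q (τ l) = combPos w q (τ l) := by
      rw [hval q hq l hl, combPos_apply, (hw q).2, hδl]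
    have h3 : τ l ∈ outer (combPos w q) := by rw [(hfr q hq).1, hl]; simp
    rcases ((hcentral.combPos w q).2 hq).eq_or_eq_opp ((hcentral.relPerm a b q).2 hq) ho with h | h
    · exact h
    · rw [h] at h2
      exact absurd h2 (rev_ne_of_kd_zero hk (mem_outer.1 h3))
  have hne : ∀ q, IsCentral 1 q → relPerm a b q = combPos w q ∨ f q = opp q := by
    intro q hq
    rcases ((hcentral.combPos w q).2 hq).eq_or_eq_opp ((hcentral.relPerm a b q).2 hq)
      (by rw [(hτ q hq).1, (hfr q hq).1]) with h | h
    · exact Or.inl h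
    · right
      rw [hf, Equiv.Perm.mul_apply, h, ← (hfr q hq).2]
      exact (combPos w).symm_apply_apply _
  have hall : ∀ q, IsCentral 1 q → relPerm a b q = combPos w q := by
    by_contra! hc
    obtain ⟨q, hq, hqne⟩ := hc
    have hfq := (hne q hq).resolve_left hqne
    have hl : outer q = {l₀} := by
      obtain ⟨l, hl⟩ := hq.exists_axis
      by_contra hc
      refine hqne (heq q hq l hl ?_)
      have : l ≠ l₀ := fun e => hc (e ▸ hl)
      simp [δ, this]
    have hfo : f (opp q) = q := by
      rcases hne _ (isCentral_opp hq) with h | h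
      · rw [(hτ q hq).2, (hfr q hq).2] at h
        exact absurd (by rw [← opp_opp (relPerm a b q), h, opp_opp]) hqne
      · rw [h, opp_opp]
    have := signOn_swap (S := IsCentral 1) (f := f) (opp_ne hk one_pos hq).symm hq
      (isCentral_opp hq) fun z hz => by
        by_cases h1 : z = q
        · rw [h1, hfq, Equiv.swap_apply_left]
        · by_cases h2 : z = opp q
          · rw [h2, hfo, Equiv.swap_apply_right]
          · rw [Equiv.swap_apply_of_ne_of_ne h1 h2]
            obtain ⟨l, hzl⟩ := hz.exists_axis
            have hll : l ≠ l₀ := by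
              rintro rfl
              rcases hq.eq_or_eq_opp hz (hzl.trans hl.symm) with h | h
              exacts [h1 h, h2 h]
            rw [hf, Equiv.Perm.mul_apply, heq z hz l hzl (by simp [δ, hll])]
            exact (combPos w).symm_apply_apply _
    rw [hfsign] at this
    exact absurd this (by decide)
  intro p hp
  rw [← relPerm_apply_place a b p, hall _ (hp.of_linked (a.linked_place p))]
  rfl

/-! ### Parity of orientations -/

/-- The orientation permutation of a cubie lies in the dependent rotation group. -/
def Reference.IsDep (R : Reference n k) (a : Assembly n k) (p : Pos n k) : Prop :=
  R.orientation a (cls p) p rfl ∈ depGroup (R.base (cls p))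

theorem Reference.isDep_iff (R : Reference n k) {K : Cls n k} (a : Assembly n k) {p : Pos n k}
    (hp : cls p = K) : R.orientation a K p hp ∈ depGroup (R.base K) ↔ R.IsDep a p := by
  subst hp; rfl

theorem Reference.isDep_act (R : Reference n k) (a : Assembly n k) (w : Combination n k)
    (p : Pos n k) : R.IsDep (a.act w) p ↔ R.IsDep a p := by
  unfold Reference.IsDep
  rw [R.orientation_act]
  exact Subgroup.mul_mem_cancel_right _ (Subgroup.inv_mem _ (Subtype.prop _))

theorem Reference.isDep_sameUpTo (R : Reference n k) {ρ : Equiv.Perm (Pos n k)}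
    {a b : Assembly n k} (hρ : SameUpTo ρ a b) (p : Pos n k) :
    R.IsDep b (ρ p) ↔ R.IsDep a p := by
  have h : cls (ρ p) = cls p := cls_eq_iff.2 (hρ.linked p).symm
  rw [← R.isDep_iff a rfl, ← R.isDep_iff b h, R.orientation_sameUpTo hρ p rfl h]

open Classical in
theorem Reference.Cl_eq_card (R : Reference n k) (a : Assembly n k) (s : Finset (Pos n k)) :
    R.Cl s a = #(s.filter (R.IsDep a)) := by
  unfold Reference.Cl
  rw [card_filter]
  exact sum_congr rfl fun p _ => R.simpleOrientation_eq a p rfl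

theorem Reference.linked_base (R : Reference n k) (p : Pos n k) : Linked p (R.base (cls p)) :=
  cls_eq_iff.1 (R.cls_base (cls p)).symm

theorem Linked.card_outer {p q : Pos n k} (h : Linked p q) : #(outer q) = #(outer p) := by
  obtain ⟨σ, h⟩ := linked_iff.1 h
  exact h.card_outer

theorem Reference.isDep_of_not_chiral (R : Reference n k) (a : Assembly n k) {p : Pos n k}
    (h : ¬ Chiral p) : R.IsDep a p := by
  unfold Reference.IsDep
  rw [depGroup_of_not_chiral fun hc => h (hc.of_linked (R.linked_base p).symm)]
  exact Subgroup.mem_top _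

theorem Reference.isDep_of_card_outer_le_one (R : Reference n k) (a : Assembly n k) {p : Pos n k}
    (h : #(outer p) ≤ 1) : R.IsDep a p := by
  have : Subsingleton (outer (R.base (cls p))) := by
    rw [← Fintype.card_le_one_iff_subsingleton, Fintype.card_coe, (R.linked_base p).card_outer]
    exact h
  unfold Reference.IsDep
  rw [Subsingleton.elim (R.orientation a (cls p) p rfl) 1]
  exact one_mem _

/-- Without inner axes the condition `rigid` covers all coordinates, so such a cubie stands as if it
had been moved there by rotations. -/
theorem Assembly.carries_face_of_card_outer (a : Assembly n k) {p : Pos n k} (h : #(outer p) = n) :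
    Carries (a.face p) := by
  obtain ⟨σ, ε, h1, h2⟩ := a.rigid' p
  have h3 : outer p = univ := (card_eq_iff_eq_univ _).1 (by rw [h, Fintype.card_fin])
  exact ⟨σ, ⟨ε, h1, fun l => (h2 ⟨l, h3 ▸ mem_univ l⟩).2⟩, fun l => (h2 l).1⟩

/-- A cubie with only outer axes is carried in both assemblies, so its two orientation permutations
differ by elements of the dependent group. -/
theorem Reference.isDep_of_card_outer (R : Reference n k) (a b : Assembly n k) {p : Pos n k}
    (h : #(outer p) = n) (ha : R.IsDep a p) : R.IsDep b p := by
  unfold Reference.IsDep at ha ⊢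
  rw [mem_depGroup] at ha ⊢
  have e : R.orientation b (cls p) p rfl =
      ((R.right (cls p) (b.place p) (cls_place b rfl)).trans (b.face p).symm).trans
        (((a.face p).trans (R.right (cls p) (a.place p) (cls_place a rfl)).symm).trans
          (R.orientation a (cls p) p rfl)) := by
    ext l : 1
    simp [Reference.orientation]
  rw [e]
  exact ((R.carries_right _ _ _).trans (b.carries_face_of_card_outer h).symm).trans
    (((a.carries_face_of_card_outer h).trans (R.carries_right _ _ _).symm).trans ha)

theorem mem_cluster_self (hn : 3 ≤ n) (p : Pos n k) : p ∈ cluster p :=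
  (mem_cluster hn).2 ⟨Linked.refl p, SameColour.refl p⟩

theorem cluster_eq_of_mem (hn : 3 ≤ n) {p q : Pos n k} (h : q ∈ cluster p) :
    cluster q = cluster p := by
  rw [mem_cluster hn] at h
  ext x
  rw [mem_cluster hn, mem_cluster hn]
  exact ⟨fun hx => ⟨h.1.trans hx.1, h.2.trans hx.2⟩,
    fun hx => ⟨h.1.symm.trans hx.1, h.2.symm.trans hx.2⟩⟩

/-- Reversing an inner coordinate. -/
theorem update_rev_mem_cluster (hn : 3 ≤ n) {p : Pos n k} (hp : 2 ≤ #(outer p)) {l : Fin n}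
    (hl : l ∉ outer p) : Function.update p l (p l).rev ∈ cluster p := by
  have hkd : ∀ x, kd (Function.update p l (p l).rev x) = kd (p x) := by
    intro x
    by_cases hx : x = l
    · subst hx; rw [Function.update_self, ← flip_neg_one, kd_flip]
    · rw [Function.update_of_ne hx]
  refine (mem_cluster hn).2 ⟨linked_of_two_le_card_outer (σ := 1) hkd hp, ?_, fun x hx => ?_⟩
  · ext x; rw [mem_outer, mem_outer, hkd]
  · rw [Function.update_of_ne]
    rintro rfl; exact hl hx

open Classical in
-- For nontrivial alternating clusters this is the invariant `Cl`. In all others membership does not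
-- depend on the assembly: the group is full, there is at most one outer axis, or all axes are
-- outer. A chiral cubie outside these cases shares its cluster with the cubie got by reversing an
-- inner factor.
theorem Reference.card_isDep (hn : 3 ≤ n) (hk : 2 ≤ k) (R : Reference n k) {a b : Assembly n k}
    (h : ∀ s, IsAltCluster s → R.Cl s a = R.Cl s b) (p : Pos n k) :
    #((cluster p).filter (R.IsDep a)) = #((cluster p).filter (R.IsDep b)) := by
  by_cases hs : IsAltCluster (cluster p)
  · rw [← R.Cl_eq_card, ← R.Cl_eq_card, h _ hs]
  congr 1
  refine filter_congr fun q hq => ?_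
  have hpq := ((mem_cluster hn).1 hq).1
  by_cases hc : Chiral p
  swap
  · have hc' : ¬ Chiral q := fun h => hc (h.of_linked hpq.symm)
    exact iff_of_true (R.isDep_of_not_chiral a hc') (R.isDep_of_not_chiral b hc')
  by_cases hm : #(outer p) ≤ 1
  · rw [← hpq.card_outer] at hm
    exact iff_of_true (R.isDep_of_card_outer_le_one a hm) (R.isDep_of_card_outer_le_one b hm)
  push Not at hm
  have hmn : #(outer p) = n := by
    by_contra hne
    obtain ⟨l, hl⟩ : ∃ l, l ∉ outer p := by
      by_contra! hc
      exact hne (by rw [eq_univ_iff_forall.2 hc, card_univ, Fintype.card_fin])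
    refine hs ⟨p, rfl, ?_, hm, depGroup_of_chiral hk hc⟩
    refine one_lt_card.2 ⟨p, mem_cluster_self hn p, _, update_rev_mem_cluster hn hm hl, fun e => ?_⟩
    exact (hc l hl).1 (by simpa using (congrFun e l).symm)
  rw [← hpq.card_outer] at hmn
  exact ⟨R.isDep_of_card_outer a b hmn, R.isDep_of_card_outer b a hmn⟩

/-- Cubies are sorted by cluster and parity. Both assemblies have equally many of each sort, so a
bijection that respects the sorting exists. -/
theorem Reference.exists_relabel (hn : 3 ≤ n) (hk : 2 ≤ k) (R : Reference n k) {a b : Assembly n k}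
    (h : ∀ s, IsAltCluster s → R.Cl s a = R.Cl s b) :
    ∃ (ρ : Equiv.Perm (Pos n k)), (∀ p, Linked p (ρ p)) ∧ (∀ p, SameColour p (ρ p)) ∧
      ∀ p, R.IsDep b (ρ p) ↔ R.IsDep a p := by
  classical
  let f : Assembly n k → Pos n k → Finset (Pos n k) × Prop := fun a p => (cluster p, R.IsDep a p)
  have key : ∀ c : Finset (Pos n k) × Prop,
      Nonempty ({p : Pos n k // f a p = c} ≃ {p : Pos n k // f b p = c}) := by
    rintro ⟨s, P⟩
    refine ⟨Fintype.equivOfCardEq ?_⟩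
    rw [Fintype.card_subtype, Fintype.card_subtype]
    by_cases hs : ∃ p, cluster p = s
    · obtain ⟨p, rfl⟩ := hs
      have h1 : ∀ a, univ.filter (fun q => f a q = (cluster p, P)) =
          (cluster p).filter fun q => R.IsDep a q = P := by
        intro a
        ext q
        simp only [f, mem_filter, mem_univ, true_and, Prod.mk.injEq]
        refine and_congr_left fun _ => ⟨fun e => e ▸ mem_cluster_self hn q, cluster_eq_of_mem hn⟩
      rw [h1, h1]
      by_cases hP : P
      · simp only [hP, eq_iff_iff, iff_true]
        convert R.card_isDep hn hk h p
      · simp only [hP, eq_iff_iff, iff_false]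
        have h2 := card_filter_add_card_filter_not (s := cluster p) (R.IsDep a)
        have h3 := card_filter_add_card_filter_not (s := cluster p) (R.IsDep b)
        have h4 := R.card_isDep hn hk h p
        convert (show #((cluster p).filter fun q => ¬ R.IsDep a q) =
          #((cluster p).filter fun q => ¬ R.IsDep b q) by omega)
    · rw [filter_false_of_mem, filter_false_of_mem] <;>
      · intro q _ e
        exact hs ⟨q, congrArg Prod.fst e⟩
  let ρ : Equiv.Perm (Pos n k) := Equiv.ofFiberEquiv (f := f a) (g := f b) fun c => (key c).some
  have hρ : ∀ p, f b (ρ p) = f a p := fun p => Equiv.ofFiberEquiv_map _ p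
  have h1 : ∀ p, ρ p ∈ cluster p := fun p => by
    rw [← show cluster (ρ p) = cluster p from congrArg Prod.fst (hρ p)]
    exact mem_cluster_self hn _
  exact ⟨ρ, fun p => ((mem_cluster hn).1 (h1 p)).1, fun p => ((mem_cluster hn).1 (h1 p)).2,
    fun p => iff_of_eq (congrArg Prod.snd (hρ p))⟩

end Completeness

end Rubik

namespace Rubik

open Finset

/-! ### Matching the signs of the classes -/

section MatchingSigns

variable {n k : ℕ}

/-- The classes with at most one inner coordinate outside the middle, ranked: the central classes,
and the classes with one inner coordinate. -/
def HasRank (r : ℕ) (p : Pos n k) : Prop :=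
  if r ≤ n then IsCentral r p
  else #(outer p) + 1 = n ∧ ∀ l ∉ outer p, kd (p l) + n + 1 = r ∧ (p l).rev ≠ p l

theorem hasRank_iff {r : ℕ} (h : r ≤ n) {p : Pos n k} : HasRank r p ↔ IsCentral r p := by
  unfold HasRank; rw [if_pos h]

theorem hasRank_iff_of_lt {r : ℕ} (h : n < r) {p : Pos n k} : HasRank r p ↔
    #(outer p) + 1 = n ∧ ∀ l ∉ outer p, kd (p l) + n + 1 = r ∧ (p l).rev ≠ p l := by
  unfold HasRank; rw [if_neg (by omega)]

theorem exists_not_mem_outer {p : Pos n k} (h : #(outer p) < n) : ∃ l, l ∉ outer p := by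
  by_contra! hc
  rw [eq_univ_iff_forall.2 hc, card_univ, Fintype.card_fin] at h
  omega

theorem isClassSet_hasRank (r : ℕ) : IsClassSet (n := n) (k := k) (HasRank r) := by
  have key : ∀ p q : Pos n k, Linked p q → HasRank r p → HasRank r q := by
    intro p q h hp
    by_cases hr : r ≤ n
    · rw [hasRank_iff hr] at hp ⊢; exact hp.of_linked h
    · rw [hasRank_iff_of_lt (by omega)] at hp ⊢
      refine ⟨by rw [h.card_outer]; exact hp.1, fun l hl => ?_⟩
      obtain ⟨σ, hσ⟩ := linked_iff.1 h
      obtain ⟨l, rfl⟩ := σ.surjective l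
      have := hp.2 l (mt (hσ.mem_outer l).2 hl)
      rwa [Ne, rev_eq_iff, hσ.kd_eq, ← rev_eq_iff]
  exact fun p q h => ⟨key p q h, key q p h.symm⟩

theorem HasRank.linked (hn : 3 ≤ n) {r : ℕ} {p q : Pos n k} (hp : HasRank r p)
    (hq : HasRank r q) : Linked p q := by
  by_cases hr : r ≤ n
  · rw [hasRank_iff hr] at hp hq; exact hp.linked (by omega) hq
  · rw [hasRank_iff_of_lt (by omega)] at hp hq
    have e : outer p ≃ outer q := Finset.equivOfCardEq (by omega)
    refine linked_of_two_le_card_outer (σ := e.extendSubtype) (fun l => ?_) (by omega)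
    by_cases hl : l ∈ outer p
    · rw [mem_outer.1 hl, mem_outer.1 (e.extendSubtype_mem l hl)]
    · have h1 := hp.2 l hl
      have h2 := hq.2 _ (e.extendSubtype_not_mem l hl)
      omega

/-- The turned plane passes through `p`. For `r < n` its directions are an outer and a middle axis
of `p`, and it is odd on the central classes `r` and `r + 1`. For `r = n` and even `k` it turns four
corners. For `r > n` two outer axes are turned, and the fixed inner factor of the plane keeps all
lower ranks out. The corners for odd `k` are excluded, since `C` forbids changing them alone. -/
theorem exists_turn (hn : 3 ≤ n) (hk : 2 ≤ k) {r : ℕ} (hr : 2 ≤ r) (hrn : r = n → ¬ Odd k)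
    {p : Pos n k} (hp : HasRank r p) :
    ∃ w : Combination n k, signOn (HasRank r) (combPos w) = -1 ∧
      ∀ s, 1 ≤ s → s < r → ∀ q : Pos n k, HasRank s q → combPos w q = q := by
  have fixed : ∀ {i j : Fin n} (hij : i ≠ j) (q : Pos n k),
      (Coplanar i j p q → (q i).rev = q i ∧ (q j).rev = q j) →
      combPos [planeTurn hij p] q = q := by
    intro i j hij q h
    by_cases hc : Coplanar i j p q
    · exact (planeTurn_pos_of_coplanar hij hc).trans (rotate_eq_self hij (h hc).1 (h hc).2)
    · exact planeTurn_pos_of_not hij hc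
  rcases lt_trichotomy r n with hlt | heq | hgt
  · rw [hasRank_iff hlt.le] at hp
    obtain ⟨i, hi⟩ := card_pos.1 (show 0 < #(outer p) by rw [hp.1]; omega)
    obtain ⟨j, hj⟩ := exists_not_mem_outer (p := p) (by rw [hp.1]; omega)
    have hij : i ≠ j := fun e => hj (e ▸ hi)
    have hodd := odd_of_rev_eq (hp.2 j hj)
    have hcard := card_outer_of_coplanar hij (coplanar_self p)
    rw [if_pos (mem_outer.1 hi), if_neg (mt mem_outer.2 hj), hp.1] at hcard
    refine ⟨[planeTurn hij p], ?_, fun s hs1 hs q hq => fixed hij q fun hc => ?_⟩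
    · rw [show (HasRank r : Pos n k → Prop) = IsCentral r from
        funext fun q => propext (hasRank_iff hlt.le), signOn_central hk hodd hij fun l _ _ =>
          hp.kd_or l, if_pos (by omega), if_neg (by omega), mul_one]
    · rw [hasRank_iff (by omega)] at hq
      have h1 := card_outer_of_coplanar hij hc
      rw [hq.1] at h1
      have h4 : kd (q i) ≠ 0 ∧ kd (q j) ≠ 0 := by
        constructor <;> intro h4 <;> rw [if_pos h4] at h1 <;> split_ifs at h1 <;> omega
      exact ⟨(hq.kd_or i).resolve_left h4.1, (hq.kd_or j).resolve_left h4.2⟩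
  · have hodd := hrn heq
    have hall : ∀ q : Pos n k, HasRank r q → ∀ l, kd (q l) = 0 := by
      intro q hq l
      rw [hasRank_iff heq.le] at hq
      exact (hq.kd_or l).resolve_right fun h => hodd (odd_of_rev_eq h)
    let i : Fin n := ⟨0, by omega⟩
    let j : Fin n := ⟨1, by omega⟩
    have hij : i ≠ j := by simp [i, j]
    refine ⟨[planeTurn hij p], ?_, fun s hs1 hs q hq => ?_⟩
    · refine signOn_planeTurn (isClassSet_hasRank r) hij (coplanar_self p) hp
        (rev_ne_of_kd_zero hk (hall p hp i)) fun q hq hc => Or.inr ?_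
      exact planeRelated_of_outer hij hc (hall p hp i) (hall p hp j) (hall q hq i) (hall q hq j)
    · rw [hasRank_iff (by omega)] at hq
      exact absurd hq (not_isCentral_of_not_odd (by omega) hodd q)
  · have hp' := (hasRank_iff_of_lt hgt).1 hp
    obtain ⟨x, hx⟩ := exists_not_mem_outer (p := p) (by omega)
    obtain ⟨i, hi, j, hj, hij⟩ := one_lt_card.1 (show 1 < #(outer p) by omega)
    have hxi : x ≠ i := fun e => hx (e ▸ hi)
    have hxj : x ≠ j := fun e => hx (e ▸ hj)
    have hx' := hp'.2 x hx
    refine ⟨[planeTurn hij p], ?_, fun s hs1 hs q hq => fixed hij q fun hc => ?_⟩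
    · refine signOn_planeTurn (isClassSet_hasRank r) hij (coplanar_self p) hp
        (rev_ne_of_kd_zero hk (mem_outer.1 hi)) fun q hq hc => Or.inr ?_
      have h1 := card_outer_of_coplanar hij hc
      have h2 := card_outer_of_coplanar hij (coplanar_self p)
      have h3 := ((hasRank_iff_of_lt hgt).1 hq).1
      rw [if_pos (mem_outer.1 hi), if_pos (mem_outer.1 hj)] at h2
      refine planeRelated_of_outer hij hc (mem_outer.1 hi) (mem_outer.1 hj) ?_ ?_ <;>
      · by_contra h4
        rw [if_neg h4] at h1
        split_ifs at h1 <;> omega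
    · exfalso
      have hqx := hc x hxi hxj
      have hxq : x ∉ outer q := by rw [mem_outer, hqx, ← mem_outer]; exact hx
      by_cases hsn : s ≤ n
      · rw [hasRank_iff hsn] at hq
        exact hx'.2 (hqx ▸ hq.2 x hxq)
      · have := ((hasRank_iff_of_lt (by omega)).1 hq).2 x hxq
        rw [hqx] at this
        omega

theorem signOn_relPerm_act {S : Pos n k → Prop} (hS : IsClassSet S) (a b : Assembly n k)
    (w : Combination n k) :
    signOn S (relPerm (a.act w) b) = signOn S (relPerm a b) * signOn S (combPos w) := by
  have h := signOn_mul (hS.relPerm (a.act w) b) (hS.relPerm a (a.act w))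
  have e : relPerm a (a.act w) = combPos w := by
    rw [relPerm_act]; ext1 p; simp [relPerm]
  rw [relPerm_mul, e] at h
  rw [h, mul_assoc, Int.units_mul_self, mul_one]

/-- Triangular elimination: the signs are corrected by increasing rank, each by a turn that fixes
all cubies of lower rank. The frame has rank 1 and stays in place. -/
theorem exists_act_signs (hn : 3 ≤ n) (hk : 2 ≤ k) (R : Reference n k) {a b : Assembly n k}
    (h : R.SameInvariants a b) (hfr : ∀ p, IsCentral 1 p → a.place p = b.place p) (r : ℕ)
    (hr : 1 ≤ r) :
    ∃ w, (∀ p, IsCentral 1 p → (a.act w).place p = b.place p) ∧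
      ∀ s, 1 ≤ s → s ≤ r → signOn (HasRank s) (relPerm (a.act w) b) = 1 := by
  have hone : ∀ c : Assembly n k, (∀ p, IsCentral 1 p → c.place p = b.place p) →
      signOn (HasRank 1) (relPerm c b) = 1 := by
    intro c hc
    refine signOn_eq_one fun p hp => ?_
    rw [hasRank_iff (by omega)] at hp
    have := hc _ (hp.of_linked (c.symm_linked p))
    rw [Equiv.apply_symm_apply] at this
    exact this.symm
  induction r, hr using Nat.le_induction with
  | base =>
    refine ⟨[], hfr, fun s h1 h2 => ?_⟩
    obtain rfl : s = 1 := by omega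
    exact hone _ hfr
  | succ r hr ih =>
    obtain ⟨w, h1, h2⟩ := ih
    by_cases hs : signOn (HasRank (r + 1)) (relPerm (a.act w) b) = 1
    · refine ⟨w, h1, fun s hs1 hs2 => ?_⟩
      rcases hs2.lt_or_eq with h3 | rfl
      exacts [h2 s hs1 (by omega), hs]
    -- For odd `k` the last central sign is the product of the earlier ones, by the invariant `C`,
    -- so it is already correct.
    have hrn : r + 1 = n → ¬ Odd k := by
      intro e hodd
      have hC : R.C (a.act w) = R.C b := (R.C_act hk a w).trans h.2.2.1
      have h3 : ∏ m ∈ Icc 1 n, signOn (IsCentral m) (relPerm (a.act w) b) = 1 := by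
        have h4 : (∏ m ∈ Icc 1 n, signOn (IsCentral m) (relPerm (a.act w) b)) *
            R.C (a.act w) = R.C b := by
          rw [R.C_eq hodd, R.C_eq hodd, ← prod_mul_distrib]
          refine prod_congr rfl fun m _ => ?_
          rw [← signOn_mul ((isClassSet_central m).relPerm _ _)
            ((isClassSet_central m).relPerm _ _), relPerm_mul]
        rw [hC] at h4
        exact mul_eq_right.1 h4
      refine hs ?_
      rw [prod_eq_single_of_mem (r + 1) (mem_Icc.2 (by omega)) fun m hm hm' => ?_] at h3
      · rw [← h3]
        congr 1
        exact funext fun q => propext (hasRank_iff (by omega))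
      · have hm1 := mem_Icc.1 hm
        rw [← h2 m hm1.1 (by omega)]
        congr 1
        exact funext fun q => propext (hasRank_iff (by omega)).symm
    obtain ⟨p, hp⟩ : ∃ p : Pos n k, HasRank (r + 1) p := by
      by_contra! hc
      exact hs (signOn_eq_one fun p hp => absurd hp (hc p))
    obtain ⟨v, h3, h4⟩ := exists_turn hn hk (by omega) hrn hp
    have hact : ∀ s, signOn (HasRank s) (relPerm (a.act (w ++ v)) b) =
        signOn (HasRank s) (relPerm (a.act w) b) * signOn (HasRank s) (combPos v) := by
      intro s
      rw [signOn_relPerm_act (isClassSet_hasRank s), signOn_relPerm_act (isClassSet_hasRank s),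
        combPos_append, signOn_mul ((isClassSet_hasRank s).combPos _)
          ((isClassSet_hasRank s).combPos _), mul_comm (signOn _ (combPos v)), mul_assoc]
    refine ⟨w ++ v, fun p hp => ?_, fun s hs1 hs2 => ?_⟩
    · rw [Assembly.act_place, posAfter_append, ← Assembly.act_place, h1 p hp]
      exact h4 1 le_rfl (by omega) _ ((hasRank_iff (by omega)).2 (hp.of_linked (b.linked_place p)))
    · rw [hact]
      rcases hs2.lt_or_eq with h5 | rfl
      · rw [h2 s hs1 (by omega), signOn_eq_one (h4 s hs1 h5), one_mul]
      · rw [h3, (Int.units_eq_one_or _).resolve_left hs]; rfl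

/-- A permutation of the positions, given for each class. -/
def glue (f : Cls n k → Equiv.Perm (Pos n k)) (hf : ∀ K p, cls (f K p) = K ↔ cls p = K) :
    Equiv.Perm (Pos n k) where
  toFun p := f (cls p) p
  invFun p := (f (cls p)).symm p
  left_inv p := by
    have := (hf (cls p) p).2 rfl
    change (f (cls (f (cls p) p))).symm (f (cls p) p) = p
    rw [this, Equiv.symm_apply_apply]
  right_inv p := by
    have : cls ((f (cls p)).symm p) = cls p := (hf _ _).1 (by rw [Equiv.apply_symm_apply])
    change f (cls ((f (cls p)).symm p)) ((f (cls p)).symm p) = p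
    rw [this, Equiv.apply_symm_apply]

theorem glue_apply (f : Cls n k → Equiv.Perm (Pos n k)) (hf) {K : Cls n k} {p : Pos n k}
    (hp : cls p = K) : glue f hf p = f K p := by
  subst hp; rfl

/-- A class outside the ranked ones has two cubies that look the same and are both well or both
badly oriented. -/
theorem exists_pair (hn : 3 ≤ n) (R : Reference n k) (b : Assembly n k) {p : Pos n k}
    (h0 : 0 < #(outer p)) (h : ∀ r, 1 ≤ r → ¬ HasRank r p) :
    ∃ x y, x ≠ y ∧ Linked p x ∧ Linked p y ∧ SameColour x y ∧ (R.IsDep b x ↔ R.IsDep b y) := by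
  have hle : #(outer p) ≤ n := by simpa using card_le_univ (outer p)
  have hnc : ¬ IsCentral #(outer p) p := fun hc => h _ h0 ((hasRank_iff hle).2 hc)
  obtain ⟨i, hi, hir⟩ : ∃ i, i ∉ outer p ∧ (p i).rev ≠ p i := by
    by_contra! hc
    exact hnc ⟨rfl, hc⟩
  -- If `i` were the only inner axis, `p` would have the rank `kd (p i) + n + 1`.
  obtain ⟨j, hj, hij⟩ : ∃ j, j ∉ outer p ∧ i ≠ j := by
    by_contra! hc
    refine h (kd (p i) + n + 1) (by omega) ((hasRank_iff_of_lt (by omega)).2 ⟨?_, fun l hl => ?_⟩)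
    · have : outer p = univ.erase i := by
        ext l
        simp only [mem_erase, mem_univ, and_true]
        exact ⟨fun hl e => hi (e ▸ hl), fun hl => by_contra fun hc' => hl (hc l hc').symm⟩
      rw [this, card_erase_of_mem (mem_univ i), card_univ, Fintype.card_fin]; omega
    · rw [← hc l hl]; exact ⟨rfl, hir⟩
  have hrot : ∀ q : Pos n k, i ∉ outer q → j ∉ outer q →
      SameColour q (rotate i j q) ∧ i ∉ outer (rotate i j q) ∧ j ∉ outer (rotate i j q) ∧
      Linked q (rotate i j q) := by
    intro q hi hj
    have h1 := reach_rotate hij q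
    have h2 : outer (rotate i j q) = outer q := by
      ext l
      by_cases hli : l = i
      · subst hli
        refine iff_of_false ?_ hi
        rw [mem_outer, rotate_fst, ← flip_neg_one, kd_flip, ← mem_outer]; exact hj
      · by_cases hlj : l = j
        · subst hlj
          refine iff_of_false ?_ hj
          rw [mem_outer, rotate_snd hij, ← mem_outer]; exact hi
        · rw [mem_outer, mem_outer]; simp [rotate, hli, hlj]
    refine ⟨⟨h2, fun l hl => ?_⟩, h2 ▸ hi, h2 ▸ hj, h1.linked⟩
    have hli : l ≠ i := fun e => hi (e ▸ hl)
    have hlj : l ≠ j := fun e => hj (e ▸ hl)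
    simp [rotate, hli, hlj]
  obtain ⟨c1, i1, j1, l1⟩ := hrot p hi hj
  obtain ⟨c2, i2, j2, l2⟩ := hrot _ i1 j1
  set q := rotate i j p with hq
  set r := rotate i j q with hr
  have hrp : p ≠ r := fun e => hir (rotate_two hij e.symm).1
  have hqp : p ≠ q := fun e => hrp (by rw [hr, ← e, ← hq, ← e])
  have hrq : q ≠ r := fun e => hqp ((Equiv.injective (Equiv.ofBijective (rotate i j)
    (Finite.injective_iff_bijective.1 (Function.LeftInverse.injective (rotate_rotate hij))))) e)
  -- Of the three different cubies `p`, `q`, `r` of equal colours, two have the same parity.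
  by_cases h1 : R.IsDep b p ↔ R.IsDep b q
  · exact ⟨p, q, hqp, Linked.refl p, l1, c1, h1⟩
  by_cases h2 : R.IsDep b p ↔ R.IsDep b r
  · exact ⟨p, r, hrp, Linked.refl p, l1.trans l2, c1.trans c2, h2⟩
  · exact ⟨q, r, hrq, l1, l1.trans l2, c2, by tauto⟩

/-- In each class with a wrong sign two cubies of equal colours and parity are exchanged; such a
class has no rank, so `exists_pair` applies. The exchanges in different classes are glued. -/
theorem exists_relabel_signs (hn : 3 ≤ n) (R : Reference n k) {a b : Assembly n k}
    (h : ∀ r, 1 ≤ r → signOn (HasRank r) (relPerm a b) = 1) :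
    ∃ (ρ : Equiv.Perm (Pos n k)) (hρ : ∀ p, Linked p (ρ p)) (hc : ∀ p, SameColour p (ρ p)),
      (∀ p, R.IsDep b (ρ p) ↔ R.IsDep b p) ∧
      ∀ K, 0 < #(outer (R.base K)) →
        signOn (fun p => cls p = K) (relPerm a (b.relabel ρ hρ hc)) = 1 := by
  classical
  have key : ∀ K : Cls n k, ∃ g : Equiv.Perm (Pos n k), (∀ p, cls p = K → Linked p (g p) ∧
      SameColour p (g p) ∧ (R.IsDep b (g p) ↔ R.IsDep b p)) ∧ (∀ p, cls (g p) = K ↔ cls p = K) ∧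
      (0 < #(outer (R.base K)) →
        signOn (fun p => cls p = K) (relPerm a b) * signOn (fun p => cls p = K) g = 1) := by
    intro K
    by_cases hs : 0 < #(outer (R.base K)) ∧ signOn (fun p => cls p = K) (relPerm a b) ≠ 1
    · obtain ⟨h0, hs⟩ := hs
      obtain ⟨x, y, hxy, hx, hy, hc, hd⟩ := exists_pair hn R b h0 fun r hr hK => hs (by
        rw [← h r hr]
        congr 1
        funext p
        refine propext ⟨fun hp => ?_, fun hp => R.cls_base' (hK.linked hn hp)⟩
        exact (isClassSet_hasRank r _ _ (cls_eq_iff.1 (hp.trans (R.cls_base K).symm))).2 hK)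
      have hx' := R.cls_base' hx
      have hy' := R.cls_base' hy
      refine ⟨Equiv.swap x y, fun p hp => ?_, fun p => ?_, fun _ => ?_⟩
      · rw [Equiv.swap_apply_def]
        split_ifs with h1 h2
        · subst h1; exact ⟨hx.symm.trans hy, hc, hd.symm⟩
        · subst h2; exact ⟨hy.symm.trans hx, hc.symm, hd⟩
        · exact ⟨Linked.refl p, SameColour.refl p, Iff.rfl⟩
      · rw [Equiv.swap_apply_def]
        split_ifs with h1 h2
        · rw [h1]; exact iff_of_true hy' hx'
        · rw [h2]; exact iff_of_true hx' hy'
        · rfl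
      · rw [(Int.units_eq_one_or _).resolve_left hs, signOn_swap hxy hx' hy' fun _ _ => rfl]; rfl
    · refine ⟨1, fun p _ => ⟨Linked.refl p, SameColour.refl p, Iff.rfl⟩, fun _ => Iff.rfl,
        fun h0 => ?_⟩
      rw [signOn_eq_one (f := 1) fun _ _ => rfl, mul_one]
      by_contra hc
      exact hs ⟨h0, hc⟩
  choose g h1 h2 h3 using key
  refine ⟨glue g h2, fun p => (h1 _ p rfl).1, fun p => (h1 _ p rfl).2.1,
    fun p => (h1 _ p rfl).2.2, fun K hK => ?_⟩
  have hS := isClassSet_cls K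
  have ha : ∀ p, cls (a.place p) = K ↔ cls p = K := fun p => (hS _ _ (a.linked_place p)).symm
  have hb : ∀ p, cls (b.place p) = K ↔ cls p = K := fun p => (hS _ _ (b.linked_place p)).symm
  have hg : ∀ p, cls (glue g h2 p) = K ↔ cls p = K := fun p =>
    (hS _ _ (h1 _ p rfl).1).symm
  have hai : ∀ p, cls (a.place⁻¹ p) = K ↔ cls p = K := fun p => by rw [← ha]; simp
  rw [← h3 K hK]
  change signOn _ (b.place * glue g h2 * a.place⁻¹) = signOn _ (b.place * a.place⁻¹) * _
  rw [signOn_mul (f := b.place * glue g h2) (fun p => (hb _).trans (hg p)) hai, signOn_mul hb hg,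
    signOn_mul hb hai, signOn_congr (f := glue g h2) (g := g K) (fun p hp => glue_apply g h2 hp) hg
      (h2 K)]
  exact mul_right_comm _ _ _

end MatchingSigns

end Rubik

namespace Rubik

open Finset

/-! ### Completeness of the invariants -/

section Complete

variable {n k : ℕ}

/-- The slot that a slot of the solved puzzle occupies in an assembly. -/
def Assembly.slot (a : Assembly n k) (p : Pos n k) (l : outer p) : Slot n k :=
  ⟨(a.place p, a.face p l), (a.face p l).2⟩

theorem paint_eq_of_slot {a b : Assembly n k} (h : ∀ p l, a.slot p l = b.slot p l) :
    a.paint = b.paint := by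
  have key : ∀ {a b : Assembly n k}, (∀ p l, a.slot p l = b.slot p l) → ∀ f l x,
      a.paint f l = some x → b.paint f l = some x := by
    intro a b h f l x
    rw [Assembly.paint_eq_some, Assembly.paint_eq_some]
    rintro ⟨p, h1, h2, h3, h4⟩
    have h5 := congrArg Subtype.val (h p ⟨l, h3⟩)
    have h6 : a.place p = b.place p := congrArg Prod.fst h5
    have h7 : (a.face p ⟨l, h3⟩ : Fin n) = b.face p ⟨l, h3⟩ := congrArg Prod.snd h5
    exact ⟨p, h6 ▸ h1, h2, h3, h7 ▸ h4⟩
  exact colouring_ext fun f l x => ⟨key h f l x, key (fun p l => (h p l).symm) f l x⟩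

theorem connected_of_slot {a b : Assembly n k} {g : Equiv.Perm (Slot n k)} (hg : g ∈ slotGroup n k)
    (h : ∀ p l, g (a.slot p l) = b.slot p l) : Connected a.paint b.paint := by
  obtain ⟨w, rfl⟩ := hg
  refine connected_iff.2 ⟨w, paint_eq_of_slot fun p l => ?_⟩
  rw [← h]
  exact Subtype.ext (combSlot_apply w (a.slot p l)).symm

/-- Elements supported on different classes do not disturb each other, so a finite product of them
solves all classes at once. -/
theorem exists_slotGroup_of_classes {a b : Assembly n k}
    (h : ∀ K : Cls n k, ∃ g ∈ slotGroup n k, (∀ p, cls p = K → ∀ l, g (a.slot p l) = b.slot p l) ∧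
      ∀ s : Slot n k, cls s.1.1 ≠ K → g s = s) : Connected a.paint b.paint := by
  classical
  have key : ∀ T : Finset (Cls n k), ∃ g ∈ slotGroup n k,
      (∀ p, cls p ∈ T → ∀ l, g (a.slot p l) = b.slot p l) ∧
      ∀ s : Slot n k, cls s.1.1 ∉ T → g s = s := by
    intro T
    induction T using Finset.induction_on with
    | empty => exact ⟨1, one_mem _, by simp, by simp⟩
    | insert K T hK ih =>
      obtain ⟨g, hg, h1, h2⟩ := ih
      obtain ⟨g', hg', h3, h4⟩ := h K
      refine ⟨g * g', mul_mem hg hg', fun p hp l => ?_, fun s hs => ?_⟩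
      · rcases mem_insert.1 hp with hp | hp
        · rw [Equiv.Perm.mul_apply, h3 p hp l]
          refine h2 _ ?_
          rw [show cls (b.slot p l).1.1 = K from cls_place b hp]
          exact hK
        · rw [Equiv.Perm.mul_apply, h4, h1 p hp l]
          rw [show cls (a.slot p l).1.1 = cls p from cls_place a rfl]
          exact fun e => hK (e ▸ hp)
      · rw [mem_insert, not_or] at hs
        rw [Equiv.Perm.mul_apply, h4 s hs.1, h2 s hs.2]
  obtain ⟨g, hg, h1, -⟩ := key univ
  exact connected_of_slot hg fun p l => h1 p (mem_univ _) l

/-- The change of orientation between two assemblies, at a position of the first one. -/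
noncomputable def Reference.relTwist (R : Reference n k) (a b : Assembly n k) (K : Cls n k)
    (x : {p : Pos n k // cls p = K}) : depGroup (R.base K) :=
  have h : cls (a.place.symm x) = K := (cls_eq_iff.2 (a.symm_linked x)).symm.trans x.2
  (R.depOrientation b K _ h)⁻¹ * R.depOrientation a K _ h

theorem Reference.relTwist_place (R : Reference n k) (a b : Assembly n k) (K : Cls n k) {p : Pos n k}
    (hp : cls p = K) : R.relTwist a b K ⟨a.place p, cls_place a hp⟩ =
      (R.depOrientation b K p hp)⁻¹ * R.depOrientation a K p hp := by
  have key : ∀ q (hq : cls q = K), q = p →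
      (R.depOrientation b K q hq)⁻¹ * R.depOrientation a K q hq =
        (R.depOrientation b K p hp)⁻¹ * R.depOrientation a K p hp := by
    rintro q hq rfl; rfl
  exact key _ _ (Equiv.symm_apply_apply _ _)

open Classical in
-- Where the invariant `O` exists, it is the product in question for each assembly. Where it does
-- not, the abelianization is trivial.
theorem Reference.prod_relTwist (R : Reference n k) {a b : Assembly n k} (K : Cls n k)
    (hO : R.HasO K → R.O K a = R.O K b) : ∏ x, Abelianization.of (R.relTwist a b K x) = 1 := by
  have ha : ∀ p, cls (a.place p) = K ↔ cls p = K := fun p =>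
    (isClassSet_cls K _ _ (a.linked_place p)).symm
  by_cases hH : R.HasO K
  · rw [← Equiv.prod_comp (a.place.subtypePerm ha)]
    have h1 : ∀ p : {p : Pos n k // cls p = K},
        Abelianization.of (R.relTwist a b K (a.place.subtypePerm ha p)) =
        (Abelianization.of (R.depOrientation b K p p.2))⁻¹ *
          Abelianization.of (R.depOrientation a K p p.2) := by
      intro p
      rw [← map_inv, ← map_mul]
      exact congrArg _ (R.relTwist_place a b K p.2)
    rw [prod_congr rfl fun p _ => h1 p, prod_mul_distrib, prod_inv_distrib]
    have h3 := hO hH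
    unfold Reference.O at h3
    rw [h3, inv_mul_cancel]
  · unfold Reference.HasO at hH
    rw [ne_eq, not_not] at hH
    refine prod_eq_one fun x _ => ?_
    rw [← MonoidHom.mem_ker, Abelianization.ker_of, hH]
    exact Subgroup.mem_top _

/-- With equal parities both orientations are renumbered by `other` or neither is, so `other`
cancels. -/
theorem Reference.relTwist_smul (R : Reference n k) {a b : Assembly n k} (K : Cls n k)
    (hd : ∀ p, R.IsDep a p ↔ R.IsDep b p) {p : Pos n k} (hp : cls p = K) (m : outer (R.base K)) :
    R.relTwist a b K ⟨a.place p, cls_place a hp⟩ • m =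
      (R.orientation b K p hp).symm (R.orientation a K p hp m) := by
  rw [R.relTwist_place a b K hp]
  have h3 : R.orientation a K p hp ∈ depGroup (R.base K) ↔
      R.orientation b K p hp ∈ depGroup (R.base K) := by
    rw [R.isDep_iff, R.isDep_iff]; exact hd p
  have h4 : (((R.depOrientation b K p hp)⁻¹ * R.depOrientation a K p hp : depGroup (R.base K)) :
      Equiv.Perm (outer (R.base K))) = (R.orientation b K p hp)⁻¹ * R.orientation a K p hp := by
    rw [Subgroup.coe_mul, Subgroup.coe_inv]
    unfold Reference.depOrientation
    by_cases h4 : R.orientation a K p hp ∈ depGroup (R.base K)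
    · rw [dif_pos h4, dif_pos (h3.1 h4)]
    · rw [dif_neg h4, dif_neg (mt h3.2 h4)]
      simp only [mul_inv_rev, mul_assoc, inv_mul_cancel_left]
  exact DFunLike.congr_fun h4 m

theorem Reference.slot_eq (R : Reference n k) (a : Assembly n k) {K : Cls n k} {p : Pos n k}
    (hp : cls p = K) (m : outer (R.base K)) :
    a.slot p (R.number K p hp (R.orientation a K p hp m)) =
      classSlot R K (⟨a.place p, cls_place a hp⟩, m) :=
  Subtype.ext (Prod.ext rfl (R.orientation_spec a p hp m))

theorem exists_on_class_of_sign (hn : 3 ≤ n) (hk : 2 ≤ k) (R : Reference n k) {a b : Assembly n k}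
    (K : Cls n k) (hK : IsMobile (R.base K))
    (hs : signOn (fun p => cls p = K) (relPerm a b) = 1)
    (hd : ∀ p, R.IsDep a p ↔ R.IsDep b p) (hO : R.HasO K → R.O K a = R.O K b) :
    ∃ g ∈ slotGroup n k, (∀ p, cls p = K → ∀ l, g (a.slot p l) = b.slot p l) ∧
      ∀ s : Slot n k, cls s.1.1 ≠ K → g s = s := by
  classical
  rw [signOn_eq ((isClassSet_cls K).relPerm a b)] at hs
  obtain ⟨g, hg, h1, h2⟩ := exists_on_class hn hk R K hK
    (σ := (relPerm a b).subtypePerm ((isClassSet_cls K).relPerm a b)) (by convert hs)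
    (d := R.relTwist a b K) (by convert R.prod_relTwist K hO)
  refine ⟨g, hg, fun p hp l => ?_, h2⟩
  obtain ⟨m, rfl⟩ := (R.number K p hp).surjective l
  obtain ⟨m, rfl⟩ := (R.orientation a K p hp).surjective m
  have e : (relPerm a b).subtypePerm ((isClassSet_cls K).relPerm a b) ⟨a.place p, cls_place a hp⟩ =
      (⟨b.place p, cls_place b hp⟩ : {p : Pos n k // cls p = K}) :=
    Subtype.ext (relPerm_apply_place a b p)
  rw [R.slot_eq a hp, h1, R.relTwist_smul K hd hp, e, ← R.slot_eq b hp, Equiv.apply_symm_apply]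

theorem Reference.connected_of_sameInvariants (hn : 3 ≤ n) (hk : 2 ≤ k) (R : Reference n k)
    {a b : Assembly n k} (h : R.SameInvariants a b) : Connected a.paint b.paint := by
  -- match the frame, the parities, and the signs
  obtain ⟨w₁, h1⟩ := exists_act_frame hk R hn h
  have hI₁ : R.SameInvariants (a.act w₁) b := (R.sameInvariants_act hn hk a w₁).trans h
  obtain ⟨ρ₁, l₁, c₁, d₁⟩ := R.exists_relabel hn hk hI₁.2.2.2.2
  set b₁ := b.relabel ρ₁ l₁ c₁
  have hρ₁ : SameUpTo ρ₁ b₁ b := sameUpTo_relabel b ρ₁ l₁ c₁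
  have hI₂ : R.SameInvariants (a.act w₁) b₁ := hI₁.trans (hρ₁.sameInvariants hn R).symm
  have hd₁ : ∀ p, R.IsDep (a.act w₁) p ↔ R.IsDep b₁ p := fun p => by
    rw [← R.isDep_sameUpTo hρ₁, d₁]
  -- The bound `n + 1 + k` exceeds every rank that occurs, because the kind of a factor is less than
  -- `k`.
  obtain ⟨w₂, h2, h3⟩ := exists_act_signs hn hk R hI₂
    (fun p hp => (h1 p hp).trans (hρ₁.sameCentral 1 le_rfl p hp).symm) (n + 1 + k) (by omega)
  set a₂ := (a.act w₁).act w₂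
  have hs : ∀ r, 1 ≤ r → signOn (HasRank r) (relPerm a₂ b₁) = 1 := by
    intro r hr
    by_cases hrk : r ≤ n + 1 + k
    · exact h3 r hr hrk
    · refine signOn_eq_one fun p hp => ?_
      rw [hasRank_iff_of_lt (by omega)] at hp
      obtain ⟨l, hl⟩ := exists_not_mem_outer (p := p) (by omega)
      have := (hp.2 l hl).1
      have := kd_lt (p l)
      omega
  obtain ⟨ρ₂, l₂, c₂, d₂, h4⟩ := exists_relabel_signs hn R hs
  set b₂ := b₁.relabel ρ₂ l₂ c₂
  have hρ₂ : SameUpTo ρ₂ b₂ b₁ := sameUpTo_relabel b₁ ρ₂ l₂ c₂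
  have hI₃ : R.SameInvariants a₂ b₂ :=
    ((R.sameInvariants_act hn hk _ w₂).trans hI₂).trans (hρ₂.sameInvariants hn R).symm
  have hd₂ : ∀ p, R.IsDep a₂ p ↔ R.IsDep b₂ p := fun p => by
    rw [← R.isDep_sameUpTo hρ₂, d₂, R.isDep_act, hd₁]
  have hfr : ∀ p, IsCentral 1 p → a₂.place p = b₂.place p := fun p hp =>
    (h2 p hp).trans (hρ₂.sameCentral 1 le_rfl p hp).symm
  have hconn : Connected a₂.paint b₂.paint := by
    refine exists_slotGroup_of_classes fun K => ?_
    have hcard : ∀ p, cls p = K → #(outer p) = #(outer (R.base K)) := fun p hp =>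
      (cls_eq_iff.1 ((R.cls_base K).trans hp.symm)).card_outer
    -- Cubies without outer axes have no slots, so nothing has to be moved.
    by_cases h0 : #(outer (R.base K)) = 0
    · refine ⟨1, one_mem _, fun p hp l => ?_, fun _ _ => rfl⟩
      have h5 := hcard p hp
      rw [h0, card_eq_zero] at h5
      exact absurd (Finset.ext_iff.1 h5 l |>.1 l.2) (notMem_empty _)
    -- Frame cubies are already in place and have one slot only. They are not mobile, so the 3-cycle
    -- argument would not apply to them.
    by_cases hc : IsCentral 1 (R.base K)
    · refine ⟨1, one_mem _, fun p hp l => ?_, fun _ _ => rfl⟩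
      have hp' : IsCentral 1 p := hc.of_linked (cls_eq_iff.1 ((R.cls_base K).trans hp.symm))
      refine Subtype.ext (Prod.ext (hfr p hp') ?_)
      have h5 : IsCentral 1 (b₂.place p) := hp'.of_linked (b₂.linked_place p)
      have h6 : (a₂.face p l : Fin n) ∈ outer (b₂.place p) := hfr p hp' ▸ (a₂.face p l).2
      exact card_le_one.1 h5.1.le _ h6 _ (b₂.face p l).2
    refine exists_on_class_of_sign hn hk R K ?_ (h4 K (Nat.pos_of_ne_zero h0)) hd₂
      (hI₃.2.2.2.1 K)
    obtain ⟨i, hi⟩ := card_pos.1 (Nat.pos_of_ne_zero h0)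
    by_cases h5 : ∃ j ∈ outer (R.base K), j ≠ i
    -- Outer factors are never self-opposite for `2 ≤ k`, so two outer axes make the cubie mobile;
    -- with one outer axis, a non-central cubie has a further factor that is not self-opposite.
    · obtain ⟨j, hj, hji⟩ := h5
      exact ⟨i, j, hji.symm, rev_ne_of_kd_zero hk (mem_outer.1 hi),
        rev_ne_of_kd_zero hk (mem_outer.1 hj)⟩
    · push Not at h5
      have h6 : outer (R.base K) = {i} := eq_singleton_iff_unique_mem.2 ⟨hi, h5⟩
      obtain ⟨j, hj, hjr⟩ : ∃ j, j ∉ outer (R.base K) ∧ ((R.base K) j).rev ≠ (R.base K) j := by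
        by_contra! hcon
        exact hc ⟨by rw [h6, card_singleton], hcon⟩
      exact ⟨i, j, fun e => hj (e ▸ hi), rev_ne_of_kd_zero hk (mem_outer.1 hi), hjr⟩
  obtain ⟨w₃, hw₃⟩ := connected_iff.1 hconn
  refine connected_iff.2 ⟨(w₁ ++ w₂) ++ w₃, ?_⟩
  rw [← hρ₁.paint_eq, ← hρ₂.paint_eq, ← hw₃]
  refine paint_eq_of_slot fun p l => Subtype.ext (Prod.ext ?_ ?_)
  · change posAfter (w₁ ++ w₂ ++ w₃) (a.place p) = posAfter w₃ (posAfter w₂ (posAfter w₁ (a.place p)))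
    rw [posAfter_append, posAfter_append]
  · change axesAfter (w₁ ++ w₂ ++ w₃) (a.place p) (a.face p l) =
      axesAfter w₃ (posAfter w₂ (posAfter w₁ (a.place p)))
        (axesAfter w₂ (posAfter w₁ (a.place p)) (axesAfter w₁ (a.place p) (a.face p l)))
    rw [axesAfter_append, axesAfter_append, posAfter_append]
    rfl

theorem Reference.connected_iff_sameInvariants (hn : 3 ≤ n) (hk : 2 ≤ k) (R : Reference n k)
    (a b : Assembly n k) : Connected a.paint b.paint ↔ R.SameInvariants a b :=
  ⟨R.sameInvariants_of_connected hn hk, R.connected_of_sameInvariants hn hk⟩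

end Complete

end Rubik

namespace Rubik

open Finset

/-! ### Existence of reference data -/

section Existence

variable {n k : ℕ}

theorem exists_carries {p q : Pos n k} (h : Linked p q) : ∃ f : outer p ≃ outer q, Carries f := by
  obtain ⟨σ, h⟩ := linked_iff.1 h
  exact ⟨outerEquiv h, carries_outerEquiv h⟩

theorem Carries.rigid {p q : Pos n k} {f : outer p ≃ outer q} (h : Carries f) :
    ∃ (σ : Equiv.Perm (Fin n)) (ε : Fin n → ℤˣ), Equiv.Perm.sign σ * ∏ l, ε l = 1 ∧
      ∀ l : outer p, (f l : Fin n) = σ l ∧ q (σ l) = if ε l = 1 then p l else (p l).rev := by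
  obtain ⟨σ, ⟨ε, h1, h2⟩, h3⟩ := h
  exact ⟨σ, ε, h1, fun l => ⟨h3 l, h2 l⟩⟩

theorem exists_assembly_place (e : Equiv.Perm (Pos n k)) (he : ∀ p, Linked p (e p)) :
    ∃ a : Assembly n k, a.place = e := by
  choose f hf using fun p => exists_carries (he p)
  exact ⟨⟨e, he, f, fun p => (hf p).rigid⟩, rfl⟩

theorem equivOfCardEq_congr {s t t' : Finset (Fin n)} (h : t = t') (e : #s = #t) (e' : #s = #t')
    (l : s) : (Finset.equivOfCardEq e l : Fin n) = Finset.equivOfCardEq e' l := by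
  subst h; rfl

/-- The dependent group contains all even permutations, so any odd one can serve. -/
theorem exists_other (hk : 2 ≤ k) (P : Pos n k) : ∃ τ : Equiv.Perm (outer P),
    ∀ φ, φ ∈ depGroup P ∨ τ * φ ∈ depGroup P := by
  by_cases h : ∃ π : Equiv.Perm (outer P), π ∉ alternatingGroup (outer P)
  · obtain ⟨π, hπ⟩ := h
    refine ⟨π, fun φ => ?_⟩
    by_cases hφ : φ ∈ alternatingGroup (outer P)
    · exact Or.inl (alternatingGroup_le_depGroup hk P hφ)
    · refine Or.inr (alternatingGroup_le_depGroup hk P ?_)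
      rw [Equiv.Perm.mem_alternatingGroup] at hπ hφ ⊢
      rw [map_mul, (Int.units_eq_one_or _).resolve_left hπ, (Int.units_eq_one_or _).resolve_left hφ]
      rfl
  · push Not at h
    exact ⟨1, fun φ => Or.inl (alternatingGroup_le_depGroup hk P (h φ))⟩

theorem nonempty_reference (hn : 3 ≤ n) (hk : 2 ≤ k) : Nonempty (Reference n k) := by
  classical
  obtain ⟨a₀, -⟩ := exists_assembly_place (n := n) (k := k) 1 Linked.refl
  have hbase : ∀ K : Cls n k, cls K.out = K := fun K => Quotient.out_eq K
  have hlinked : ∀ (K : Cls n k) (q : Pos n k), cls q = K → Linked K.out q := fun K q h =>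
    cls_eq_iff.1 ((hbase K).trans h.symm)
  choose f hf using fun K q h => exists_carries (hlinked K q h)
  choose τ hτ using fun K : Cls n k => exists_other hk K.out
  exact ⟨{
    central := a₀
    frame := fun S => if h : ∃ a : Assembly n k, B₁ a = S then h.choose else a₀
    B₁_frame := fun a => by
      have h : ∃ b : Assembly n k, B₁ b = B₁ a := ⟨a, rfl⟩
      rw [dif_pos h]
      exact h.choose_spec
    base := fun K => K.out
    cls_base := hbase
    right := f
    right_spec := fun K q h => carries_iff.1 (hf K q h)
    -- This bijection depends only on the set of outer axes, so cubies with the same colours are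
    -- numbered alike.
    number := fun K p hp => Finset.equivOfCardEq (hlinked K p hp).card_outer.symm
    number_spec := fun K p q hp hq h l =>
      equivOfCardEq_congr (sameColour_of_colours hn h).1.symm _ _ l
    other := τ
    other_spec := hτ }⟩

/-! ### Realizing orientations -/

/-- A cubie with an inner factor can be inserted with any orientation. One without is restricted to
those orientations that a rotation of space produces, which is the alternative in `hφ`. -/
theorem Reference.exists_assembly (R : Reference n k) (e : Equiv.Perm (Pos n k))
    (he : ∀ p, Linked p (e p)) (φ : ∀ p, Equiv.Perm (outer (R.base (cls p))))
    (hφ : ∀ p, #(outer p) < n ∨ Carries ((R.number (cls p) p rfl).symm.trans (φ p).symm)) :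
    ∃ a : Assembly n k, a.place = e ∧ ∀ p, R.orientation a (cls p) p rfl = φ p := by
  have hcls : ∀ p, cls (e p) = cls p := fun p => (cls_eq_iff.2 (he p)).symm
  let f : ∀ p, outer p ≃ outer (e p) := fun p =>
    ((R.number (cls p) p rfl).symm.trans (φ p).symm).trans (R.right (cls p) (e p) (hcls p))
  have hf : ∀ p, ∃ (σ : Equiv.Perm (Fin n)) (ε : Fin n → ℤˣ), Equiv.Perm.sign σ * ∏ l, ε l = 1 ∧
      ∀ l : outer p, (f p l : Fin n) = σ l ∧ e p (σ l) = if ε l = 1 then p l else (p l).rev := by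
    intro p
    rcases hφ p with h | h
    · exact rigid_of_card_lt _ h
    · exact (h.trans (R.carries_right _ _ _)).rigid
  refine ⟨⟨e, he, f, hf⟩, rfl, fun p => (R.eq_orientation _ _ _ _ fun l => ?_).symm⟩
  change ((R.right (cls p) (e p) (hcls p)) ((φ p).symm ((R.number (cls p) p rfl).symm
    (R.number (cls p) p rfl (φ p l)))) : Fin n) = _
  rw [Equiv.symm_apply_apply, Equiv.symm_apply_apply]

theorem Reference.carries_number (R : Reference n k) (a : Assembly n k) {p : Pos n k}
    (hp : #(outer p) = n) :
    Carries ((R.number (cls p) p rfl).symm.trans (R.orientation a (cls p) p rfl).symm) := by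
  have e : (R.number (cls p) p rfl).symm.trans (R.orientation a (cls p) p rfl).symm =
      (a.face p).trans (R.right (cls p) (a.place p) (cls_place a rfl)).symm := by
    ext l : 1
    simp [Reference.orientation]
  rw [e]
  exact (a.carries_face_of_card_outer hp).trans (R.carries_right _ _ _).symm

open Classical in
/-- The orientation invariants take all values, independently of places and parities. -/
theorem Reference.exists_O (R : Reference n k) (a : Assembly n k)
    (o : ∀ K, Abelianization (depGroup (R.base K))) :
    ∃ b : Assembly n k, b.place = a.place ∧ (∀ p, R.IsDep b p ↔ R.IsDep a p) ∧
      ∀ K, R.O K b = o K := by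
  have hδ : ∀ K, ∃ δ : depGroup (R.base K), Abelianization.of δ = (R.O K a)⁻¹ * o K := fun K =>
    QuotientGroup.mk_surjective _
  choose δ hδ using hδ
  -- In each class a single cubie is turned, by an element of the dependent group; this corrects `O`
  -- and keeps every parity.
  let d : ∀ K, Pos n k → depGroup (R.base K) := fun K p => if p = R.base K then δ K else 1
  obtain ⟨b, hb, hor⟩ := R.exists_assembly a.place a.linked_place
    (fun p => R.orientation a (cls p) p rfl * d (cls p) p) (by
      intro p
      rcases (by simpa using card_le_univ (outer p) : #(outer p) ≤ n).lt_or_eq with h | h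
      · exact Or.inl h
      · refine Or.inr ?_
        have h1 := (R.carries_number a h).trans
          (mem_depGroup.1 (inv_mem (d (cls p) p).2))
        exact h1)
  have hor' : ∀ K p (hp : cls p = K), R.orientation b K p hp = R.orientation a K p hp * d K p := by
    rintro K p rfl; exact hor p
  refine ⟨b, hb, fun p => ?_, fun K => ?_⟩
  · unfold Reference.IsDep
    rw [hor p]
    exact Subgroup.mul_mem_cancel_right _ (d (cls p) p).2
  · have h1 : R.O K b = R.O K a * ∏ p : {p : Pos n k // cls p = K}, Abelianization.of (d K p) := by
      unfold Reference.O
      rw [← prod_mul_distrib]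
      refine prod_congr rfl fun p _ => ?_
      rw [← map_mul]
      exact congrArg _ (R.depOrientation_mul a b p.2 p.2 _ (hor' K p p.2))
    rw [h1, prod_eq_single (⟨R.base K, R.cls_base K⟩ : {p : Pos n k // cls p = K})]
    · simp only [d, if_true, hδ, mul_inv_cancel_left]
    · intro p _ hp
      have : (p : Pos n k) ≠ R.base K := fun e => hp (Subtype.ext e)
      simp only [d, if_neg this, map_one]
    · exact fun h => absurd (mem_univ _) h

open Classical in
/-- The parities of the orientations in the nontrivial alternating clusters are arbitrary. -/
theorem Reference.exists_isDep (hk : 2 ≤ k) (R : Reference n k) (a : Assembly n k)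
    (T : Set (Pos n k)) : ∃ b : Assembly n k, b.place = a.place ∧
      ∀ p, Chiral p → 1 < #(outer p) → #(outer p) < n → (R.IsDep b p ↔ p ∈ T) := by
  have hodd : ∀ p : Pos n k, ∃ π : Equiv.Perm (outer (R.base (cls p))),
      Chiral p → 1 < #(outer p) → π ∉ depGroup (R.base (cls p)) := by
    intro p
    by_cases h : Chiral p ∧ 1 < #(outer p)
    · have hD := depGroup_of_chiral hk (h.1.of_linked (R.linked_base p))
      have hc := (R.linked_base p).card_outer
      obtain ⟨x, hx, y, hy, hxy⟩ := one_lt_card.1 (h.2.trans_eq hc.symm)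
      refine ⟨Equiv.swap ⟨x, hx⟩ ⟨y, hy⟩, fun _ _ => ?_⟩
      rw [hD, Equiv.Perm.mem_alternatingGroup, Equiv.Perm.sign_swap fun e =>
        hxy (congrArg Subtype.val e)]
      decide
    · exact ⟨1, fun h1 h2 => absurd ⟨h1, h2⟩ h⟩
  choose π hπ using hodd
  obtain ⟨b, hb, hor⟩ := R.exists_assembly a.place a.linked_place
    (fun p => if #(outer p) < n then (if p ∈ T then 1 else π p)
      else R.orientation a (cls p) p rfl) (by
      intro p
      by_cases h : #(outer p) < n
      · exact Or.inl h
      · have h' : #(outer p) ≤ n := by simpa using card_le_univ (outer p)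
        refine Or.inr ?_
        rw [if_neg h]
        exact R.carries_number a (by omega))
  refine ⟨b, hb, fun p h1 h2 h3 => ?_⟩
  unfold Reference.IsDep
  rw [hor p, if_pos h3]
  split_ifs with hT
  · exact iff_of_true (one_mem _) hT
  · exact iff_of_false (hπ p h1 h2) hT

/-! ### Independence of the invariants -/

/-- If all axes were outer, the colours would determine the cubie and the cluster would have one
element. So an inner factor exists and the orientation is unrestricted. -/
theorem IsAltCluster.exists_mem (hn : 3 ≤ n) (hk : 2 ≤ k) {s : Finset (Pos n k)}
    (hs : IsAltCluster s) {p : Pos n k} (hp : p ∈ s) :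
    cluster p = s ∧ Chiral p ∧ 1 < #(outer p) ∧ #(outer p) < n := by
  obtain ⟨q, rfl, h1, h2, h3⟩ := hs
  have hc := cluster_eq_of_mem hn hp
  have hl := ((mem_cluster hn).1 hp).1
  have hq := (depGroup_eq_alternating_iff hk h2).1 h3
  refine ⟨hc, hq.of_linked hl, by rwa [hl.card_outer], ?_⟩
  rw [hl.card_outer]
  by_contra hcard
  have hu : outer q = univ := by
    apply (card_eq_iff_eq_univ _).1
    have := card_le_univ (outer q)
    rw [Fintype.card_fin] at *
    omega
  obtain ⟨x, hx, y, hy, hxy⟩ := one_lt_card.1 h1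
  rw [mem_cluster hn] at hx hy
  refine hxy (funext fun l => ?_)
  rw [hx.2.2 l (by rw [hu]; exact mem_univ l), hy.2.2 l (by rw [hu]; exact mem_univ l)]

open Classical in
theorem Reference.exists_Cl (hn : 3 ≤ n) (hk : 2 ≤ k) (R : Reference n k) (a : Assembly n k)
    (c : Finset (Pos n k) → ℕ) (hc : ∀ s, IsAltCluster s → c s ≤ #s) :
    ∃ b : Assembly n k, b.place = a.place ∧ ∀ s, IsAltCluster s → R.Cl s b = c s := by
  have h1 : ∀ s : Finset (Pos n k), ∃ t ⊆ s, IsAltCluster s → #t = c s := by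
    intro s
    by_cases hs : IsAltCluster s
    · obtain ⟨t, ht, htc⟩ := exists_subset_card_eq (hc s hs)
      exact ⟨t, ht, fun _ => htc⟩
    · exact ⟨∅, empty_subset s, fun h => absurd h hs⟩
  choose t ht htc using h1
  obtain ⟨b, hb, hdep⟩ := R.exists_isDep hk a {p | p ∈ t (cluster p)}
  refine ⟨b, hb, fun s hs => ?_⟩
  rw [R.Cl_eq_card, ← htc s hs]
  congr 1
  ext p
  rw [mem_filter]
  constructor
  · rintro ⟨hp, hd⟩
    obtain ⟨h2, h3, h4, h5⟩ := hs.exists_mem hn hk hp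
    have := (hdep p h3 h4 h5).1 hd
    rwa [Set.mem_ofPred_eq, h2] at this
  · intro hp
    obtain ⟨h2, h3, h4, h5⟩ := hs.exists_mem hn hk (ht s hp)
    refine ⟨ht s hp, (hdep p h3 h4 h5).2 ?_⟩
    rw [Set.mem_ofPred_eq, h2]; exact hp

open Classical in
-- The parities are set first. The later correction of `O` uses dependent elements and keeps them,
-- and neither step moves a cubie.
theorem Reference.exists_values (hn : 3 ≤ n) (hk : 2 ≤ k) (R : Reference n k) (a : Assembly n k)
    (o : ∀ K, Abelianization (depGroup (R.base K))) (c : Finset (Pos n k) → ℕ)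
    (hc : ∀ s, IsAltCluster s → c s ≤ #s) :
    ∃ b : Assembly n k, b.place = a.place ∧ (∀ K, R.O K b = o K) ∧
      ∀ s, IsAltCluster s → R.Cl s b = c s := by
  obtain ⟨b, hb, h1⟩ := R.exists_Cl hn hk a c hc
  obtain ⟨b', hb', h2, h3⟩ := R.exists_O b o
  refine ⟨b', hb'.trans hb, h3, fun s hs => ?_⟩
  rw [← h1 s hs, R.Cl_eq_card, R.Cl_eq_card]
  congr 1
  exact filter_congr fun p _ => h2 p

open Classical in
theorem Reference.Cl_le (R : Reference n k) (a : Assembly n k) (s : Finset (Pos n k)) :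
    R.Cl s a ≤ #s := by
  rw [R.Cl_eq_card]; exact card_filter_le _ _

/-- The classes with an orientation invariant and with a prescribed kind of dependent rotation
group. -/
abbrev Reference.OClass (R : Reference n k)
    (D : ∀ P : Pos n k, Subgroup (Equiv.Perm (outer P))) :=
  {K : Cls n k // R.HasO K ∧ depGroup (R.base K) = D (R.base K)}

theorem Reference.range_O (hn : 3 ≤ n) (hk : 2 ≤ k) (R : Reference n k)
    (D : ∀ P : Pos n k, Subgroup (Equiv.Perm (outer P))) :
    Nat.card (Set.range fun (a : Assembly n k) (K : R.OClass D) => R.O K.1 a) =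
      ∏ᶠ K : R.OClass D, Nat.card (Abelianization (depGroup (R.base K.1))) := by
  classical
  obtain ⟨a₀, -⟩ := exists_assembly_place (n := n) (k := k) 1 Linked.refl
  have h : Function.Surjective fun (a : Assembly n k) (K : R.OClass D) => R.O K.1 a := by
    intro o
    obtain ⟨b, -, hb, -⟩ := R.exists_values hn hk a₀
      (fun K => if h : R.HasO K ∧ depGroup (R.base K) = D (R.base K) then o ⟨K, h⟩ else 1)
      (fun _ => 0) (fun _ _ => Nat.zero_le _)
    refine ⟨b, funext fun K => ?_⟩
    simp only [hb, dif_pos K.2]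
  rw [h.range_eq, Nat.card_univ, Nat.card_pi, finprod_eq_prod_of_fintype]

theorem Reference.range_Cl (hn : 3 ≤ n) (hk : 2 ≤ k) (R : Reference n k) :
    Nat.card (Set.range fun (a : Assembly n k) (s : {s : Finset (Pos n k) // IsAltCluster s}) =>
      R.Cl s.1 a) = ∏ᶠ s : {s : Finset (Pos n k) // IsAltCluster s}, (#s.1 + 1) := by
  classical
  obtain ⟨a₀, -⟩ := exists_assembly_place (n := n) (k := k) 1 Linked.refl
  have h : (Set.range fun (a : Assembly n k) (s : {s : Finset (Pos n k) // IsAltCluster s}) =>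
      R.Cl s.1 a) = (Fintype.piFinset fun s : {s : Finset (Pos n k) // IsAltCluster s} =>
        range (#s.1 + 1) : Finset _) := by
    ext c
    rw [mem_coe, Fintype.mem_piFinset]
    constructor
    · rintro ⟨a, rfl⟩ s
      exact mem_range.2 (Nat.lt_succ_of_le (R.Cl_le a s))
    · intro hc
      obtain ⟨b, -, -, hb⟩ := R.exists_values hn hk a₀ (fun _ => 1)
        (fun s => if h : IsAltCluster s then c ⟨s, h⟩ else 0) (by
          intro s hs
          have h1 : c ⟨s, hs⟩ < #s + 1 := mem_range.1 (hc ⟨s, hs⟩)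
          rw [dif_pos hs]
          omega)
      refine ⟨b, funext fun s => ?_⟩
      simp only [hb s.1 s.2, dif_pos s.2]
  rw [h, Nat.card_coe_set_eq, Set.ncard_coe_finset, Fintype.card_piFinset,
    finprod_eq_prod_of_fintype]
  simp

theorem depGroup_eq_or (hk : 2 ≤ k) (P : Pos n k) :
    depGroup P = alternatingGroup (outer P) ∨ depGroup P = ⊤ := by
  by_cases h : Chiral P
  · exact Or.inl (depGroup_of_chiral hk h)
  · exact Or.inr (depGroup_of_not_chiral h)

theorem Reference.sameInvariants_iff (hk : 2 ≤ k) (R : Reference n k) (a b : Assembly n k) :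
    R.SameInvariants a b ↔ (B₁ a, R.B₂ a, R.C a) = (B₁ b, R.B₂ b, R.C b) ∧
      (fun K : R.OClass fun P => alternatingGroup (outer P) => R.O K.1 a) =
        (fun K : R.OClass fun P => alternatingGroup (outer P) => R.O K.1 b) ∧
      (fun K : R.OClass fun _ => ⊤ => R.O K.1 a) = (fun K : R.OClass fun _ => ⊤ => R.O K.1 b) ∧
      (fun s : {s : Finset (Pos n k) // IsAltCluster s} => R.Cl s.1 a) =
        fun s : {s : Finset (Pos n k) // IsAltCluster s} => R.Cl s.1 b := by
  constructor
  · rintro ⟨h1, h2, h3, h4, h5⟩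
    refine ⟨by rw [h1, h2, h3], funext fun K => h4 K.1 K.2.1, funext fun K => h4 K.1 K.2.1,
      funext fun s => h5 s.1 s.2⟩
  · rintro ⟨h1, h2, h3, h4⟩
    simp only [Prod.mk.injEq] at h1
    refine ⟨h1.1, h1.2.1, h1.2.2, fun K hK => ?_, fun s hs => congrFun h4 ⟨s, hs⟩⟩
    rcases depGroup_eq_or hk (R.base K) with h | h
    · exact congrFun h2 ⟨K, hK, h⟩
    · exact congrFun h3 ⟨K, hK, h⟩

theorem card_outer_of_hasO {R : Reference n k} {K : Cls n k} (h : R.HasO K) :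
    1 < #(outer (R.base K)) := by
  by_contra hc
  refine h ?_
  have h1 : Subsingleton (outer (R.base K)) := by
    rw [← Fintype.card_le_one_iff_subsingleton, Fintype.card_coe]; omega
  rw [eq_top_iff]
  intro x _
  rw [Subsingleton.elim x 1]
  exact one_mem _

/-- By completeness the quotient embeds in the product of the four value sets. It fills the product,
since the places can be taken from one assembly and the orientation data from others. -/
theorem Reference.card_quot (hn : 3 ≤ n) (hk : 2 ≤ k) (R : Reference n k) :
    Nat.card (Quot fun s t : State n k => Connected s.1 t.1) =
      Nat.card (Set.range fun a : Assembly n k => (B₁ a, R.B₂ a, R.C a)) *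
      Nat.card (Set.range fun (a : Assembly n k)
        (K : R.OClass fun P => alternatingGroup (outer P)) => R.O K.1 a) *
      Nat.card (Set.range fun (a : Assembly n k) (K : R.OClass fun _ => ⊤) => R.O K.1 a) *
      Nat.card (Set.range fun (a : Assembly n k)
        (s : {s : Finset (Pos n k) // IsAltCluster s}) => R.Cl s.1 a) := by
  classical
  rw [mul_assoc (_ * _), ← Nat.card_prod, ← Nat.card_prod, ← Nat.card_prod]
  let F : Assembly n k → ((Set.range fun a : Assembly n k => (B₁ a, R.B₂ a, R.C a)) ×
      (Set.range fun (a : Assembly n k)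
        (K : R.OClass fun P => alternatingGroup (outer P)) => R.O K.1 a)) ×
      (Set.range fun (a : Assembly n k) (K : R.OClass fun _ => ⊤) => R.O K.1 a) ×
      (Set.range fun (a : Assembly n k)
        (s : {s : Finset (Pos n k) // IsAltCluster s}) => R.Cl s.1 a) := fun a =>
    ((⟨_, a, rfl⟩, ⟨_, a, rfl⟩), ⟨_, a, rfl⟩, ⟨_, a, rfl⟩)
  have hF : ∀ a b, F a = F b ↔ Connected a.paint b.paint := by
    intro a b
    rw [R.connected_iff_sameInvariants hn hk, R.sameInvariants_iff hk]
    constructor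
    · intro h
      exact ⟨congrArg (fun x => x.1.1.1) h, congrArg (fun x => x.1.2.1) h,
        congrArg (fun x => x.2.1.1) h, congrArg (fun x => x.2.2.1) h⟩
    · rintro ⟨h1, h2, h3, h4⟩
      exact Prod.ext (Prod.ext (Subtype.ext h1) (Subtype.ext h2))
        (Prod.ext (Subtype.ext h3) (Subtype.ext h4))
  have hchoose : ∀ s : State n k, s.2.choose.paint = s.1 := fun s => s.2.choose_spec
  let f : Quot (fun s t : State n k => Connected s.1 t.1) → _ :=
    Quot.lift (fun s => F s.2.choose) fun s t h => (hF _ _).2 (by rw [hchoose, hchoose]; exact h)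
  refine Nat.card_eq_of_bijective f ⟨?_, ?_⟩
  · rintro ⟨s⟩ ⟨t⟩ h
    refine Quot.sound ?_
    have h1 := (hF _ _).1 h
    rwa [hchoose, hchoose] at h1
  · rintro ⟨⟨⟨_, a₁, rfl⟩, ⟨_, a₂, rfl⟩⟩, ⟨_, a₃, rfl⟩, ⟨_, a₄, rfl⟩⟩
    obtain ⟨b, hb, hO, hCl⟩ := R.exists_values hn hk a₁
      -- No class with an invariant `O` is of both types: such a class has more than one orientation
      -- face, and then the alternating and the full group differ.
      (fun K => if depGroup (R.base K) = ⊤ then R.O K a₃ else R.O K a₂) (fun s => R.Cl s a₄)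
      (fun s _ => R.Cl_le a₄ s)
    refine ⟨Quot.mk _ ⟨b.paint, b, rfl⟩, ?_⟩
    -- The assembly chosen for the colouring of `b` need not be `b`, but the two look the same and
    -- so have the same invariants.
    have h1 : F (⟨b.paint, b, rfl⟩ : State n k).2.choose = F b :=
      (hF _ _).2 (by rw [hchoose]; exact ⟨[], fun _ => rfl⟩)
    have hplace : ∀ p, b.place p = a₁.place p := fun p => by rw [hb]
    refine h1.trans (Prod.ext (Prod.ext (Subtype.ext ?_) (Subtype.ext (funext fun K => ?_)))
      (Prod.ext (Subtype.ext (funext fun K => ?_)) (Subtype.ext (funext fun s => hCl s.1 s.2))))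
    · change (B₁ b, R.B₂ b, R.C b) = (B₁ a₁, R.B₂ a₁, R.C a₁)
      rw [B₁_congr fun p _ => hplace p, R.B₂_congr fun p _ => hplace p,
        R.C_congr fun _ _ p _ => hplace p]
    · refine (hO K.1).trans (if_neg fun h => ?_)
      have h2 := card_outer_le_one_of_depGroup K.2.2 h
      have h3 := card_outer_of_hasO K.2.1
      omega
    · exact (hO K.1).trans (if_pos K.2.2)

end Existence

end Rubik

namespace Rubik

open Finset

/-! ### The number of values of the frame and central invariants -/

section CountFrame

variable {n k : ℕ}

/-- The cubies of the frame. -/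
abbrev Frame (n k : ℕ) := {p : Pos n k // IsCentral 1 p}

/-- The opposite positions in the frame. -/
def frameOpp (n k : ℕ) : Equiv.Perm (Frame n k) where
  toFun p := ⟨opp p, isCentral_opp p.2⟩
  invFun p := ⟨opp p, isCentral_opp p.2⟩
  left_inv p := Subtype.ext (opp_opp p.1)
  right_inv p := Subtype.ext (opp_opp p.1)

/-- The places of the frame cubies. -/
def framePlace (a : Assembly n k) : Equiv.Perm (Frame n k) :=
  a.place.subtypePerm fun p => (isClassSet_central 1 _ _ (a.linked_place p)).symm

/-- The pairs of frame cubies standing at opposite positions, as an involution. -/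
def frameInv (a : Assembly n k) : Equiv.Perm (Frame n k) :=
  (framePlace a)⁻¹ * frameOpp n k * framePlace a

theorem B₁_eq_frameInv (a : Assembly n k) :
    B₁ a = {s | ∃ x : Frame n k, s = {(x : Pos n k), (frameInv a x : Pos n k)}} := by
  rw [B₁_eq]
  ext s
  constructor
  · rintro ⟨q, hq, rfl⟩
    refine ⟨⟨a.place.symm q, hq.of_linked (a.symm_linked q)⟩, ?_⟩
    have : (frameInv a ⟨a.place.symm q, hq.of_linked (a.symm_linked q)⟩ : Pos n k) =
        a.place.symm (opp (a.place (a.place.symm q))) := rfl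
    rw [this, Equiv.apply_symm_apply]
  · rintro ⟨x, rfl⟩
    refine ⟨a.place x, x.2.of_linked (a.linked_place x), ?_⟩
    rw [Equiv.symm_apply_apply]
    rfl

theorem B₁_eq_iff (hk : 2 ≤ k) (hodd : Odd k) {a b : Assembly n k} :
    B₁ a = B₁ b ↔ frameInv a = frameInv b := by
  constructor
  · intro h
    obtain ⟨τ, hτ⟩ := exists_frameAct_of_B₁_eq hk hodd h
    ext x : 2
    have h1 := (hτ (a.place x) (x.2.of_linked (a.linked_place x))).2
    rw [relPerm_apply_place] at h1
    change a.place.symm (opp (a.place x)) = b.place.symm (opp (b.place x))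
    rw [← h1]
    simp [relPerm]
  · intro h
    rw [B₁_eq_frameInv, B₁_eq_frameInv, h]

theorem exists_framePlace (hn : 3 ≤ n) (π : Equiv.Perm (Frame n k)) :
    ∃ a : Assembly n k, framePlace a = π := by
  classical
  have h1 : ∀ p, Linked p (Equiv.Perm.ofSubtype π p) := by
    intro p
    by_cases hp : IsCentral 1 p
    · rw [Equiv.Perm.ofSubtype_apply_of_mem π hp]
      exact hp.linked (by omega) (π ⟨p, hp⟩).2
    · rw [Equiv.Perm.ofSubtype_apply_of_not_mem π hp]
      exact Linked.refl p
  obtain ⟨a, ha⟩ := exists_assembly_place _ h1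
  refine ⟨a, ?_⟩
  ext x : 2
  change a.place x = π x
  rw [ha, Equiv.Perm.ofSubtype_apply_of_mem π x.2]

/-- Frame cubies can be placed by an arbitrary permutation, and the pairing is the opposition
conjugated by that permutation. -/
theorem range_frameInv (hn : 3 ≤ n) :
    Set.range (frameInv (n := n) (k := k)) = {g | IsConj (frameOpp n k) g} := by
  ext g
  rw [Set.mem_ofPred_eq, isConj_iff]
  constructor
  · rintro ⟨a, rfl⟩
    exact ⟨(framePlace a)⁻¹, by rw [inv_inv]; rfl⟩
  · rintro ⟨c, rfl⟩
    obtain ⟨a, ha⟩ := exists_framePlace hn c⁻¹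
    exact ⟨a, by rw [frameInv, ha, inv_inv]⟩

theorem card_frame (hk : 2 ≤ k) (hodd : Odd k) : Nat.card (Frame n k) = 2 * n := by
  choose P hP hPl using fun l => exists_frame hk hodd (n := n) l
  let f : Fin n × Bool → Frame n k := fun x =>
    if x.2 then ⟨P x.1, hP x.1⟩ else ⟨opp (P x.1), isCentral_opp (hP x.1)⟩
  have hf : ∀ x, outer (f x : Pos n k) = {x.1} := by
    rintro ⟨l, c⟩
    cases c
    · exact (outer_opp (P l)).trans (hPl l)
    · exact hPl l
  have hbij : Function.Bijective f := by
    constructor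
    · rintro ⟨l, c⟩ ⟨l', c'⟩ h
      have h1 : l = l' := by
        have := hf (l, c)
        rw [h, hf] at this
        exact (singleton_inj.1 this).symm
      subst h1
      have h2 := congrArg Subtype.val h
      have h3 := opp_ne hk one_pos (hP l)
      cases c <;> cases c' <;> first | rfl | exact absurd h2 h3 | exact absurd h2.symm h3
    · rintro ⟨p, hp⟩
      obtain ⟨l, hl⟩ := hp.exists_axis
      rcases (hP l).eq_or_eq_opp hp (hl.trans (hPl l).symm) with rfl | rfl
      · exact ⟨(l, true), rfl⟩
      · exact ⟨(l, false), rfl⟩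
  rw [← Nat.card_congr (Equiv.ofBijective f hbij), Nat.card_prod, Nat.card_fin,
    Nat.card_eq_fintype_card, Fintype.card_bool, mul_comm]

/-- The pairings form the conjugacy class of an involution without fixed points on `2 * n` cubies,
whose centralizer has order `2 ^ n * n!`. -/
theorem card_range_B₁ (hn : 3 ≤ n) (hk : 2 ≤ k) (hodd : Odd k) :
    Nat.card (Set.range (B₁ (n := n) (k := k))) * (2 ^ n * n.factorial) = (2 * n).factorial := by
  classical
  have h1 : Nat.card (Set.range (B₁ (n := n) (k := k))) =
      Nat.card {g | IsConj (frameOpp n k) g} := by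
    rw [← range_frameInv hn]
    refine Nat.card_congr (Equiv.ofBijective (fun s => ⟨frameInv s.2.choose, _, rfl⟩) ⟨?_, ?_⟩)
    · rintro ⟨s, hs⟩ ⟨t, ht⟩ h
      have h2 := (B₁_eq_iff hk hodd).2 (congrArg Subtype.val h)
      rw [hs.choose_spec, ht.choose_spec] at h2
      exact Subtype.ext h2
    · rintro ⟨_, a, rfl⟩
      have h : ∃ b : Assembly n k, B₁ b = B₁ a := ⟨a, rfl⟩
      exact ⟨⟨B₁ a, h⟩, Subtype.ext ((B₁_eq_iff hk hodd).1 h.choose_spec)⟩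
  have hcard := card_frame (n := n) hk hodd
  rw [Nat.card_eq_fintype_card] at hcard
  have hne : ∀ x, frameOpp n k x ≠ x := fun x h => opp_ne hk one_pos x.2 (congrArg Subtype.val h)
  have hsupp : #(frameOpp n k).support = 2 * n := by
    rw [← hcard, ← card_univ]
    congr 1
    ext x
    simp [hne]
  have hord : orderOf (frameOpp n k) = 2 := by
    have : Fact (Nat.Prime 2) := ⟨Nat.prime_two⟩
    refine orderOf_eq_prime ?_ fun h => ?_
    · ext x : 2
      exact opp_opp x.1
    · rw [h, Equiv.Perm.support_one, card_empty] at hsupp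
      omega
  have hct : (frameOpp n k).cycleType = Multiset.replicate n 2 := by
    obtain ⟨m, hm⟩ := Equiv.Perm.cycleType_prime_order (hord ▸ Nat.prime_two)
    have h2 := Equiv.Perm.sum_cycleType (frameOpp n k)
    rw [hm, hord, Multiset.sum_replicate, hsupp, smul_eq_mul] at h2
    rw [hm, hord]
    congr 1
    omega
  have h3 := Equiv.Perm.card_isConj_mul_eq (frameOpp n k)
  rw [hct, Multiset.sum_replicate, Multiset.prod_replicate,
    Multiset.toFinset_replicate, if_neg (by omega), prod_singleton, Multiset.count_replicate_self,
    hcard, smul_eq_mul, mul_comm n 2, Nat.sub_self, Nat.factorial_zero, one_mul] at h3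
  rw [h1, ← h3]

theorem exists_swap_assembly (a : Assembly n k) {x y : Pos n k} (hxy : Linked x y) :
    ∃ b : Assembly n k, b.place = a.place.trans (Equiv.swap x y) ∧
      relPerm a b = Equiv.swap x y := by
  have h1 : ∀ z, Linked z (Equiv.swap x y z) := by
    intro z
    rw [Equiv.swap_apply_def]
    split_ifs with h1 h2
    · exact h1 ▸ hxy
    · exact h2 ▸ hxy.symm
    · exact Linked.refl z
  obtain ⟨b, hb⟩ := exists_assembly_place (a.place.trans (Equiv.swap x y))
    fun p => (a.linked_place p).trans (h1 _)
  refine ⟨b, hb, ?_⟩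
  rw [relPerm, hb]
  ext1 p
  simp

/-- Exchanging two opposite frame cubies keeps all pairs and fixes all axes, but is odd on the
frame. -/
theorem Reference.exists_B₂ (hn : 3 ≤ n) (hk : 2 ≤ k) (hodd : Odd k) (R : Reference n k)
    (a : Assembly n k) (e : ℤˣ) : ∃ b : Assembly n k, B₁ b = B₁ a ∧ R.B₂ b = e := by
  by_cases he : R.B₂ a = e
  · exact ⟨a, rfl, he⟩
  obtain ⟨q, hq, -⟩ := exists_frame hk hodd (⟨0, by omega⟩ : Fin n)
  have hq' := isCentral_opp hq
  have hne := (opp_ne hk one_pos hq).symm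
  obtain ⟨b, -, hb⟩ := exists_swap_assembly a (hq.linked (by omega) hq')
  have hcases : ∀ r : Pos n k, IsCentral 1 r → r = q ∨ r = opp q ∨
      Equiv.swap q (opp q) r = r := by
    intro r _
    by_cases h1 : r = q
    · exact Or.inl h1
    · by_cases h2 : r = opp q
      · exact Or.inr (Or.inl h2)
      · exact Or.inr (Or.inr (Equiv.swap_apply_of_ne_of_ne h1 h2))
  have hact : FrameAct (relPerm a b) 1 := by
    rw [hb]
    have hmap : ∀ s : Finset (Fin n), s.map (1 : Equiv.Perm (Fin n)).toEmbedding = s := fun s => by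
      ext x; simp; rfl
    intro r hr
    rw [hmap]
    rcases hcases r hr with rfl | rfl | h
    · rw [Equiv.swap_apply_left, Equiv.swap_apply_right, opp_opp, outer_opp]
      exact ⟨rfl, rfl⟩
    · rw [Equiv.swap_apply_right, opp_opp, Equiv.swap_apply_left, outer_opp]
      exact ⟨rfl, rfl⟩
    · by_cases h1 : opp r = q
      · obtain rfl : r = opp q := by rw [← h1, opp_opp]
        rw [Equiv.swap_apply_right] at h
        exact absurd h hne
      · by_cases h2 : opp r = opp q
        · obtain rfl : r = q := by rw [← opp_opp r, h2, opp_opp]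
          rw [Equiv.swap_apply_left] at h
          exact absurd h.symm hne
        · rw [h, Equiv.swap_apply_of_ne_of_ne h1 h2]
          exact ⟨rfl, rfl⟩
  have hB : B₁ a = B₁ b := by
    rw [B₁_eq_iff hk hodd]
    ext x : 2
    have h1 := (hact (a.place x) (x.2.of_linked (a.linked_place x))).2
    rw [relPerm_apply_place] at h1
    change a.place.symm (opp (a.place x)) = b.place.symm (opp (b.place x))
    rw [← h1]
    simp [relPerm]
  have h2 := R.B₂_eq_iff hk hodd hB hact
  rw [hb, signOn_swap hne hq hq' fun _ _ => rfl, map_one, mul_one] at h2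
  refine ⟨b, hB.symm, ?_⟩
  rcases Int.units_eq_one_or e with rfl | rfl <;>
    rcases Int.units_eq_one_or (R.B₂ b) with h3 | h3 <;>
    rcases Int.units_eq_one_or (R.B₂ a) with h4 | h4 <;> rw [h3, h4] at h2 <;> simp_all

/-- Exchanging two opposite corners changes the sign of the central class `n` only and leaves the
frame alone. -/
theorem Reference.exists_C (hn : 3 ≤ n) (hk : 2 ≤ k) (hodd : Odd k) (R : Reference n k)
    (a : Assembly n k) (e : ℤˣ) :
    ∃ b : Assembly n k, B₁ b = B₁ a ∧ R.B₂ b = R.B₂ a ∧ R.C b = e := by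
  by_cases he : R.C a = e
  · exact ⟨a, rfl, rfl, he⟩
  let x : Pos n k := fun _ => ⟨0, by omega⟩
  have hx : IsCentral n x := by
    have : outer x = univ := by ext l; simp [mem_outer, x, kd_def]
    exact ⟨by rw [this, card_univ, Fintype.card_fin], fun l hl => absurd (mem_univ l) (this ▸ hl)⟩
  have hx' := isCentral_opp hx
  have hne := (opp_ne hk (by omega) hx).symm
  obtain ⟨b, hb', hb⟩ := exists_swap_assembly a (hx.linked (by omega) hx')
  have hfix : ∀ m, m < n → ∀ r : Pos n k, IsCentral m r → Equiv.swap x (opp x) r = r := by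
    intro m hm r hr
    refine Equiv.swap_apply_of_ne_of_ne ?_ ?_ <;> rintro rfl
    · have := hr.1.symm.trans hx.1; omega
    · have := hr.1.symm.trans hx'.1; omega
  have hplace : ∀ p, IsCentral 1 p → b.place p = a.place p := by
    intro p hp
    rw [hb']
    exact hfix 1 (by omega) _ (hp.of_linked (a.linked_place p))
  refine ⟨b, B₁_congr hplace, R.B₂_congr hplace, ?_⟩
  have h1 : R.C b = R.C a * -1 := by
    rw [R.C_eq hodd, R.C_eq hodd]
    have h2 : ∀ m ∈ Icc 1 n, signOn (IsCentral m) (relPerm R.central b) =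
        signOn (IsCentral m) (relPerm R.central a) * if m = n then -1 else 1 := by
      intro m hm
      rw [← relPerm_mul R.central a b, signOn_mul ((isClassSet_central m).relPerm _ _)
        ((isClassSet_central m).relPerm _ _), mul_comm, hb]
      congr 1
      split_ifs with h
      · subst h; exact signOn_swap hne hx hx' fun _ _ => rfl
      · exact signOn_eq_one (hfix m (by have := mem_Icc.1 hm; omega))
    rw [prod_congr rfl h2, prod_mul_distrib, prod_ite_eq', if_pos (mem_Icc.2 (by omega))]
  rw [h1]
  rcases Int.units_eq_one_or e with rfl | rfl <;>
    rcases Int.units_eq_one_or (R.C a) with h4 | h4 <;> rw [h4] at he ⊢ <;> simp_all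

theorem Reference.card_central_values (hn : 3 ≤ n) (hk : 2 ≤ k) (R : Reference n k) :
    Nat.card (Set.range fun a : Assembly n k => (B₁ a, R.B₂ a, R.C a)) = countBC n k := by
  unfold countBC
  by_cases heven : Even k
  · rw [if_pos heven]
    have hodd : ¬ Odd k := Nat.not_odd_iff_even.2 heven
    have hno := fun p : Pos n k => not_isCentral_of_not_odd (m := 1) (by omega) hodd p
    obtain ⟨a₀, -⟩ := exists_assembly_place (n := n) (k := k) 1 Linked.refl
    rw [Nat.card_eq_one_iff_unique]
    refine ⟨⟨?_⟩, ⟨⟨_, a₀, rfl⟩⟩⟩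
    rintro ⟨_, a, rfl⟩ ⟨_, b, rfl⟩
    apply Subtype.ext
    change (B₁ a, R.B₂ a, R.C a) = (B₁ b, R.B₂ b, R.C b)
    rw [R.B₂_of_not_odd hodd, R.B₂_of_not_odd hodd, R.C_of_not_odd hodd, R.C_of_not_odd hodd,
      B₁_congr fun p hp => absurd hp (hno p)]
  · rw [if_neg heven]
    have hodd : Odd k := Nat.not_even_iff_odd.1 heven
    have hrange : (Set.range fun a : Assembly n k => (B₁ a, R.B₂ a, R.C a)) =
        Set.range (B₁ (n := n) (k := k)) ×ˢ (Set.univ : Set (ℤˣ × ℤˣ)) := by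
      ext ⟨s, e, e'⟩
      constructor
      · rintro ⟨a, h⟩
        exact ⟨⟨a, congrArg Prod.fst h⟩, Set.mem_univ _⟩
      · rintro ⟨⟨a, rfl⟩, -⟩
        obtain ⟨b, h1, h2⟩ := R.exists_B₂ hn hk hodd a e
        obtain ⟨c, h3, h4, h5⟩ := R.exists_C hn hk hodd b e'
        refine ⟨c, ?_⟩
        change (B₁ c, R.B₂ c, R.C c) = (B₁ a, e, e')
        rw [h3, h4, h5, h1, h2]
    have h4 : Nat.card (ℤˣ × ℤˣ) = 4 := by
      rw [Nat.card_prod, Nat.card_eq_fintype_card]; rfl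
    rw [hrange, Nat.card_coe_set_eq, Set.ncard_prod, Set.ncard_univ, h4, ← Nat.card_coe_set_eq]
    symm
    apply Nat.div_eq_of_eq_mul_left
    · positivity
    · rw [← card_range_B₁ hn hk hodd]
      -- The four values of `B₂` and `C` turn the factor `2 ^ n` of the centralizer into `2 ^ (n -
      -- 2)`.
      have h5 : 2 ^ n = 4 * 2 ^ (n - 2) := by
        conv_lhs => rw [show n = (n - 2) + 2 by omega, pow_add]
        ring
      rw [h5]
      ring

end CountFrame

end Rubik

namespace Rubik

open Finset

/-! ### Abelianizations of symmetric and alternating groups -/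

section Abelianizations

variable {α : Type*} [Fintype α] [DecidableEq α]

/-- A 3-cycle is conjugate to its inverse and has order 3, so its image in the abelianization has
order dividing 2 and 3. -/
theorem alternatingGroup_le_commutator : alternatingGroup α ≤ commutator (Equiv.Perm α) := by
  rw [← Equiv.Perm.closure_three_cycles_eq_alternating, Subgroup.closure_le]
  intro g hg
  have h1 : Abelianization.of g = 1 := by
    have h2 : Abelianization.of g = (Abelianization.of g)⁻¹ := by
      rw [← map_inv, ← isConj_iff_eq]
      exact MonoidHom.map_isConj Abelianization.of
        (Equiv.Perm.isConj_iff_cycleType_eq.2 (Equiv.Perm.cycleType_inv g).symm)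
    have h3 : Abelianization.of g ^ 3 = 1 := by
      have h4 : g ^ 3 = 1 := by
        have h5 : g.IsThreeCycle := hg
        rw [← h5.orderOf]
        exact pow_orderOf_eq_one g
      rw [← map_pow, h4, map_one]
    rw [pow_succ, pow_two] at h3
    nth_rewrite 1 [h2] at h3
    rwa [inv_mul_cancel, one_mul] at h3
  rw [SetLike.mem_coe, ← Abelianization.ker_of]
  exact h1

theorem card_abelianization_perm (h : 1 < Fintype.card α) :
    Nat.card (Abelianization (Equiv.Perm α)) = 2 := by
  have : Nontrivial α := Fintype.one_lt_card_iff_nontrivial.1 h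
  have e : commutator (Equiv.Perm α) = alternatingGroup α :=
    le_antisymm alternatingGroup.commutator_perm_le alternatingGroup_le_commutator
  exact (congrArg Subgroup.index e).trans alternatingGroup.index_eq_two

theorem card_abelianization_alternating_three (h : Fintype.card α = 3) :
    Nat.card (Abelianization (alternatingGroup α)) = 3 := by
  have hα : Nat.card α = 3 := by rw [Nat.card_eq_fintype_card, h]
  have : Nontrivial α := Fintype.one_lt_card_iff_nontrivial.1 (by omega)
  have h1 : Nat.card (alternatingGroup α) = 3 := by
    rw [nat_card_alternatingGroup, hα]; rfl
  have : Fact (Nat.Prime 3) := ⟨Nat.prime_three⟩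
  have hc : IsCyclic (alternatingGroup α) := isCyclic_of_prime_card h1
  have e : commutator (alternatingGroup α) = ⊥ := by
    rw [commutator_eq_bot_iff_center_eq_top]
    let _ := hc.commGroup
    exact eq_top_iff.2 fun x _ => Subgroup.mem_center_iff.2 fun y => mul_comm y x
  exact (congrArg Subgroup.index e).trans ((Subgroup.index_bot).trans h1)

theorem card_abelianization_alternating_four (h : Fintype.card α = 4) :
    Nat.card (Abelianization (alternatingGroup α)) = 3 := by
  have hα : Nat.card α = 4 := by rw [Nat.card_eq_fintype_card, h]
  have : Nontrivial α := Fintype.one_lt_card_iff_nontrivial.1 (by omega)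
  have h1 : Nat.card (alternatingGroup α) = 12 := by
    rw [nat_card_alternatingGroup, hα]; rfl
  have h2 := Subgroup.card_mul_index (commutator (alternatingGroup α))
  rw [← alternatingGroup.kleinFour_eq_commutator hα,
    alternatingGroup.kleinFour_card_of_card_eq_four hα, h1,
    alternatingGroup.kleinFour_eq_commutator hα] at h2
  have h3 : Nat.card (Abelianization (alternatingGroup α)) =
    (commutator (alternatingGroup α)).index := rfl
  omega

/-- The group is perfect from five points on, and trivial on at most two. -/
theorem card_abelianization_alternating (h3 : Fintype.card α ≠ 3) (h4 : Fintype.card α ≠ 4) :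
    Nat.card (Abelianization (alternatingGroup α)) = 1 := by
  by_cases h : 5 ≤ Fintype.card α
  · have e := commutator_alternatingGroup_eq_top (α := α) (by rwa [Nat.card_eq_fintype_card])
    exact (congrArg Subgroup.index e).trans Subgroup.index_top
  · have h1 := alternatingGroup.eq_bot_of_card_le_two (α := α) (by
      rw [Nat.card_eq_fintype_card]; omega)
    have h2 : Subsingleton (alternatingGroup α) := by
      rw [h1]; infer_instance
    have e : commutator (alternatingGroup α) = ⊤ :=
      eq_top_iff.2 fun x _ => by rw [Subsingleton.elim x 1]; exact one_mem _
    exact (congrArg Subgroup.index e).trans Subgroup.index_top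

end Abelianizations

/-! ### Which classes have an orientation invariant, and how many values it takes. -/

section OrientationClasses

variable {n k : ℕ} (R : Reference n k)

theorem hasO_iff (K : Cls n k) :
    R.HasO K ↔ Nat.card (Abelianization (depGroup (R.base K))) ≠ 1 :=
  not_congr Subgroup.index_eq_one.symm

theorem card_abelianization_of_chiral (hk : 2 ≤ k) {P : Pos n k} (h : Chiral P) :
    Nat.card (Abelianization (depGroup P)) = if #(outer P) = 3 ∨ #(outer P) = 4 then 3 else 1 := by
  rw [depGroup_of_chiral hk h]
  split_ifs with h1
  · rcases h1 with h1 | h1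
    · exact card_abelianization_alternating_three (by rw [Fintype.card_coe, h1])
    · exact card_abelianization_alternating_four (by rw [Fintype.card_coe, h1])
  · rw [not_or] at h1
    exact card_abelianization_alternating (by rw [Fintype.card_coe]; exact h1.1)
      (by rw [Fintype.card_coe]; exact h1.2)

theorem card_abelianization_of_not_chiral {P : Pos n k} (h : ¬ Chiral P) (hP : 1 < #(outer P)) :
    Nat.card (Abelianization (depGroup P)) = 2 := by
  rw [depGroup_of_not_chiral h]
  rw [Nat.card_congr (Subgroup.topEquiv.abelianizationCongr).toEquiv]
  exact card_abelianization_perm (by rwa [Fintype.card_coe])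

theorem mem_OClass_alternating (hk : 2 ≤ k) (K : Cls n k) :
    (R.HasO K ∧ depGroup (R.base K) = alternatingGroup (outer (R.base K))) ↔
      Chiral (R.base K) ∧ (#(outer (R.base K)) = 3 ∨ #(outer (R.base K)) = 4) := by
  constructor
  · rintro ⟨h1, h2⟩
    have h3 := (depGroup_eq_alternating_iff hk (card_outer_of_hasO h1)).1 h2
    refine ⟨h3, ?_⟩
    by_contra h4
    rw [hasO_iff, card_abelianization_of_chiral hk h3, if_neg h4] at h1
    exact h1 rfl
  · rintro ⟨h1, h2⟩
    refine ⟨?_, depGroup_of_chiral hk h1⟩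
    rw [hasO_iff, card_abelianization_of_chiral hk h1, if_pos h2]
    decide

theorem mem_OClass_top (hk : 2 ≤ k) (K : Cls n k) :
    (R.HasO K ∧ depGroup (R.base K) = ⊤) ↔ ¬ Chiral (R.base K) ∧ 2 ≤ #(outer (R.base K)) := by
  constructor
  · rintro ⟨h1, h2⟩
    have h3 := card_outer_of_hasO h1
    exact ⟨(depGroup_eq_top_iff hk h3).1 h2, h3⟩
  · rintro ⟨h1, h2⟩
    refine ⟨?_, depGroup_of_not_chiral h1⟩
    rw [hasO_iff, card_abelianization_of_not_chiral h1 h2]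
    decide

open Classical in
theorem card_range_OA (hn : 3 ≤ n) (hk : 2 ≤ k) :
    Nat.card (Set.range fun (a : Assembly n k)
      (K : R.OClass fun P => alternatingGroup (outer P)) => R.O K.1 a) =
    3 ^ #(univ.filter fun K : Cls n k =>
      Chiral (R.base K) ∧ (#(outer (R.base K)) = 3 ∨ #(outer (R.base K)) = 4)) := by
  rw [R.range_O hn hk, finprod_eq_prod_of_fintype]
  rw [prod_congr rfl fun K _ => (card_abelianization_of_chiral hk
    ((mem_OClass_alternating R hk K.1).1 K.2).1).trans
      (if_pos ((mem_OClass_alternating R hk K.1).1 K.2).2), prod_const, card_univ,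
    Fintype.card_subtype]
  congr 2
  exact filter_congr fun K _ => mem_OClass_alternating R hk K

open Classical in
theorem card_range_OS (hn : 3 ≤ n) (hk : 2 ≤ k) :
    Nat.card (Set.range fun (a : Assembly n k) (K : R.OClass fun _ => ⊤) => R.O K.1 a) =
    2 ^ #(univ.filter fun K : Cls n k => ¬ Chiral (R.base K) ∧ 2 ≤ #(outer (R.base K))) := by
  rw [R.range_O hn hk, finprod_eq_prod_of_fintype]
  have h1 : ∀ K : R.OClass fun _ => ⊤, Nat.card (Abelianization (depGroup (R.base K.1))) = 2 := by
    intro K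
    have h2 := (mem_OClass_top R hk K.1).1 K.2
    exact card_abelianization_of_not_chiral h2.1 h2.2
  rw [prod_congr rfl fun K _ => h1 K, prod_const, card_univ,
    Fintype.card_subtype]
  congr 2
  exact filter_congr fun K _ => mem_OClass_top R hk K

end OrientationClasses

/-! ### The number of classes -/

section CountClasses

variable {n k : ℕ}

theorem exists_perm_of_map_eq {ι β : Type*} [Fintype ι] [DecidableEq β] {f g : ι → β}
    (h : (univ : Finset ι).val.map f = (univ : Finset ι).val.map g) :
    ∃ σ : Equiv.Perm ι, ∀ l, g (σ l) = f l := by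
  have key : ∀ x, Nonempty ({l // f l = x} ≃ {l // g l = x}) := by
    intro x
    have h1 : ∀ f : ι → β, ((univ : Finset ι).val.map f).count x = Fintype.card {l // f l = x} := by
      intro f
      rw [Multiset.count_map, Fintype.card_subtype]
      simp only [eq_comm (a := x)]
      rfl
    exact ⟨Fintype.equivOfCardEq (by rw [← h1, ← h1, h])⟩
  exact ⟨Equiv.ofFiberEquiv fun x => (key x).some, fun l => Equiv.ofFiberEquiv_map _ l⟩

theorem exists_map_eq (t : Multiset ℕ) (h : t.card = n) :
    ∃ f : Fin n → ℕ, (univ : Finset (Fin n)).val.map f = t := by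
  subst h
  have h1 : t.toList.length = t.card := Multiset.length_toList t
  refine ⟨fun i => t.toList.get (i.cast h1.symm), ?_⟩
  rw [Fin.univ_val_map, ← List.ofFn_congr h1]
  exact (congrArg _ (List.ofFn_get t.toList)).trans t.coe_toList

/-- The kinds of the coordinates of a position. -/
def kinds (p : Pos n k) : Multiset ℕ := (univ : Finset (Fin n)).val.map fun l => kd (p l)

theorem Linked.kinds_eq {p q : Pos n k} (h : Linked p q) : kinds q = kinds p := by
  obtain ⟨σ, hσ⟩ := linked_iff.1 h
  have e : ∀ l, kd (p l) = kd (q (σ l)) := fun l => (hσ.kd_eq l).symm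
  unfold kinds
  simp only [e]
  conv_lhs => rw [← Multiset.map_univ_val_equiv σ, Multiset.map_map]
  rfl

/-- Two outer axes have equal kind and can be exchanged to adjust the determinant, so the multiset
of kinds determines the class. With fewer outer axes mirror images may lie in different classes. -/
theorem linked_of_kinds {p q : Pos n k} (h : kinds p = kinds q) (hp : 2 ≤ #(outer p)) :
    Linked p q := by
  obtain ⟨σ, hσ⟩ := exists_perm_of_map_eq h
  exact linked_of_two_le_card_outer hσ hp

theorem count_zero_kinds (p : Pos n k) : (kinds p).count 0 = #(outer p) := by
  have : outer p = univ.filter fun l => 0 = kd (p l) := by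
    ext l; rw [mem_outer, mem_filter, eq_comm]; simp
  rw [this, kinds, Multiset.count_map]
  rfl

theorem card_kinds (p : Pos n k) : (kinds p).card = n := by
  rw [kinds, Multiset.card_map]; exact card_fin n

theorem exists_kinds (t : Multiset ℕ) (h : t.card = n) (h' : ∀ x ∈ t, 2 * x + 1 ≤ k) :
    ∃ p : Pos n k, kinds p = t := by
  obtain ⟨f, rfl⟩ := exists_map_eq t h
  have h1 : ∀ l, 2 * f l + 1 ≤ k := fun l => h' _ (Multiset.mem_map_of_mem f (mem_univ l))
  refine ⟨fun l => ⟨f l, by have := h1 l; omega⟩, ?_⟩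
  unfold kinds
  congr 1
  funext l
  rw [kd_def]
  have := h1 l
  exact min_eq_left (show f l ≤ k - 1 - f l by omega)

/-- The kinds of the inner coordinates. -/
def innerKinds (p : Pos n k) : Multiset ℕ := (kinds p).filter fun x => x ≠ 0

theorem kinds_eq_add (p : Pos n k) :
    kinds p = Multiset.replicate #(outer p) 0 + innerKinds p := by
  rw [← Multiset.filter_add_not (fun x => x = 0) (kinds p)]
  congr 1
  rw [Multiset.filter_eq', count_zero_kinds]

theorem card_innerKinds (p : Pos n k) : (innerKinds p).card = n - #(outer p) := by
  have h := congrArg Multiset.card (kinds_eq_add p)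
  rw [Multiset.card_add, card_kinds, Multiset.card_replicate] at h
  omega

theorem mem_innerKinds {p : Pos n k} {x : ℕ} :
    x ∈ innerKinds p ↔ ∃ l, l ∉ outer p ∧ kd (p l) = x := by
  rw [innerKinds, Multiset.mem_filter, kinds, Multiset.mem_map]
  constructor
  · rintro ⟨⟨l, -, rfl⟩, h⟩
    exact ⟨l, mt mem_outer.1 h, rfl⟩
  · rintro ⟨l, h, rfl⟩
    exact ⟨⟨l, mem_univ l, rfl⟩, mt mem_outer.2 h⟩

theorem innerKinds_eq (p : Pos n k) :
    innerKinds p = (outer p)ᶜ.val.map fun l => kd (p l) := by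
  rw [innerKinds, kinds, Multiset.filter_map]
  congr 1
  have : (outer p)ᶜ = univ.filter fun l => kd (p l) ≠ 0 := by
    ext l; rw [mem_compl, mem_outer]; simp
  rw [this]
  rfl

theorem chiral_iff (p : Pos n k) :
    Chiral p ↔ (innerKinds p).Nodup ∧ ∀ x ∈ innerKinds p, 2 * x + 1 ≠ k := by
  rw [innerKinds_eq, Finset.nodup_map_iff_injOn, ← innerKinds_eq]
  constructor
  · intro h
    refine ⟨fun l hl l' hl' e => ?_, fun x hx => ?_⟩
    · exact (h l' (mem_compl.1 hl')).2 l (mem_compl.1 hl) e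
    · obtain ⟨l, hl, rfl⟩ := mem_innerKinds.1 hx
      exact mt rev_eq_iff.2 (h l hl).1
  · rintro ⟨h1, h2⟩ l hl
    exact ⟨mt rev_eq_iff.1 (h2 _ (mem_innerKinds.2 ⟨l, hl, rfl⟩)), fun l' hl' e =>
      h1 (mem_compl.2 hl') (mem_compl.2 hl) e⟩

theorem innerKinds_bound {p : Pos n k} {x : ℕ} (h : x ∈ innerKinds p) : 1 ≤ x ∧ 2 * x + 1 ≤ k := by
  obtain ⟨l, hl, rfl⟩ := mem_innerKinds.1 h
  exact ⟨Nat.pos_of_ne_zero (mt mem_outer.2 hl), kd_lt _⟩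

open Classical in
/-- The classes with at least two outer axes correspond to multisets of inner kinds. -/
theorem card_classes (R : Reference n k) (hk : 0 < k) {m : ℕ} (hm : 2 ≤ m) (hmn : m ≤ n)
    (A : Finset (Multiset ℕ)) (hA : ∀ u ∈ A, u.card = n - m ∧ ∀ x ∈ u, 1 ≤ x ∧ 2 * x + 1 ≤ k) :
    #(univ.filter fun K : Cls n k => #(outer (R.base K)) = m ∧ innerKinds (R.base K) ∈ A) = #A := by
  refine card_bij (fun K _ => innerKinds (R.base K)) (fun K hK => (mem_filter.1 hK).2.2) ?_ ?_
  · intro K hK K' hK' e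
    have h1 := (mem_filter.1 hK).2.1
    have h2 := (mem_filter.1 hK').2.1
    rw [← R.cls_base K, ← R.cls_base K', cls_eq_iff]
    refine linked_of_kinds ?_ (by omega)
    rw [kinds_eq_add, kinds_eq_add, h1, h2, e]
  · intro u hu
    obtain ⟨h1, h2⟩ := hA u hu
    have h0 : u.count 0 = 0 := Multiset.count_eq_zero.2 fun h => by have := (h2 0 h).1; omega
    obtain ⟨p, hp⟩ := exists_kinds (n := n) (k := k) (Multiset.replicate m 0 + u)
      (by rw [Multiset.card_add, Multiset.card_replicate, h1]; omega) (by
        intro x hx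
        rcases Multiset.mem_add.1 hx with h | h
        · rw [Multiset.eq_of_mem_replicate h]; omega
        · exact (h2 x h).2)
    have hout : #(outer p) = m := by
      rw [← count_zero_kinds, hp, Multiset.count_add, Multiset.count_replicate_self, h0, add_zero]
    have hb := (R.linked_base p).kinds_eq
    have hout' := (R.linked_base p).card_outer
    have hu' : innerKinds (R.base (cls p)) = u := by
      rw [kinds_eq_add, hout', hout, hp] at hb
      exact Multiset.add_right_inj.1 hb
    refine ⟨cls p, mem_filter.2 ⟨mem_univ _, hout'.trans hout, hu' ▸ hu⟩, hu'⟩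

open Classical in
-- The `n - m` inner kinds of a chiral cubie form a set, and `1, …, k / 2 - 1` are the kinds that
-- are neither outer nor self-opposite.
theorem card_classes_chiral (R : Reference n k) (hk : 2 ≤ k) {m : ℕ} (hm : 2 ≤ m) (hmn : m ≤ n) :
    #(univ.filter fun K : Cls n k => #(outer (R.base K)) = m ∧ Chiral (R.base K)) =
      (k / 2 - 1).choose (n - m) := by
  have h1 := card_classes R (by omega) hm hmn
    (((Icc 1 (k / 2 - 1)).powersetCard (n - m)).map ⟨Finset.val, Finset.val_injective⟩) (by
      intro u hu
      obtain ⟨s, hs, rfl⟩ := Finset.mem_map.1 hu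
      rw [mem_powersetCard] at hs
      refine ⟨hs.2, fun x hx => ?_⟩
      have := mem_Icc.1 (hs.1 hx)
      omega)
  rw [card_map, card_powersetCard, Nat.card_Icc, Nat.add_sub_cancel] at h1
  rw [← h1]
  congr 1
  refine filter_congr fun K _ => and_congr_right fun hK => ?_
  rw [chiral_iff, Finset.mem_map]
  constructor
  · rintro ⟨h2, h3⟩
    refine ⟨⟨innerKinds (R.base K), h2⟩, ?_, rfl⟩
    rw [mem_powersetCard]
    refine ⟨fun x hx => ?_, (card_innerKinds _).trans (by rw [hK])⟩
    have h4 := innerKinds_bound (show x ∈ innerKinds (R.base K) from hx)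
    have h5 := h3 x hx
    rw [mem_Icc]
    omega
  · rintro ⟨s, hs, h2⟩
    rw [mem_powersetCard] at hs
    change s.val = _ at h2
    rw [← h2]
    refine ⟨s.nodup, fun x hx => ?_⟩
    have := mem_Icc.1 (hs.1 hx)
    omega

open Classical in
-- Without chirality, repetitions and, for odd `k`, the middle kind are allowed: the inner kinds
-- form any multiset from `1, …, (k - 1) / 2`.
theorem card_classes_all (R : Reference n k) (hk : 2 ≤ k) {m : ℕ} (hm : 2 ≤ m) (hmn : m ≤ n) :
    #(univ.filter fun K : Cls n k => #(outer (R.base K)) = m) =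
      ((k - 1) / 2).multichoose (n - m) := by
  let A : Finset (Multiset ℕ) := univ.map
    ⟨fun u : Sym (Icc 1 ((k - 1) / 2)) (n - m) => u.val.map Subtype.val, fun u v h =>
      Subtype.ext (Multiset.map_injective Subtype.val_injective h)⟩
  have hA : ∀ u, u ∈ A ↔ u.card = n - m ∧ ∀ x ∈ u, 1 ≤ x ∧ 2 * x + 1 ≤ k := by
    intro u
    rw [Finset.mem_map]
    constructor
    · rintro ⟨v, -, rfl⟩
      refine ⟨(Multiset.card_map _ _).trans v.2, fun x hx => ?_⟩
      obtain ⟨y, -, rfl⟩ := Multiset.mem_map.1 hx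
      have := mem_Icc.1 y.2
      omega
    · rintro ⟨h1, h2⟩
      have h3 : ∀ x ∈ u, x ∈ Icc 1 ((k - 1) / 2) := fun x hx => by
        have := h2 x hx
        rw [mem_Icc]; omega
      refine ⟨⟨u.attach.map fun x => ⟨x.1, h3 x.1 x.2⟩, by simpa using h1⟩, mem_univ _, ?_⟩
      change Multiset.map _ (Multiset.map _ _) = _
      rw [Multiset.map_map]
      exact Multiset.attach_map_val u
  have h1 := card_classes R (by omega) hm hmn A fun u hu => (hA u).1 hu
  rw [card_map, card_univ, Sym.card_sym_eq_multichoose, Fintype.card_coe, Nat.card_Icc,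
    Nat.add_sub_cancel] at h1
  rw [← h1]
  congr 1
  refine filter_congr fun K _ => ⟨fun hK => ⟨hK, (hA _).2 ⟨?_, fun x hx => innerKinds_bound hx⟩⟩,
    fun h => h.1⟩
  rw [card_innerKinds, hK]

end CountClasses

end Rubik

namespace Rubik

open Finset

/-! ### The numbers of values of the orientation invariants. -/

section CountOrientations

variable {n k : ℕ}

theorem binom_of_pos {N s : ℕ} (hN : 0 < N) : binom N s = N.choose s := by
  rw [binom, if_pos ⟨by omega, by omega⟩, Int.toNat_natCast, Int.toNat_natCast]

/-- The binomial coefficient with the convention of `binom` agrees with the usual one unless both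
arguments vanish. -/
theorem binom_natCast {N s : ℕ} (h : 0 < N ∨ 0 < s) : binom N s = N.choose s := by
  rcases Nat.eq_zero_or_pos N with rfl | hN
  · rw [binom, if_neg (by omega), Nat.choose_eq_zero_of_lt (by omega)]
  · exact binom_of_pos hN

theorem half_sub_one (hk : 2 ≤ k) : ((k / 2 : ℕ) : ℤ) - 1 = ((k / 2 - 1 : ℕ) : ℤ) := by
  have : 1 ≤ k / 2 := by omega
  push_cast [this]
  rfl

/-- The extra summand repairs the convention that `binom 0 0 = 0`. That coefficient occurs only for
`k ≤ 3`, in the first term if `n = 3` and in the second if `n = 4`. -/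
theorem exponent_OA (hn : 3 ≤ n) (hk : 2 ≤ k) :
    (binom ((k / 2 : ℕ) - 1) (n - 3) + binom ((k / 2 : ℕ) - 1) (n - 4) +
      if (n = 3 ∨ n = 4) ∧ k ≤ 3 then 1 else 0) =
    (k / 2 - 1).choose (n - 3) + if 4 ≤ n then (k / 2 - 1).choose (n - 4) else 0 := by
  rw [half_sub_one hk, show (n : ℤ) - 3 = ((n - 3 : ℕ) : ℤ) by omega]
  by_cases h4 : 4 ≤ n
  · rw [if_pos h4, show (n : ℤ) - 4 = ((n - 4 : ℕ) : ℤ) by omega, binom_natCast (by omega)]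
    by_cases h : n = 4 ∧ k ≤ 3
    · obtain ⟨rfl, hk3⟩ := h
      have h0 : k / 2 - 1 = 0 := by omega
      rw [h0, if_pos ⟨by omega, hk3⟩]
      rfl
    · rw [binom_natCast (by omega), if_neg (by omega), add_zero]
  · have h3 : n = 3 := by omega
    subst h3
    rw [if_neg h4, add_zero]
    have hb : binom ((k / 2 - 1 : ℕ) : ℤ) ((3 : ℕ) - 4) = 0 := if_neg (by omega)
    rw [hb, add_zero]
    by_cases h : k ≤ 3
    · have h0 : k / 2 - 1 = 0 := by omega
      rw [h0, if_pos ⟨by omega, h⟩]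
      rfl
    · rw [if_neg (by omega), add_zero, binom_natCast (by omega)]

open Classical in
theorem Reference.card_OA_values (hn : 3 ≤ n) (hk : 2 ≤ k) (R : Reference n k) :
    Nat.card (Set.range fun (a : Assembly n k)
      (K : R.OClass fun P => alternatingGroup (outer P)) => R.O K.1 a) = countOA n k := by
  rw [card_range_OA R hn hk, countOA, exponent_OA hn hk]
  congr 1
  have h1 : (univ.filter fun K : Cls n k =>
      Chiral (R.base K) ∧ (#(outer (R.base K)) = 3 ∨ #(outer (R.base K)) = 4)) =
      (univ.filter fun K => #(outer (R.base K)) = 3 ∧ Chiral (R.base K)) ∪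
      (univ.filter fun K => #(outer (R.base K)) = 4 ∧ Chiral (R.base K)) := by
    ext K
    simp only [mem_filter, mem_union, mem_univ, true_and]
    tauto
  rw [h1, card_union_of_disjoint, card_classes_chiral R hk (by omega) hn]
  · congr 1
    split_ifs with h4
    · exact card_classes_chiral R hk (by omega) h4
    · rw [card_eq_zero, filter_eq_empty_iff]
      rintro K - ⟨h5, -⟩
      have := card_le_univ (outer (R.base K))
      rw [Fintype.card_fin] at this
      omega
  · rw [disjoint_filter]
    rintro K - h2 h3
    omega

theorem exponent_OS_all {m : ℕ} (hm : 1 ≤ m) :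
    binom (((k - 1) / 2 : ℕ) + m - 1) (((k - 1) / 2 : ℕ) - 1) = ((k - 1) / 2).multichoose m := by
  rw [Nat.multichoose_eq]
  rcases Nat.eq_zero_or_pos ((k - 1) / 2) with h | h
  · rw [h, binom, if_neg (by omega), Nat.choose_eq_zero_of_lt (by omega)]
  · generalize (k - 1) / 2 = r at h
    rw [show (r : ℤ) + m - 1 = ((r + m - 1 : ℕ) : ℤ) by omega,
      show (r : ℤ) - 1 = ((r - 1 : ℕ) : ℤ) by omega, binom_natCast (by omega)]
    rw [← Nat.choose_symm (by omega)]
    congr 1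
    omega

open Classical in
-- The summation index is the number of inner axes, which is at most `n - 2` when there are two
-- outer ones.
theorem sum_card_fiber_outer (R : Reference n k) (P : Cls n k → Prop) :
    #(univ.filter fun K : Cls n k => P K ∧ 2 ≤ #(outer (R.base K))) =
      ∑ m ∈ range (n - 1), #(univ.filter fun K => #(outer (R.base K)) = n - m ∧ P K) := by
  have hle : ∀ K : Cls n k, #(outer (R.base K)) ≤ n := fun K =>
    (card_le_univ _).trans (Fintype.card_fin n).le
  rw [card_eq_sum_card_fiberwise (f := fun K => n - #(outer (R.base K))) (t := range (n - 1))]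
  · refine sum_congr rfl fun m hm => ?_
    rw [mem_range] at hm
    rw [filter_filter]
    congr 1
    refine filter_congr fun K _ => ?_
    have := hle K
    constructor
    · rintro ⟨⟨h1, h2⟩, h3⟩
      exact ⟨by omega, h1⟩
    · rintro ⟨h1, h2⟩
      exact ⟨⟨h2, by omega⟩, by omega⟩
  · intro K hK
    have h1 := (mem_filter.1 hK).2.2
    have := hle K
    simp only [coe_range, Set.mem_Iio]
    omega

open Classical in
-- Each class with at least two outer axes that is not chiral contributes a factor 2; they are
-- counted as all classes minus the chiral ones.
theorem Reference.card_OS_values (hn : 3 ≤ n) (hk : 2 ≤ k) (R : Reference n k) :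
    Nat.card (Set.range fun (a : Assembly n k) (K : R.OClass fun _ => ⊤) => R.O K.1 a) =
      countOS n k := by
  rw [card_range_OS R hn hk, countOS]
  congr 1
  have h1 : #(univ.filter fun K : Cls n k => True ∧ 2 ≤ #(outer (R.base K))) =
      ∑ m ∈ range (n - 1), #(univ.filter fun K => #(outer (R.base K)) = n - m ∧ True) := by
    convert sum_card_fiber_outer R fun _ => True
  have h2 := sum_card_fiber_outer R fun K => Chiral (R.base K)
  have h3 := card_filter_add_card_filter_not (s := univ.filter fun K : Cls n k =>
    True ∧ 2 ≤ #(outer (R.base K))) fun K => Chiral (R.base K)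
  rw [filter_filter, filter_filter] at h3
  have h4 : #(univ.filter fun K : Cls n k =>
      (True ∧ 2 ≤ #(outer (R.base K))) ∧ Chiral (R.base K)) =
      #(univ.filter fun K : Cls n k => Chiral (R.base K) ∧ 2 ≤ #(outer (R.base K))) := by
    congr 1
    exact filter_congr fun K _ => by tauto
  have h5 : #(univ.filter fun K : Cls n k =>
      (True ∧ 2 ≤ #(outer (R.base K))) ∧ ¬ Chiral (R.base K)) =
      #(univ.filter fun K : Cls n k => ¬ Chiral (R.base K) ∧ 2 ≤ #(outer (R.base K))) := by
    congr 1
    exact filter_congr fun K _ => by tauto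
  rw [h4, h5, h1, h2] at h3
  have e1 : ∀ m ∈ range (n - 1), #(univ.filter fun K => #(outer (R.base K)) = n - m ∧ True) =
      ((k - 1) / 2).multichoose m := by
    intro m hm
    rw [mem_range] at hm
    simp only [and_true]
    rw [card_classes_all R hk (by omega) (by omega)]
    congr 1
    omega
  have e2 : ∀ m ∈ range (n - 1), #(univ.filter fun K => #(outer (R.base K)) = n - m ∧
      Chiral (R.base K)) = (k / 2 - 1).choose m := by
    intro m hm
    rw [mem_range] at hm
    rw [card_classes_chiral R hk (by omega) (by omega)]
    congr 1
    omega
  rw [sum_congr rfl e1, sum_congr rfl e2] at h3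
  -- For zero inner axes both sums have the term 1, namely the corners, which cancels; therefore the
  -- sums of the formula begin with 1.
  have e3 : range (n - 1) = insert 0 (Icc 1 (n - 2)) := by
    ext m
    rw [mem_range, mem_insert, mem_Icc]
    omega
  rw [e3, sum_insert (by simp), sum_insert (by simp), Nat.multichoose_zero_right,
    Nat.choose_zero_right] at h3
  have e4 : ∑ m ∈ Icc 1 (n - 2), binom (((k - 1) / 2 : ℕ) + m - 1) (((k - 1) / 2 : ℕ) - 1) =
      ∑ m ∈ Icc 1 (n - 2), ((k - 1) / 2).multichoose m :=
    sum_congr rfl fun m hm => exponent_OS_all (mem_Icc.1 hm).1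
  have e5 : ∑ m ∈ Icc 1 (n - 2), binom ((k / 2 : ℕ) - 1) m =
      ∑ m ∈ Icc 1 (n - 2), (k / 2 - 1).choose m := by
    refine sum_congr rfl fun m hm => ?_
    rw [half_sub_one hk]
    exact binom_natCast (Or.inr (mem_Icc.1 hm).1)
  rw [e4, e5]
  omega

end CountOrientations

end Rubik

namespace Rubik

open Finset

/-! ### The alternating clusters, their sizes and their number. -/

section CountClusters

variable {n k : ℕ}

theorem linked_iff_innerKinds {p q : Pos n k} (hp : 2 ≤ #(outer p)) (h : outer q = outer p) :
    Linked p q ↔ innerKinds p = innerKinds q := by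
  constructor
  · intro hl
    have e := hl.kinds_eq
    rw [kinds_eq_add, kinds_eq_add, h] at e
    exact (Multiset.add_right_inj.1 e).symm
  · intro e
    refine linked_of_kinds ?_ hp
    rw [kinds_eq_add, kinds_eq_add, h, e]

theorem innerKinds_eq_map_univ {p q : Pos n k} (h : outer q = outer p) :
    innerKinds q = (univ : Finset ((outer p)ᶜ : Finset (Fin n))).val.map
      fun l : ((outer p)ᶜ : Finset (Fin n)) => kd (q l) := by
  rw [innerKinds_eq, h]
  conv_lhs => rw [← Finset.attach_map_val (s := (outer p)ᶜ), Finset.map_val, Multiset.map_map]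
  rfl

/-- The position got from `p` by permuting and reflecting its inner coordinates. -/
def innerMove (p : Pos n k) (x : Equiv.Perm ((outer p)ᶜ : Finset (Fin n)) ×
    (((outer p)ᶜ : Finset (Fin n)) → ℤˣ)) : Pos n k := fun l =>
  if h : l ∈ (outer p)ᶜ then flip (x.2 ⟨l, h⟩) (p (x.1 ⟨l, h⟩)) else p l

theorem innerMove_of_mem {p : Pos n k} (x) (l : ((outer p)ᶜ : Finset (Fin n))) :
    innerMove p x l = flip (x.2 l) (p (x.1 l)) := dif_pos l.2

theorem innerMove_of_mem_outer {p : Pos n k} (x) {l : Fin n} (h : l ∈ outer p) :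
    innerMove p x l = p l := dif_neg (by rwa [mem_compl, not_not])

theorem outer_innerMove (p : Pos n k) (x) : outer (innerMove p x) = outer p := by
  ext l
  by_cases h : l ∈ outer p
  · rw [mem_outer, innerMove_of_mem_outer x h, ← mem_outer]
  · have h1 := innerMove_of_mem x ⟨l, mem_compl.2 h⟩
    change innerMove p x l = _ at h1
    rw [mem_outer, h1, kd_flip, ← mem_outer]
    exact ⟨fun h2 => absurd h2 (mem_compl.1 (x.1 ⟨l, mem_compl.2 h⟩).2), fun h2 => absurd h2 h⟩

theorem innerMove_mem_cluster (hn : 3 ≤ n) {p : Pos n k} (hp : 2 ≤ #(outer p)) (x) :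
    innerMove p x ∈ cluster p := by
  refine (mem_cluster hn).2 ⟨(linked_iff_innerKinds hp (outer_innerMove p x)).2 ?_,
    outer_innerMove p x, fun l hl => innerMove_of_mem_outer x hl⟩
  rw [innerKinds_eq_map_univ rfl, innerKinds_eq_map_univ (outer_innerMove p x)]
  simp only [innerMove_of_mem, kd_flip]
  conv_lhs => rw [← Multiset.map_univ_val_equiv x.1, Multiset.map_map]
  rfl

/-- For a chiral cubie the kinds recover the permutation of the inner axes, and no factor is
self-opposite, so the signs are recovered too. -/
theorem innerMove_injective {p : Pos n k} (hp : Chiral p) : Function.Injective (innerMove p) := by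
  have hinj : ∀ l l' : ((outer p)ᶜ : Finset (Fin n)), kd (p l) = kd (p l') → l = l' :=
    fun l l' h => Subtype.ext ((hp l' (mem_compl.1 l'.2)).2 l (mem_compl.1 l.2) h)
  intro x y h
  have h1 : ∀ l, flip (x.2 l) (p (x.1 l)) = flip (y.2 l) (p (y.1 l)) := fun l => by
    rw [← innerMove_of_mem, ← innerMove_of_mem, h]
  have h2 : ∀ l, x.1 l = y.1 l := fun l => hinj _ _ (by rw [← kd_flip (x.2 l), h1, kd_flip])
  refine Prod.ext (Equiv.ext h2) (funext fun l => ?_)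
  have h3 := h1 l
  rw [h2] at h3
  exact flip_injective_left (hp _ (mem_compl.1 (y.1 l).2)).1 h3

theorem exists_innerMove (hn : 3 ≤ n) {p q : Pos n k} (h : q ∈ cluster p)
    (hp : 2 ≤ #(outer p)) : ∃ x, innerMove p x = q := by
  obtain ⟨h1, h2, h3⟩ := (mem_cluster hn).1 h
  rw [linked_iff_innerKinds hp h2, innerKinds_eq_map_univ rfl, innerKinds_eq_map_univ h2] at h1
  obtain ⟨σ, hσ⟩ := exists_perm_of_map_eq h1.symm
  have h4 : ∀ l : ((outer p)ᶜ : Finset (Fin n)), ∃ e, q l = flip e (p (σ l)) :=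
    fun l => kd_eq_iff.1 (hσ l)
  choose e he using h4
  refine ⟨(σ, e), funext fun l => ?_⟩
  by_cases hl : l ∈ outer p
  · rw [innerMove_of_mem_outer _ hl, h3 l hl]
  · exact (innerMove_of_mem (σ, e) ⟨l, mem_compl.2 hl⟩).trans (he _).symm

/-- The cubies of the cluster are the signed rearrangements of the inner factors, without
repetition. -/
theorem card_cluster (hn : 3 ≤ n) {p : Pos n k} (hc : Chiral p) (hp : 2 ≤ #(outer p)) :
    #(cluster p) = (n - #(outer p)).factorial * 2 ^ (n - #(outer p)) := by
  have h1 : #(cluster p) = #(univ.image (innerMove p)) := by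
    congr 1
    ext q
    rw [mem_image]
    constructor
    · intro h
      obtain ⟨x, hx⟩ := exists_innerMove hn h hp
      exact ⟨x, mem_univ x, hx⟩
    · rintro ⟨x, -, rfl⟩
      exact innerMove_mem_cluster hn hp x
  rw [h1, card_image_of_injective _ (innerMove_injective hc), card_univ, Fintype.card_prod,
    Fintype.card_perm, Fintype.card_fun, Fintype.card_units_int, Fintype.card_coe, card_compl,
    Fintype.card_fin]

theorem card_image_eq_card_image {α β γ : Type*} [DecidableEq β] [DecidableEq γ] {s : Finset α}
    {f : α → β} {g : α → γ} (h : ∀ x ∈ s, ∀ y ∈ s, f x = f y ↔ g x = g y) :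
    #(s.image f) = #(s.image g) := by
  have h1 : (s.image fun x => (f x, g x)).image Prod.fst = s.image f := by
    rw [image_image]; rfl
  have h2 : (s.image fun x => (f x, g x)).image Prod.snd = s.image g := by
    rw [image_image]; rfl
  have h3 : Set.InjOn Prod.snd ((s.image fun x => (f x, g x) : Finset (β × γ)) : Set (β × γ)) := by
    intro x hx y hy e
    obtain ⟨a, ha, rfl⟩ := mem_image.1 (mem_coe.1 hx)
    obtain ⟨b, hb, rfl⟩ := mem_image.1 (mem_coe.1 hy)
    exact Prod.ext ((h a ha b hb).2 e) e
  have h4 : Set.InjOn Prod.fst ((s.image fun x => (f x, g x) : Finset (β × γ)) : Set (β × γ)) := by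
    intro x hx y hy e
    obtain ⟨a, ha, rfl⟩ := mem_image.1 (mem_coe.1 hx)
    obtain ⟨b, hb, rfl⟩ := mem_image.1 (mem_coe.1 hy)
    exact Prod.ext e ((h a ha b hb).1 e)
  rw [← h1, ← h2, card_image_of_injOn h4, card_image_of_injOn h3]

open Classical in
/-- The chiral positions with `m` inner axes. -/
noncomputable def chiralPositions (n k m : ℕ) : Finset (Pos n k) :=
  univ.filter fun p => Chiral p ∧ #(outer p) = n - m

theorem mem_chiralPositions {m : ℕ} {p : Pos n k} :
    p ∈ chiralPositions n k m ↔ Chiral p ∧ #(outer p) = n - m := by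
  classical exact mem_filter.trans (and_iff_right (mem_univ p))

/-- The outer axes, those among them with coordinate zero, and the inner kinds. They determine the
cluster of a position. -/
def clusterKey (p : Pos n k) : (Σ _ : Finset (Fin n), Finset (Fin n)) × Multiset ℕ :=
  (⟨outer p, (outer p).filter fun l => (p l : ℕ) = 0⟩, innerKinds p)

/-- An outer coordinate is 0 or `k - 1`, so the set of zeros gives the colours; with at least two
outer axes, the inner kinds give the class. -/
theorem cluster_eq_iff (hn : 3 ≤ n) {p q : Pos n k} (hp : 2 ≤ #(outer p)) :
    cluster p = cluster q ↔ clusterKey p = clusterKey q := by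
  have h1 : cluster p = cluster q ↔ q ∈ cluster p :=
    ⟨fun h => h ▸ mem_cluster_self hn q, fun h => (cluster_eq_of_mem hn h).symm⟩
  rw [h1, mem_cluster hn]
  constructor
  · rintro ⟨h2, h3, h4⟩
    rw [linked_iff_innerKinds hp h3] at h2
    have h5 : ((outer p).filter fun l => (p l : ℕ) = 0) =
        (outer p).filter fun l => (q l : ℕ) = 0 :=
      filter_congr fun l hl => by rw [h4 l hl]
    rw [clusterKey, clusterKey, h2, h3, h5]
  · intro h
    have h2 : outer p = outer q := congrArg (fun x => x.1.1) h
    have h3 : ((outer p).filter fun l => (p l : ℕ) = 0) =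
        (outer q).filter fun l => (q l : ℕ) = 0 := congrArg (fun x => x.1.2) h
    have h4 : innerKinds p = innerKinds q := congrArg (fun x => x.2) h
    refine ⟨(linked_iff_innerKinds hp h2.symm).2 h4, h2.symm, fun l hl => ?_⟩
    have h5 : l ∈ ((outer p).filter fun l => (p l : ℕ) = 0) ↔
        l ∈ (outer q).filter fun l => (q l : ℕ) = 0 := by rw [h3]
    rw [mem_filter, mem_filter, ← h2, and_iff_right hl, and_iff_right hl] at h5
    have h6 := mem_outer.1 hl
    have h7 := mem_outer.1 (h2 ▸ hl)
    rw [kd_def] at h6 h7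
    ext
    omega

theorem exists_clusterKey (hk : 2 ≤ k) {O Z : Finset (Fin n)} (hZ : Z ⊆ O) {S : Finset ℕ}
    (hS : S ⊆ Icc 1 (k / 2 - 1)) (hc : #O + #S = n) :
    ∃ p : Pos n k, Chiral p ∧ clusterKey p = (⟨O, Z⟩, S.val) := by
  have hb : ∀ x ∈ S, 1 ≤ x ∧ 2 * x + 1 < k := fun x hx => by
    have := mem_Icc.1 (hS hx)
    omega
  have e : (Oᶜ : Finset (Fin n)) ≃ S := Finset.equivOfCardEq (by
    rw [card_compl, Fintype.card_fin]; omega)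
  let p : Pos n k := fun l => if l ∈ Z then ⟨0, by omega⟩ else
    if h : l ∈ Oᶜ then ⟨e ⟨l, h⟩, by have := hb _ (e ⟨l, h⟩).2; omega⟩ else ⟨k - 1, by omega⟩
  have hpZ : ∀ l ∈ Z, (p l : ℕ) = 0 := fun l hl => by
    change ((if _ then _ else _ : Fin k) : ℕ) = 0
    rw [if_pos hl]
  have hpI : ∀ l : (Oᶜ : Finset (Fin n)), (p l : ℕ) = e l := fun l => by
    change ((if _ then _ else _ : Fin k) : ℕ) = _
    rw [if_neg (fun h => mem_compl.1 l.2 (hZ h)), dif_pos l.2]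
  have hpO : ∀ l ∈ O, l ∉ Z → (p l : ℕ) = k - 1 := fun l hl h => by
    change ((if _ then _ else _ : Fin k) : ℕ) = _
    rw [if_neg h, dif_neg (by rwa [mem_compl, not_not])]
  have hkd : ∀ l : (Oᶜ : Finset (Fin n)), kd (p l) = e l := fun l => by
    have := hb _ (e l).2
    rw [kd_def, hpI]
    omega
  have hout : outer p = O := by
    ext l
    rw [mem_outer]
    by_cases h : l ∈ O
    · refine iff_of_true ?_ h
      rw [kd_def]
      by_cases h1 : l ∈ Z
      · rw [hpZ l h1]; omega
      · rw [hpO l h h1]; omega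
    · refine iff_of_false ?_ h
      have h1 := hkd ⟨l, mem_compl.2 h⟩
      have h2 := hb _ (e ⟨l, mem_compl.2 h⟩).2
      change kd (p l) = _ at h1
      omega
  have hin : innerKinds p = S.val := by
    rw [innerKinds_eq, hout]
    have h1 : Oᶜ.image (fun l => kd (p l)) = S := by
      ext x
      rw [mem_image]
      constructor
      · rintro ⟨l, hl, rfl⟩
        rw [hkd ⟨l, hl⟩]
        exact (e ⟨l, hl⟩).2
      · intro hx
        refine ⟨e.symm ⟨x, hx⟩, (e.symm ⟨x, hx⟩).2, ?_⟩
        rw [hkd, e.apply_symm_apply]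
    have h2 : Set.InjOn (fun l => kd (p l)) (Oᶜ : Finset (Fin n)) := by
      intro l hl l' hl' h
      have h3 := hkd ⟨l, hl⟩
      have h4 := hkd ⟨l', hl'⟩
      change kd (p l) = kd (p l') at h
      rw [h3, h4] at h
      exact congrArg Subtype.val (e.injective (Subtype.ext h))
    rw [← image_val_of_injOn h2, h1]
  refine ⟨p, (chiral_iff p).2 ?_, ?_⟩
  · rw [hin]
    exact ⟨S.nodup, fun x hx => (hb x hx).2.ne⟩
  · rw [clusterKey, hout, hin]
    congr 2
    ext l
    rw [mem_filter]
    constructor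
    · rintro ⟨h1, h2⟩
      by_contra h3
      rw [hpO l h1 h3] at h2
      omega
    · exact fun h => ⟨hZ h, hpZ l h⟩

/-- A cluster amounts to a choice of `n - m` outer axes, a side for each of them, and `m` of the `k
/ 2 - 1` possible inner kinds. -/
theorem card_image_cluster (hn : 3 ≤ n) (hk : 2 ≤ k) {m : ℕ} (hm : m + 2 ≤ n) :
    #((chiralPositions n k m).image cluster) =
      (k / 2 - 1).choose m * n.choose m * 2 ^ (n - m) := by
  rw [card_image_eq_card_image (g := clusterKey) fun p hp q _ =>
    cluster_eq_iff hn (by rw [(mem_chiralPositions.1 hp).2]; omega)]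
  have h1 : (chiralPositions n k m).image clusterKey =
      ((powersetCard (n - m) (univ : Finset (Fin n))).sigma fun O => O.powerset) ×ˢ
        ((Icc 1 (k / 2 - 1)).powersetCard m).map ⟨Finset.val, Finset.val_injective⟩ := by
    ext ⟨⟨O, Z⟩, t⟩
    rw [mem_image, mem_product, mem_sigma, mem_powersetCard, mem_powerset, Finset.mem_map]
    constructor
    · rintro ⟨p, hp, h⟩
      rw [mem_chiralPositions] at hp
      have h2 : outer p = O := congrArg (fun x => x.1.1) h
      have h3 : ((outer p).filter fun l => (p l : ℕ) = 0) = Z := congrArg (fun x => x.1.2) h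
      have h4 : innerKinds p = t := congrArg (fun x => x.2) h
      obtain ⟨h5, h6⟩ := (chiral_iff p).1 hp.1
      subst h2 h3 h4
      refine ⟨⟨⟨subset_univ _, hp.2⟩, filter_subset _ _⟩, ⟨innerKinds p, h5⟩, ?_, rfl⟩
      rw [mem_powersetCard]
      refine ⟨fun x hx => ?_, (card_innerKinds p).trans (by rw [hp.2]; omega)⟩
      have h7 := innerKinds_bound (show x ∈ innerKinds p from hx)
      have h8 := h6 x hx
      rw [mem_Icc]
      omega
    · rintro ⟨⟨⟨-, h2⟩, h3⟩, S, hS, rfl⟩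
      rw [mem_powersetCard] at hS
      have h5 : #O = n - m := h2
      obtain ⟨p, hp, h⟩ := exists_clusterKey hk h3 hS.1 (by rw [hS.2, h5]; omega)
      refine ⟨p, mem_chiralPositions.2 ⟨hp, ?_⟩, h⟩
      have h4 : outer p = O := congrArg (fun x => x.1.1) h
      rw [h4]
      exact h2
  rw [h1, card_product, card_sigma, card_map, card_powersetCard, Nat.card_Icc, Nat.add_sub_cancel,
    sum_congr rfl fun O hO => (card_powerset O).trans (by rw [(mem_powersetCard.1 hO).2]),
    sum_const, card_powersetCard, card_univ, Fintype.card_fin, Nat.choose_symm (by omega),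
    smul_eq_mul]
  ring

/-- More than one cubie means at least one inner axis, and more than one orientation face means at
least two outer axes; hence the range of `m`. -/
theorem isAltCluster_iff (hn : 3 ≤ n) (hk : 2 ≤ k) {s : Finset (Pos n k)} :
    IsAltCluster s ↔ ∃ m ∈ Icc 1 (n - 2), s ∈ (chiralPositions n k m).image cluster := by
  constructor
  · intro hs
    obtain ⟨p, hp, h1, -⟩ := id hs
    have h2 : p ∈ s := hp ▸ mem_cluster_self hn p
    obtain ⟨-, h3, h4, h5⟩ := hs.exists_mem hn hk h2
    refine ⟨n - #(outer p), mem_Icc.2 (by omega), mem_image.2 ⟨p, ?_, hp.symm⟩⟩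
    exact mem_chiralPositions.2 ⟨h3, by omega⟩
  · rintro ⟨m, hm, hs⟩
    obtain ⟨p, hp, rfl⟩ := mem_image.1 hs
    obtain ⟨h1, h2⟩ := mem_chiralPositions.1 hp
    rw [mem_Icc] at hm
    refine ⟨p, rfl, ?_, by omega, depGroup_of_chiral hk h1⟩
    rw [card_cluster hn h1 (by omega), show n - #(outer p) = m by omega]
    calc 1 < 2 ^ m := Nat.one_lt_two_pow (by omega)
      _ ≤ m.factorial * 2 ^ m := Nat.le_mul_of_pos_left _ (Nat.factorial_pos m)

/-- On each cluster every value from 0 to its size occurs independently, which explains the summand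
1 in each factor. Clusters are grouped by their number of inner axes. -/
theorem Reference.card_Cl_values (hn : 3 ≤ n) (hk : 2 ≤ k) (R : Reference n k) :
    Nat.card (Set.range fun (a : Assembly n k) (s : {s : Finset (Pos n k) // IsAltCluster s}) =>
      R.Cl s.1 a) = countCl n k := by
  classical
  rw [R.range_Cl hn hk, finprod_eq_prod_of_fintype, countCl]
  have h1 : ∏ s : {s : Finset (Pos n k) // IsAltCluster s}, (#s.1 + 1) =
      ∏ s ∈ univ.filter IsAltCluster, (#s + 1) :=
    (Finset.prod_subtype _ (fun s => by rw [mem_filter, and_iff_right (mem_univ s)])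
      fun s : Finset (Pos n k) => #s + 1).symm
  have h2 : univ.filter (IsAltCluster (n := n) (k := k)) =
      (Icc 1 (n - 2)).biUnion fun m => (chiralPositions n k m).image cluster := by
    ext s
    rw [mem_filter, and_iff_right (mem_univ s), mem_biUnion, isAltCluster_iff hn hk]
  rw [h1, h2, prod_biUnion]
  · refine prod_congr rfl fun m hm => ?_
    rw [mem_Icc] at hm
    have h3 : ∀ s ∈ (chiralPositions n k m).image cluster,
        #s + 1 = m.factorial * 2 ^ m + 1 := by
      intro s hs
      obtain ⟨p, hp, rfl⟩ := mem_image.1 hs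
      obtain ⟨h4, h5⟩ := mem_chiralPositions.1 hp
      rw [card_cluster hn h4 (by omega), show n - #(outer p) = m by omega]
    rw [prod_congr rfl h3, prod_const, card_image_cluster hn hk (by omega), half_sub_one hk,
      binom_natCast (Or.inr hm.1), binom_natCast (Or.inl (by omega))]
  · intro i hi j hj hij
    refine disjoint_left.2 fun s hs hs' => hij ?_
    obtain ⟨p, hp, rfl⟩ := mem_image.1 hs
    obtain ⟨q, hq, h⟩ := mem_image.1 hs'
    have h3 := ((mem_cluster hn).1 (h ▸ mem_cluster_self hn q)).1.card_outer
    rw [(mem_chiralPositions.1 hp).2, (mem_chiralPositions.1 hq).2] at h3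
    have h4 := mem_Icc.1 (mem_coe.1 hi)
    have h5 := mem_Icc.1 (mem_coe.1 hj)
    omega

end CountClusters

end Rubik

/-! ### The main theorem. -/

theorem mainTheorem1 (n k : ℕ) (hn : 3 ≤ n) (hk : 2 ≤ k) :
    -- reference data exist
    Nonempty (Rubik.Reference n k) ∧
    (∀ R : Rubik.Reference n k,
      -- completeness of the system of invariants
      (∀ a b : Rubik.Assembly n k,
        Rubik.Connected a.paint b.paint ↔ R.SameInvariants a b) ∧
      -- the numbers of distinct values of the groups of invariants
      Nat.card (Set.range fun a : Rubik.Assembly n k => (Rubik.B₁ a, R.B₂ a, R.C a)) =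
        Rubik.countBC n k ∧
      Nat.card (Set.range fun (a : Rubik.Assembly n k)
        (K : {K : Rubik.Cls n k // R.HasO K ∧
          Rubik.depGroup (R.base K) = alternatingGroup (Rubik.outer (R.base K))}) =>
          R.O K.1 a) = Rubik.countOA n k ∧
      Nat.card (Set.range fun (a : Rubik.Assembly n k)
        (K : {K : Rubik.Cls n k // R.HasO K ∧ Rubik.depGroup (R.base K) = ⊤}) =>
          R.O K.1 a) = Rubik.countOS n k ∧
      Nat.card (Set.range fun (a : Rubik.Assembly n k)
        (s : {s : Finset (Rubik.Pos n k) // Rubik.IsAltCluster s}) => R.Cl s.1 a) =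
          Rubik.countCl n k) ∧
    -- the number of pairwise unconnected states
    Nat.card (Quot fun s t : Rubik.State n k => Rubik.Connected s.1 t.1) =
      Rubik.countBC n k * Rubik.countOA n k * Rubik.countOS n k * Rubik.countCl n k := by
  refine ⟨Rubik.nonempty_reference hn hk, fun R => ⟨R.connected_iff_sameInvariants hn hk,
    R.card_central_values hn hk, R.card_OA_values hn hk, R.card_OS_values hn hk,
    R.card_Cl_values hn hk⟩, ?_⟩
  obtain ⟨R⟩ := Rubik.nonempty_reference hn hk
  rw [R.card_quot hn hk, R.card_central_values hn hk, R.card_OA_values hn hk,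
    R.card_OS_values hn hk, R.card_Cl_values hn hk]
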